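/- **Lemma (Conditional Gains).** Let $H\in(\frac12,1)$, $T>0$, and let $B=(B_t)_{t\in[0,T]}$ be a fractional Brownian motion with Hurst index $H$, i.e. a centered Gaussian process with almost surely continuous paths and covariance $r(t,s)=\frac12\left[t^{2H}+s^{2H}-|t-s|^{2H}\right]$. Let $S_0>0$, $\mu,\sigma\in\mathbb R$, $k\in[0,1)$, put $S_t=S_0\mathrm e^{\mu t+\sigma B_t}$, and let $\mathcal F_t$ be the $\sigma$-algebra generated by $(S_u)_{0\le u\le t}$. Let $f$ be a convex or concave function on $(0,\infty)$ with left derivative $f'$. Let $0=t_0<t_1<\dots<t_N=T$ and write $\Delta t_{i+1}=t_{i+1}-t_i$. For $0\le u\le t\le T$ put $$\hat B_t(u)=B_u-\int_0^u\Psi(t,s|u)\,\mathrm dB_s,\qquad \Psi(t,s|u)=-\frac{\sin(\pi(H-\frac12))}{\pi}\,s^{\frac12-H}(u-s)^{\frac12-H}\int_u^t\frac{z^{H-\frac12}(z-u)^{H-\frac12}}{z-s}\,\mathrm dz,$$ where the integral with respect to $B$ is the Wiener integral (the $L^2$-limit of the elementary integrals of step functions converging to the integrand in the norm $\|g\|^2=H(2H-1)\int_0^u\!\int_0^u|g(s)||g(v)||s-v|^{2H-2}\,\mathrm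 dv\,\mathrm ds$), and $$\hat r(t|u)=r(t,t)-\int_0^u k(t,v)^2\,\mathrm dv,\qquad k(t,s)=\left(H-\tfrac12\right)\sqrt{\frac{2H\,\Gamma(\frac32-H)}{\Gamma(H+\frac12)\Gamma(2-2H)}}\;s^{\frac12-H}\int_s^t z^{H-\frac12}(z-s)^{H-\frac32}\,\mathrm dz .$$ Put $\Delta\hat B_{t_{i+1}}(t_i)=\hat B_{t_{i+1}}(t_i)-B_{t_i}$, and let $\phi$ be the standard normal density. Integrals $\int_0^t g_u\,\mathrm dx_u$ along paths are limits of the forward sums $\sum_j g_{s_j}(x_{s_{j+1}}-x_{s_j})$ over partitions of $[0,t]$ whose mesh tends to $0$. Let $$V^\pi_t=f(S_0)+\int_0^t f'(S_u)\,\mathrm dS_u .$$ Let $\pi^N$ be a discrete strategy: $\pi^N_{t_i}$ is $\mathcal F_{t_i}$-measurable and is the position held on $(t_i,t_{i+1}]$, $0\le i<N$, and the $\mathcal F_0$-measurable variable $\pi^N_{t_{-1}}$ is the position before the trade at time $t_0=0$, so that the path of the strategy equals $\pi^N_{t_{-1}}$ at time $0$ and $\pi^N_{t_i}$ on $(t_i,t_{i+1}]$.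 Put $\Delta\pi^N_{t_i}=\pi^N_{t_i}-\pi^N_{t_{i-1}}$ for $0\le i<N$. With an $\mathcal F_0$-measurable initial wealth $V_0^{\pi^N,k}$, let $$V^{\pi^N,k}_t=V^{\pi^N,k}_0+\int_0^t\pi^N_u\,\mathrm dS_u-\int_0^t kS_u\,|\mathrm d\pi^N_u|,$$ where $|\mathrm d\pi^N|$ is the increment of the total variation of the path of $\pi^N$. For $X\in\{S,\,V^\pi,\,V^{\pi^N,k}\}$ let the conditional gain be $\Delta\hat X_{t_{i+1}}(t_i)=\mathbb E[X_{t_{i+1}}\,|\,\mathcal F_{t_i}]-X_{t_i}$. Then all the integrals above exist (the pathwise ones over each $[0,t]$, $t\in[0,T]$, almost surely), and for every $i\in\{0,\dots,N-1\}$ the following hold. 1. $S_{t_{i+1}}$ is integrable and, almost surely, $$\Delta\hat S_{t_{i+1}}(t_i)=S_{t_i}\left(\int_{-\infty}^\infty\mathrm e^{\mu\Delta t_{i+1}+\sigma\Delta\hat B_{t_{i+1}}(t_i)+\sigma\sqrt{\hat r(t_{i+1}|t_i)}\,z}\,\phi(z)\,\mathrm dz-1\right).$$ 2. If $f(S_{t_{i+1}})$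 is integrable, then so is $V^\pi_{t_{i+1}}$ and, almost surely, $$\Delta\hat V^\pi_{t_{i+1}}(t_i)=\int_{-\infty}^\infty f\left(S_{t_i}\mathrm e^{\mu\Delta t_{i+1}+\sigma\Delta\hat B_{t_{i+1}}(t_i)+\sigma\sqrt{\hat r(t_{i+1}|t_i)}\,z}\right)\phi(z)\,\mathrm dz-f(S_{t_i}).$$ 3. If $V^{\pi^N,k}_{t_{i+1}}$ is integrable, then, almost surely, $$\Delta\hat V^{\pi^N,k}_{t_{i+1}}(t_i)=\pi^N_{t_i}\,\Delta\hat S_{t_{i+1}}(t_i)-kS_{t_i}|\Delta\pi^N_{t_i}|.$$ The integrals over $z$ in 1 and 2 converge absolutely, almost surely. -/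

import Mathlib

open MeasureTheory ProbabilityTheory Filter Topology Set
open scoped ENNReal

noncomputable section

namespace FracBS

/-! ### Fractional Brownian motion -/

/-- The covariance function `r(t,s)` of the fractional Brownian motion with Hurst index `H`. -/
def fbmCov (H t s : ℝ) : ℝ :=
  (1 / 2) * (t ^ (2 * H) + s ^ (2 * H) - |t - s| ^ (2 * H))

/-- `B` is, on the time interval `[0,T]`, a fractional Brownian motion with Hurst index `H`: a
centered Gaussian process with covariance function `r` and almost surely continuous paths. Only the
values `B t` for `t ∈ [0,T]` matter. -/
structure IsFBM {Ω : Type*} [MeasurableSpace Ω] (P : Measure Ω) (H T : ℝ) (B : ℝ → Ω → ℝ) :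
    Prop where
  measurable : ∀ t ∈ Icc (0 : ℝ) T, Measurable (B t)
  gaussian : IsGaussianProcess (fun (t : Icc (0 : ℝ) T) (ω : Ω) => B t ω) P
  mean_zero : ∀ t ∈ Icc (0 : ℝ) T, ∫ ω, B t ω ∂P = 0
  cov_eq : ∀ t ∈ Icc (0 : ℝ) T, ∀ s ∈ Icc (0 : ℝ) T, cov[B t, B s; P] = fbmCov H t s
  continuous_paths : ∀ᵐ ω ∂P, ContinuousOn (fun t => B t ω) (Icc (0 : ℝ) T)

/-! ### Wiener integrals with respect to fractional Brownian motion, `H > 1/2` -/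

/-- Deterministic step functions `∑ⱼ cⱼ 1_{(aⱼ, bⱼ]}` on `[0,u]`. -/
structure StepIntegrand (u : ℝ) where
  n : ℕ
  left : Fin n → ℝ
  right : Fin n → ℝ
  coef : Fin n → ℝ
  left_nonneg : ∀ j, 0 ≤ left j
  left_le_right : ∀ j, left j ≤ right j
  right_le : ∀ j, right j ≤ u

/-- The step function itself. -/
def StepIntegrand.eval {u : ℝ} (φ : StepIntegrand u) (s : ℝ) : ℝ :=
  ∑ j, (Ioc (φ.left j) (φ.right j)).indicator (fun _ => φ.coef j) s

/-- The elementary integral `∑ⱼ cⱼ (B_{bⱼ} - B_{aⱼ})` of a step function. -/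
def StepIntegrand.integral {Ω : Type*} {u : ℝ} (φ : StepIntegrand u) (B : ℝ → Ω → ℝ) (ω : Ω) :
    ℝ :=
  ∑ j, φ.coef j * (B (φ.right j) ω - B (φ.left j) ω)

/-- The squared norm `H(2H-1) ∫₀ᵘ∫₀ᵘ |g(s)| |g(v)| |s-v|^{2H-2} dv ds` on integrands; it dominates
the second moment of the integral of `g` against the fractional Brownian motion. -/
def integrandEnergy (H u : ℝ) (g : ℝ → ℝ) : ℝ≥0∞ :=
  ∫⁻ s in Ioc 0 u, ∫⁻ v in Ioc 0 u,
    ENNReal.ofReal (H * (2 * H - 1) * (|g s| * |g v| * |s - v| ^ (2 * H - 2)))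

/-- `I` is a version of the Wiener integral `∫₀ᵘ g(s) dB_s`: the `L²(P)`-limit of the elementary
integrals of step functions that converge to `g` in the norm of integrands. -/
def IsWienerIntegral {Ω : Type*} [MeasurableSpace Ω] (P : Measure Ω) (B : ℝ → Ω → ℝ)
    (H u : ℝ) (g : ℝ → ℝ) (I : Ω → ℝ) : Prop :=
  AEStronglyMeasurable g (volume.restrict (Ioc 0 u)) ∧ MemLp I 2 P ∧
    ∃ φ : ℕ → StepIntegrand u,
      Tendsto (fun n => integrandEnergy H u (fun s => g s - (φ n).eval s)) atTop (𝓝 0) ∧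
      Tendsto (fun n => eLpNorm (fun ω => (φ n).integral B ω - I ω) 2 P) atTop (𝓝 0)

open Classical in
/-- The Wiener integral `∫₀ᵘ g(s) dB_s` (a version of it; `0` if it does not exist). -/
def wienerIntegral {Ω : Type*} [MeasurableSpace Ω] (P : Measure Ω) (B : ℝ → Ω → ℝ)
    (H u : ℝ) (g : ℝ → ℝ) : Ω → ℝ :=
  if h : ∃ I : Ω → ℝ, IsWienerIntegral P B H u g I then h.choose else 0

/-! ### Prediction law of the fractional Brownian motion -/

/-- The prediction kernel `Ψ(t,s|u)`, for `0 < s < u ≤ t`. -/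
def predKernel (H t u s : ℝ) : ℝ :=
  -(Real.sin (Real.pi * (H - 1 / 2)) / Real.pi) * s ^ (1 / 2 - H) * (u - s) ^ (1 / 2 - H) *
    ∫ z in u..t, z ^ (H - 1 / 2) * (z - u) ^ (H - 1 / 2) / (z - s)

/-- The predicted value `B̂_t(u) = B_u - ∫₀ᵘ Ψ(t,s|u) dB_s`. -/
def condMean {Ω : Type*} [MeasurableSpace Ω] (P : Measure Ω) (B : ℝ → Ω → ℝ) (H t u : ℝ)
    (ω : Ω) : ℝ :=
  B u ω - wienerIntegral P B H u (fun s => predKernel H t u s) ω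

/-- The Volterra (Molchan--Golosov) kernel `k(t,s)`, for `0 < s < t`. -/
def volterraKernel (H t s : ℝ) : ℝ :=
  (H - 1 / 2) *
    Real.sqrt (2 * H * Real.Gamma (3 / 2 - H) / (Real.Gamma (H + 1 / 2) * Real.Gamma (2 - 2 * H))) *
    s ^ (1 / 2 - H) * ∫ z in s..t, z ^ (H - 1 / 2) * (z - s) ^ (H - 3 / 2)

/-- The conditional covariance `r̂(t,s|u) = r(t,s) - ∫₀ᵘ k(t,v) k(s,v) dv`. -/
def condCov (H t s u : ℝ) : ℝ :=
  fbmCov H t s - ∫ v in (0 : ℝ)..u, volterraKernel H t v * volterraKernel H s v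

/-- The conditional variance `r̂(t|u) = r̂(t,t|u)`. -/
def condVar (H t u : ℝ) : ℝ := condCov H t t u

/-- The standard normal density `φ`. -/
def stdNormalPDF (z : ℝ) : ℝ := gaussianPDFReal 0 1 z

/-! ### Pathwise forward integrals -/

/-- The pathwise forward Riemann--Stieltjes integral `∫_a^b g dx` exists and equals `I`: the forward
sums `∑ⱼ g(sⱼ) (x(sⱼ₊₁) - x(sⱼ))` over partitions `a = s₀ ≤ s₁ ≤ ⋯ ≤ sₙ = b` tend to `I` as the mesh
of the partition tends to `0`. -/
def HasForwardIntegral (g x : ℝ → ℝ) (a b I : ℝ) : Prop :=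
  ∀ ε > 0, ∃ δ > 0, ∀ (n : ℕ) (s : ℕ → ℝ), Monotone s → s 0 = a → s n = b →
    (∀ j < n, s (j + 1) - s j < δ) →
    |(∑ j ∈ Finset.range n, g (s j) * (x (s (j + 1)) - x (s j))) - I| < ε

open Classical in
/-- The pathwise forward integral `∫_a^b g dx` (`0` if it does not exist). -/
def forwardIntegral (g x : ℝ → ℝ) (a b : ℝ) : ℝ :=
  if h : ∃ I, HasForwardIntegral g x a b I then h.choose else 0

/-! ### The fractional Black--Scholes market -/

/-- The asset price `S_t = S₀ exp(μ t + σ B_t)`. -/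
def assetPrice {Ω : Type*} (S₀ μ σ : ℝ) (B : ℝ → Ω → ℝ) (t : ℝ) (ω : Ω) : ℝ :=
  S₀ * Real.exp (μ * t + σ * B t ω)

/-- The information `F_t` generated by the process `S` up to time `t`. -/
abbrev past {Ω : Type*} (S : ℝ → Ω → ℝ) (t : ℝ) : MeasurableSpace Ω :=
  ⨆ s ∈ Icc (0 : ℝ) t, MeasurableSpace.comap (S s) inferInstance

/-- The left derivative of `f`. -/
def leftDeriv (f : ℝ → ℝ) (x : ℝ) : ℝ := derivWithin f (Iio x) x

/-- The frictionless value `V^π_t = f(S₀) + ∫₀ᵗ f'(S_u) dS_u` of the replicating strategy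
`π_t = f'(S_t)`, where `f'` is the left derivative. -/
def frictionlessValue {Ω : Type*} (f : ℝ → ℝ) (S : ℝ → Ω → ℝ) (t : ℝ) (ω : Ω) : ℝ :=
  f (S 0 ω) + forwardIntegral (fun u => leftDeriv f (S u ω)) (fun u => S u ω) 0 t

/-- The path of the discrete strategy
`π^N_t = π₋ 1_{{0}}(t) + ∑ᵢ π_{t_i} 1_{(t_i, t_{i+1}]}(t)`, where `pos i = π_{t_i}` is the position
chosen at the trading time `t_i` and `pre = π₋` is the position held before the trade at
time `t_0 = 0`. -/
def strategyPath {Ω : Type*} {N : ℕ} (t : Fin (N + 1) → ℝ) (pre : Ω → ℝ) (pos : Fin N → Ω → ℝ)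
    (u : ℝ) (ω : Ω) : ℝ :=
  ({0} : Set ℝ).indicator (fun _ => pre ω) u +
    ∑ i : Fin N, (Ioc (t i.castSucc) (t i.succ)).indicator (fun _ => pos i ω) u

/-- The trade `Δπ_{t_i} = π_{t_i} - π_{t_{i-1}}` made at time `t_i`; for `i = 0` the previous
position is `pre`. -/
def trade {Ω : Type*} {N : ℕ} (pre : Ω → ℝ) (pos : Fin N → Ω → ℝ) (i : Fin N) (ω : Ω) : ℝ :=
  pos i ω - (Fin.cons pre pos : Fin (N + 1) → Ω → ℝ) i.castSucc ω

/-- The total variation of the path `y` over `[0,u]`. -/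
def totalVariation (y : ℝ → ℝ) (u : ℝ) : ℝ := (eVariationOn y (Icc 0 u)).toReal

/-- The value
`V^{π^N,k}_t = V₀ + ∫₀ᵗ π^N_u dS_u - ∫₀ᵗ k S_u |dπ^N_u|` under proportional transaction costs `k` of
a strategy with paths `y`; here `|dπ^N|` is the increment of the total variation of the path. -/
def valueWithCosts {Ω : Type*} (k : ℝ) (S : ℝ → Ω → ℝ) (v₀ : Ω → ℝ) (y : ℝ → Ω → ℝ)
    (t : ℝ) (ω : Ω) : ℝ :=
  v₀ ω + forwardIntegral (fun u => y u ω) (fun u => S u ω) 0 t -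
    forwardIntegral (fun u => k * S u ω) (totalVariation fun u => y u ω) 0 t

/-- The conditional gain `E[X_t | F_u] - X_u` over `[u,t]` of a process `X`, with respect to the
information `F` generated by `S`. -/
def condGain {Ω : Type*} [MeasurableSpace Ω] (P : Measure Ω) (S X : ℝ → Ω → ℝ) (t u : ℝ)
    (ω : Ω) : ℝ :=
  (P[X t | past S u]) ω - X u ω

end FracBS

end

open MeasureTheory ProbabilityTheory Filter Topology Set
open scoped ENNReal

noncomputable section

namespace FracBS

/-! ### Beta-type integrals -/

/-! The first two formulas rest on a decomposition of `B_b` into its prediction from the past on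
`[0,a]` and an independent Gaussian error; the third is algebra plus a pull-out argument.

Prediction. The kernels `k(t,·)` in `L²(dv)` have the same Gram matrix as the variables `B_t` in
`L²(P)`: writing `k(t,v)` as the integral over `s ≤ t` of `∂k(s,v)/∂s`, the product of two
derivative kernels integrates to `H(2H-1)|s-w|^{2H-2}` (`lintegral_volterraDeriv_mul`, a beta
integral moved by a Möbius map), and the double integral of this is the covariance. Hence `B_t ↦
k(t,·)` preserves inner products of linear combinations, and the elementary integral of a step
function corresponds to its image under the operator with kernel `∂k(s,v)/∂s`. A second Möbius beta
integral, evaluated by Euler's reflection formula, shows that this operator sends `-Ψ(b,·|a)` to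
`k(b,·) - k(a,·)` on `(0,a)` (`volterraLift_predKernel`). So `B_b - B̂_b(a)` corresponds to `k(b,·)`
cut off to `(a,∞)`. That function is orthogonal to every `k(t,·)` with `t ≤ a`, because those vanish
beyond `a`, and its squared norm is `r̂(b|a)`. Joint Gaussianity turns orthogonality into
independence of the whole past, so the error is `N(0, r̂(b|a))` and independent of the past, whereas
`B̂_b(a)` is almost surely determined by it. Freezing the past (`condExp_indep`) gives the Gaussian
integrals.

Change of variables. The frictionless value is almost surely `f(S_t)`. For convex `f` the error of a
forward sum lies between `0` and the sum of `Δf'(S) ΔS`. At dyadic scale `2⁻ⁿ` the path moves by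
`O(rⁿ)` for any `r > 2^{-H}`. The oscillation of a monotone function over a window of width `rⁿ`
around the path, integrated in time, is of expected size `O(rⁿ)`, because the law of `log S_u` has a
density of order `u^{-H}`, integrable in `u`. With about `2ⁿ` intervals the errors at scale `n` sum
to `O((2r²)ⁿ)`, summable when `r < 2^{-1/2}`; this is where `H > 1/2` enters. If `σ = 0` there is no
density, but the path is monotone and the sum telescopes. Concave `f` follows by changing sign.

Transaction costs. A discrete strategy and its total variation are finite combinations of unit
jumps, whose forward integrals are explicit (`hasForwardIntegral_unitJump`,
`hasForwardIntegral_unitJump_right`). The increment of wealth over one period is then explicit, and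
its conditional expectation follows from a pull-out property proved by truncation
(`condExp_add_mul`), as the single terms need not be integrable. -/

theorem lintegral_Ioo_beta {p q : ℝ} (hp : 0 < p) (hq : 0 < q) :
    ∫⁻ y in Ioo (0 : ℝ) 1, ENNReal.ofReal (y ^ (p - 1) * (1 - y) ^ (q - 1)) =
      ENNReal.ofReal (beta p q) := by
  have h := lintegral_betaPDF_eq_one hp hq
  rw [lintegral_betaPDF] at h
  have hb := beta_pos hp hq
  simp_rw [mul_assoc] at h
  simp_rw [ENNReal.ofReal_mul (one_div_pos.2 hb).le] at h
  rw [lintegral_const_mul' _ _ ENNReal.ofReal_ne_top] at h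
  calc _ = ENNReal.ofReal (beta p q) * (ENNReal.ofReal (1 / beta p q) *
        ∫⁻ y in Ioo (0 : ℝ) 1, ENNReal.ofReal (y ^ (p - 1) * (1 - y) ^ (q - 1))) := by
          rw [← mul_assoc, ← ENNReal.ofReal_mul hb.le, mul_one_div_cancel hb.ne',
            ENNReal.ofReal_one, one_mul]
    _ = _ := by rw [h, mul_one]

/-- All powers of `D` cancel: their total exponent is `-2 - (p-1) - (q-1) + (p+q) = 0`. This is why
the third factor must carry exactly the exponent `-(p+q)`. -/
theorem moebius_beta_integrand {A B C D y : ℝ} (h1 : 0 < A) (h2 : 0 < B) (h3 : 0 < C) (hy0 : 0 < y)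
    (hy1 : 0 < 1 - y) (hd : 0 < D) (p q : ℝ) :
    A * C * B / D ^ 2 * ((y * (A * C / D)) ^ (p - 1) * ((1 - y) * (B * A / D)) ^ (q - 1) *
      (C * B / D) ^ (-(p + q))) =
    A ^ (p + q - 1) * C ^ (-q) * B ^ (-p) * (y ^ (p - 1) * (1 - y) ^ (q - 1)) := by
  rw [Real.mul_rpow hy0.le (by positivity), Real.mul_rpow hy1.le (by positivity),
    Real.div_rpow (by positivity) hd.le, Real.div_rpow (by positivity) hd.le,
    Real.div_rpow (by positivity) hd.le, Real.mul_rpow h1.le h3.le, Real.mul_rpow h2.le h1.le,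
    Real.mul_rpow h3.le h2.le]
  have k1 : A ^ (p + q - 1) = A ^ (p - 1) * A ^ (q - 1) * A := by
    rw [← Real.rpow_add h1, ← Real.rpow_add_one h1.ne']; congr 1; ring
  have k2 : C ^ (-q) = C ^ (p - 1) * C ^ (-(p + q)) * C := by
    rw [← Real.rpow_add h3, ← Real.rpow_add_one h3.ne']; congr 1; ring
  have k3 : B ^ (-p) = B ^ (q - 1) * B ^ (-(p + q)) * B := by
    rw [← Real.rpow_add h2, ← Real.rpow_add_one h2.ne']; congr 1; ring
  have k4 : D ^ (p - 1) * D ^ (q - 1) * D ^ (-(p + q)) * D ^ 2 = 1 := by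
    rw [← Real.rpow_add hd, ← Real.rpow_add hd, ← Real.rpow_natCast, ← Real.rpow_add hd]
    convert Real.rpow_zero D using 2; push_cast; ring
  rw [k1, k2, k3]
  have n1 := (Real.rpow_pos_of_pos hd (p - 1)).ne'
  have n2 := (Real.rpow_pos_of_pos hd (q - 1)).ne'
  have n3 := (Real.rpow_pos_of_pos hd (-(p + q))).ne'
  generalize D ^ (p - 1) = d1 at *
  generalize D ^ (q - 1) = d2 at *
  generalize D ^ (-(p + q)) = d3 at *
  generalize A ^ (p - 1) = c1
  generalize A ^ (q - 1) = c2
  generalize C ^ (p - 1) = c3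
  generalize C ^ (-(p + q)) = c4
  generalize B ^ (q - 1) = c5
  generalize B ^ (-(p + q)) = c6
  generalize y ^ (p - 1) = c7
  generalize (1 - y) ^ (q - 1) = c8
  field_simp
  linear_combination (-(c7 * c1 * c3 * c8 * c5 * c2 * c4 * c6)) * k4

/-- The beta integral transported by the Möbius map of `(0,1)` onto `(v,a)` that sends `∞` to a
point beyond which `z` is the pole. -/
theorem lintegral_Ioo_moebius {v a z p q : ℝ} (hva : v < a) (haz : a < z) (hp : 0 < p)
    (hq : 0 < q) :
    ∫⁻ s in Ioo v a, ENNReal.ofReal ((s - v) ^ (p - 1) * (a - s) ^ (q - 1) * (z - s) ^ (-(p + q))) =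
      ENNReal.ofReal (beta p q * ((a - v) ^ (p + q - 1) * (z - v) ^ (-q) * (z - a) ^ (-p))) := by
  have h1 : 0 < a - v := by linarith
  have h2 : 0 < z - a := by linarith
  have h3 : 0 < z - v := by linarith
  set D : ℝ → ℝ := fun y => (z - a) + y * (a - v) with hD
  -- `F` takes `0`, `1`, `∞` to `v`, `a`, `z`, so the distances of `F y` to these three points are
  -- `y`, `1 - y` and `1` divided by `D y`, up to constants.
  set F : ℝ → ℝ := fun y => (v * (z - a) + y * z * (a - v)) / D y with hF
  have hDpos : ∀ y ∈ Ioo (0 : ℝ) 1, 0 < D y := fun y hy => by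
    have := mul_pos hy.1 h1
    simp only [hD]; linarith
  have e1 : ∀ y ∈ Ioo (0 : ℝ) 1, F y - v = y * ((a - v) * (z - v) / D y) := fun y hy => by
    have := (hDpos y hy).ne'
    simp only [hF]; field_simp; simp only [hD]; ring
  have e2 : ∀ y ∈ Ioo (0 : ℝ) 1, a - F y = (1 - y) * ((z - a) * (a - v) / D y) := fun y hy => by
    have := (hDpos y hy).ne'
    simp only [hF]; field_simp; simp only [hD]; ring
  have e3 : ∀ y ∈ Ioo (0 : ℝ) 1, z - F y = (z - v) * (z - a) / D y := fun y hy => by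
    have := (hDpos y hy).ne'
    simp only [hF]; field_simp; simp only [hD]; ring
  have hderiv : ∀ y ∈ Ioo (0 : ℝ) 1,
      HasDerivWithinAt F ((a - v) * (z - v) * (z - a) / (D y) ^ 2) (Ioo 0 1) y := fun y hy => by
    have hd := (hDpos y hy).ne'
    have d1 : HasDerivAt D (a - v) y := by
      simpa [hD] using (hasDerivAt_id y).mul_const (a - v)
    have d2 : HasDerivAt (fun y => v * (z - a) + y * z * (a - v)) (z * (a - v)) y := by
      simpa using (((hasDerivAt_id y).mul_const z).mul_const (a - v)).const_add (v * (z - a))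
    refine ((d2.div d1 hd).congr_deriv ?_).hasDerivWithinAt
    congr 1
    simp only [hD]; ring
  have hinj : InjOn F (Ioo 0 1) := fun x hx y hy hxy => by
    have := e3 x hx
    rw [hxy, e3 y hy, div_eq_div_iff (hDpos y hy).ne' (hDpos x hx).ne'] at this
    have h4 := mul_left_cancel₀ (mul_pos h3 h2).ne' this
    simp only [hD] at h4
    have h5 : x * (a - v) = y * (a - v) := by linarith
    exact mul_right_cancel₀ h1.ne' h5
  have himage : F '' Ioo 0 1 = Ioo v a := by
    ext s
    constructor
    · rintro ⟨y, hy, rfl⟩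
      have a1 : 0 < F y - v := by
        rw [e1 y hy]; exact mul_pos hy.1 (div_pos (mul_pos h1 h3) (hDpos y hy))
      have a2 : 0 < a - F y := by
        rw [e2 y hy]
        exact mul_pos (by linarith [hy.2]) (div_pos (mul_pos h2 h1) (hDpos y hy))
      exact ⟨by linarith, by linarith⟩
    · rintro ⟨hs1, hs2⟩
      have hs3 : 0 < z - s := by linarith
      -- The preimage is read off from the quotient of `e1` and `e3`: `(F y - v) / (z - F y) = y (a
      -- - v) / (z - a)`.
      refine ⟨(s - v) * (z - a) / ((a - v) * (z - s)), ⟨by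
        have : 0 < s - v := by linarith
        positivity, ?_⟩, ?_⟩
      · rw [div_lt_one (by positivity)]
        nlinarith
      · simp only [hF, hD]
        rw [div_eq_iff]
        · field_simp; ring
        · have : 0 < s - v := by linarith
          positivity
  rw [← himage, lintegral_image_eq_lintegral_abs_deriv_mul measurableSet_Ioo hderiv hinj]
  have hb := beta_pos hp hq
  rw [mul_comm (beta p q), ENNReal.ofReal_mul (by positivity), ← lintegral_Ioo_beta hp hq,
    ← lintegral_const_mul' _ _ ENNReal.ofReal_ne_top]
  refine setLIntegral_congr_fun measurableSet_Ioo fun y hy => ?_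
  have hd := hDpos y hy
  have hy0 := hy.1
  have hy1 : 0 < 1 - y := by linarith [hy.2]
  rw [← ENNReal.ofReal_mul (abs_nonneg _), ← ENNReal.ofReal_mul (by positivity), e1 y hy, e2 y hy,
    e3 y hy, abs_of_pos (by positivity)]
  congr 1
  exact moebius_beta_integrand h1 h2 h3 hy0 hy1 hd p q

/-! ### The Molchan--Golosov kernel -/

/-- The normalizing constant of the Molchan--Golosov kernel. -/
def volterraConst (H : ℝ) : ℝ :=
  (H - 1 / 2) *
    Real.sqrt (2 * H * Real.Gamma (3 / 2 - H) / (Real.Gamma (H + 1 / 2) * Real.Gamma (2 - 2 * H)))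

/-- The derivative `∂k(s,v)/∂s` of the Molchan--Golosov kernel, extended by `0`. -/
def volterraDeriv (H s v : ℝ) : ℝ :=
  if 0 < v ∧ v < s then
    volterraConst H * v ^ (1 / 2 - H) * s ^ (H - 1 / 2) * (s - v) ^ (H - 3 / 2) else 0

theorem volterraConst_nonneg {H : ℝ} (hH : 1 / 2 < H) : 0 ≤ volterraConst H :=
  mul_nonneg (by linarith) (Real.sqrt_nonneg _)

theorem volterraDeriv_nonneg {H : ℝ} (hH : 1 / 2 < H) (s v : ℝ) : 0 ≤ volterraDeriv H s v := by
  unfold volterraDeriv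
  split_ifs with h
  · have := volterraConst_nonneg hH
    have h1 : 0 < s := h.1.trans h.2
    have h2 : 0 < s - v := by linarith [h.2]
    have h3 := h.1
    positivity
  · exact le_rfl

theorem measurable_volterraDeriv (H : ℝ) :
    Measurable fun p : ℝ × ℝ => volterraDeriv H p.1 p.2 := by
  unfold volterraDeriv
  refine Measurable.ite ?_ (by fun_prop) measurable_const
  exact (measurableSet_lt measurable_const measurable_snd).inter
    (measurableSet_lt measurable_snd measurable_fst)

/-- This fixes the normalization: the squared constant times the beta value produced by integrating
two derivative kernels must be the factor `H(2H-1)` of the mixed second derivative of the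
covariance. -/
theorem volterraConst_sq {H : ℝ} (hH : 1 / 2 < H) (hH' : H < 1) :
    volterraConst H ^ 2 * beta (2 - 2 * H) (H - 1 / 2) = H * (2 * H - 1) := by
  have g1 : 0 < Real.Gamma (3 / 2 - H) := Real.Gamma_pos_of_pos (by linarith)
  have g2 : 0 < Real.Gamma (H - 1 / 2) := Real.Gamma_pos_of_pos (by linarith)
  have g3 : 0 < Real.Gamma (2 - 2 * H) := Real.Gamma_pos_of_pos (by linarith)
  have g4 : Real.Gamma (H + 1 / 2) = (H - 1 / 2) * Real.Gamma (H - 1 / 2) := by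
    rw [← Real.Gamma_add_one (by linarith)]; congr 1; ring
  have h0 : 0 < H - 1 / 2 := by linarith
  have h1 : 0 < H := by linarith
  unfold volterraConst beta
  rw [show 2 - 2 * H + (H - 1 / 2) = 3 / 2 - H by ring, mul_pow, Real.sq_sqrt (by
    rw [g4]; positivity), g4]
  have : H - 1 / 2 ≠ 0 := h0.ne'
  generalize Real.Gamma (3 / 2 - H) = x at *
  generalize Real.Gamma (H - 1 / 2) = y at *
  generalize Real.Gamma (2 - 2 * H) = z at *
  field_simp

/-- The product of two kernels integrates to the kernel `H(2H-1)|s-w|^{2H-2}`. -/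
theorem lintegral_volterraDeriv_mul_of_lt {H s w : ℝ} (hH : 1 / 2 < H) (hH' : H < 1) (hs : 0 < s)
    (hsw : s < w) :
    ∫⁻ v, ENNReal.ofReal (volterraDeriv H s v) * ENNReal.ofReal (volterraDeriv H w v) =
      ENNReal.ofReal (H * (2 * H - 1) * |s - w| ^ (2 * H - 2)) := by
  have hw := hs.trans hsw
  have hc := volterraConst_nonneg hH
  -- Here `p + q = 3/2 - H`, so the pole exponent is `H - 3/2`, the one in `volterraDeriv H w`; the
  -- two factors `v ^ (1/2 - H)` combine to `v ^ (p - 1)`.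
  have key := lintegral_Ioo_moebius hs hsw (p := 2 - 2 * H) (q := H - 1 / 2) (by linarith)
    (by linarith)
  have e : ∀ v, ENNReal.ofReal (volterraDeriv H s v) * ENNReal.ofReal (volterraDeriv H w v) =
      (Ioo 0 s).indicator (fun v => ENNReal.ofReal (volterraConst H ^ 2 * s ^ (H - 1 / 2) *
        w ^ (H - 1 / 2)) * ENNReal.ofReal ((v - 0) ^ (2 - 2 * H - 1) * (s - v) ^ (H - 1 / 2 - 1) *
        (w - v) ^ (-(2 - 2 * H + (H - 1 / 2))))) v := fun v => by
    by_cases hv : v ∈ Ioo 0 s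
    · rw [indicator_of_mem hv, ← ENNReal.ofReal_mul (volterraDeriv_nonneg hH _ _),
        ← ENNReal.ofReal_mul (by positivity)]
      congr 1
      have hv1 := hv.1
      unfold volterraDeriv
      rw [if_pos ⟨hv.1, hv.2⟩, if_pos ⟨hv.1, hv.2.trans hsw⟩,
        show (2 - 2 * H - 1) = (1 / 2 - H) + (1 / 2 - H) by ring, sub_zero, Real.rpow_add hv1,
        show H - 1 / 2 - 1 = H - 3 / 2 by ring,
        show -(2 - 2 * H + (H - 1 / 2)) = H - 3 / 2 by ring]
      ring
    · rw [indicator_of_notMem hv]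
      have : volterraDeriv H s v = 0 := if_neg fun h => hv ⟨h.1, h.2⟩
      simp [this]
  simp_rw [e]
  rw [lintegral_indicator measurableSet_Ioo, lintegral_const_mul' _ _ ENNReal.ofReal_ne_top, key,
    ← ENNReal.ofReal_mul (by positivity)]
  congr 1
  rw [← volterraConst_sq hH hH', sub_zero, sub_zero, abs_sub_comm, abs_of_pos (by linarith),
    show 2 - 2 * H + (H - 1 / 2) - 1 = -(H - 1 / 2) by ring, show -(2 - 2 * H) = 2 * H - 2 by ring,
    Real.rpow_neg hs.le, Real.rpow_neg hw.le]
  have := (Real.rpow_pos_of_pos hs (H - 1 / 2)).ne'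
  have := (Real.rpow_pos_of_pos hw (H - 1 / 2)).ne'
  field_simp

/-- Symmetric form. The diagonal must be excluded: there the integral diverges, while `0 ^ (2H-2)`
has the value `0`. -/
theorem lintegral_volterraDeriv_mul {H s w : ℝ} (hH : 1 / 2 < H) (hH' : H < 1) (hs : 0 < s)
    (hw : 0 < w) (hsw : s ≠ w) :
    ∫⁻ v, ENNReal.ofReal (volterraDeriv H s v) * ENNReal.ofReal (volterraDeriv H w v) =
      ENNReal.ofReal (H * (2 * H - 1) * |s - w| ^ (2 * H - 2)) := by
  rcases lt_or_gt_of_ne hsw with h | h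
  · exact lintegral_volterraDeriv_mul_of_lt hH hH' hs h
  · rw [abs_sub_comm, ← lintegral_volterraDeriv_mul_of_lt hH hH' hw h]
    simp_rw [mul_comm]

/-- The integral operator with kernel `∂k(s,v)/∂s` on nonnegative functions. -/
def volterraLift (H : ℝ) (h : ℝ → ℝ≥0∞) (v : ℝ) : ℝ≥0∞ :=
  ∫⁻ s, h s * ENNReal.ofReal (volterraDeriv H s v)

theorem measurable_volterraLift (H : ℝ) {h : ℝ → ℝ≥0∞} (hh : Measurable h) :
    Measurable (volterraLift H h) := by
  unfold volterraLift
  refine Measurable.lintegral_prod_left' (f := fun p : ℝ × ℝ => h p.1 *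
    ENNReal.ofReal (volterraDeriv H p.1 p.2)) ?_
  exact (hh.comp measurable_fst).mul (measurable_volterraDeriv H).ennreal_ofReal

/-- Tonelli's theorem, for which `[0,∞]`-valued integrals need no integrability. The functions are
supported on positive times because the kernel identity holds only there; the excluded diagonal is a
null set. -/
theorem lintegral_volterraLift_mul {H : ℝ} (hH : 1 / 2 < H) (hH' : H < 1) {h g : ℝ → ℝ≥0∞}
    (hh : Measurable h) (hg : Measurable g) (hh0 : ∀ s ≤ 0, h s = 0) (hg0 : ∀ s ≤ 0, g s = 0) :
    ∫⁻ v, volterraLift H h v * volterraLift H g v =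
      ∫⁻ s, ∫⁻ w, h s * g w * ENNReal.ofReal (H * (2 * H - 1) * |s - w| ^ (2 * H - 2)) := by
  have mK : Measurable fun p : ℝ × ℝ => ENNReal.ofReal (volterraDeriv H p.1 p.2) :=
    (measurable_volterraDeriv H).ennreal_ofReal
  have mK1 : ∀ v, Measurable fun s => ENNReal.ofReal (volterraDeriv H s v) := fun v =>
    mK.comp (measurable_id.prodMk measurable_const)
  have mK2 : ∀ s, Measurable fun v => ENNReal.ofReal (volterraDeriv H s v) := fun s =>
    mK.comp (measurable_const.prodMk measurable_id)
  calc ∫⁻ v, volterraLift H h v * volterraLift H g v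
      = ∫⁻ v, ∫⁻ s, ∫⁻ w, h s * g w * (ENNReal.ofReal (volterraDeriv H s v) *
          ENNReal.ofReal (volterraDeriv H w v)) := by
        refine lintegral_congr fun v => ?_
        unfold volterraLift
        rw [← lintegral_mul_const _ (by exact hh.mul (mK1 v))]
        refine lintegral_congr fun s => ?_
        rw [← lintegral_const_mul _ (by exact hg.mul (mK1 v))]
        refine lintegral_congr fun w => ?_
        ring
    _ = ∫⁻ s, ∫⁻ v, ∫⁻ w, h s * g w * (ENNReal.ofReal (volterraDeriv H s v) *
          ENNReal.ofReal (volterraDeriv H w v)) := by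
        refine lintegral_lintegral_swap ?_
        refine Measurable.aemeasurable ?_
        refine Measurable.lintegral_prod_right' (f := fun q : (ℝ × ℝ) × ℝ => h q.1.2 * g q.2 *
          (ENNReal.ofReal (volterraDeriv H q.1.2 q.1.1) *
          ENNReal.ofReal (volterraDeriv H q.2 q.1.1))) ?_
        refine Measurable.mul ((hh.comp (by fun_prop)).mul (hg.comp (by fun_prop))) ?_
        exact (mK.comp (f := fun q : (ℝ × ℝ) × ℝ => (q.1.2, q.1.1)) (by fun_prop)).mul
          (mK.comp (f := fun q : (ℝ × ℝ) × ℝ => (q.2, q.1.1)) (by fun_prop))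
    _ = ∫⁻ s, ∫⁻ w, ∫⁻ v, h s * g w * (ENNReal.ofReal (volterraDeriv H s v) *
          ENNReal.ofReal (volterraDeriv H w v)) := by
        refine lintegral_congr fun s => ?_
        refine lintegral_lintegral_swap ?_
        refine Measurable.aemeasurable ?_
        refine Measurable.mul (measurable_const.mul (hg.comp (by fun_prop))) ?_
        exact (mK.comp (f := fun q : (ℝ × ℝ) => (s, q.1)) (by fun_prop)).mul
          (mK.comp (f := fun q : (ℝ × ℝ) => (q.2, q.1)) (by fun_prop))
    _ = _ := by
        refine lintegral_congr fun s => ?_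
        refine lintegral_congr_ae ?_
        have : ∀ᵐ w : ℝ, w ≠ s := by simp [ae_iff, measure_singleton]
        filter_upwards [this] with w hw
        rw [lintegral_const_mul _ (by exact (mK2 s).mul (mK2 w))]
        by_cases hs : s ≤ 0
        · simp [hh0 s hs]
        by_cases hw0 : w ≤ 0
        · simp [hg0 w hw0]
        · rw [lintegral_volterraDeriv_mul hH hH' (not_le.1 hs) (not_le.1 hw0) hw.symm]

/-! ### The covariance as a double integral -/

theorem intervalIntegrable_abs_rpow {r : ℝ} (hr : -1 < r) (a b : ℝ) :
    IntervalIntegrable (fun x : ℝ => |x| ^ r) volume a b := by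
  have h0 : ∀ c : ℝ, 0 ≤ c → IntervalIntegrable (fun x : ℝ => |x| ^ r) volume 0 c := fun c hc =>
    (intervalIntegral.intervalIntegrable_rpow' hr (a := 0) (b := c)).congr fun x hx => by
      rw [uIoc_of_le hc] at hx
      simp only [abs_of_pos hx.1]
  have h1 : ∀ c : ℝ, IntervalIntegrable (fun x : ℝ => |x| ^ r) volume 0 c := fun c => by
    rcases le_total 0 c with hc | hc
    · exact h0 c hc
    · have := (h0 (-c) (by linarith)).comp_sub_left 0
      simpa using this
  exact (h1 a).symm.trans (h1 b)

theorem integral_abs_sub_rpow {r y t : ℝ} (hr : -1 < r) (hy : 0 ≤ y) (hyt : y ≤ t) :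
    ∫ x in (0 : ℝ)..t, |y - x| ^ r = (y ^ (r + 1) + (t - y) ^ (r + 1)) / (r + 1) := by
  have h0 : ∀ c : ℝ, 0 ≤ c → ∫ x in (0 : ℝ)..c, |x| ^ r = c ^ (r + 1) / (r + 1) := fun c hc => by
    have : ∫ x in (0 : ℝ)..c, |x| ^ r = ∫ x in (0 : ℝ)..c, x ^ r := by
      refine intervalIntegral.integral_congr_ae (ae_of_all _ fun x hx => ?_)
      rw [uIoc_of_le hc] at hx
      simp only [abs_of_pos hx.1]
    rw [this, integral_rpow (Or.inl hr), Real.zero_rpow (by linarith)]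
    simp
  rw [intervalIntegral.integral_comp_sub_left (fun x : ℝ => |x| ^ r), sub_zero,
    ← intervalIntegral.integral_add_adjacent_intervals (b := 0)
      (intervalIntegrable_abs_rpow hr _ _) (intervalIntegrable_abs_rpow hr _ _), h0 y hy]
  have := intervalIntegral.integral_comp_sub_left (fun x : ℝ => |x| ^ r) (0 : ℝ) (a := 0)
    (b := t - y)
  simp only [zero_sub, abs_neg, sub_zero, neg_sub, h0 (t - y) (by linarith)] at this
  rw [← this]
  ring

theorem lintegral_abs_sub_rpow {r y t : ℝ} (hr : -1 < r) (hy : 0 ≤ y) (hyt : y ≤ t) :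
    ∫⁻ x in Ioc 0 t, ENNReal.ofReal (|y - x| ^ r) =
      ENNReal.ofReal ((y ^ (r + 1) + (t - y) ^ (r + 1)) / (r + 1)) := by
  rw [← integral_abs_sub_rpow hr hy hyt, intervalIntegral.integral_of_le (hy.trans hyt),
    ofReal_integral_eq_lintegral_ofReal]
  · have := (intervalIntegrable_abs_rpow hr (y - 0) (y - t)).comp_sub_left y
    rw [sub_sub_cancel, sub_sub_cancel] at this
    exact (intervalIntegrable_iff_integrableOn_Ioc_of_le (hy.trans hyt)).1 this
  · exact ae_of_all _ fun x => Real.rpow_nonneg (abs_nonneg _) _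

theorem fbmCov_symm (H t s : ℝ) : fbmCov H t s = fbmCov H s t := by
  unfold fbmCov
  rw [abs_sub_comm]
  ring

/-- The singularity `|y-x|^{2H-2}` is integrable since `2H - 2 > -1`; integrating once in each
variable recovers the three powers of the covariance. -/
theorem lintegral_lintegral_eq_fbmCov {H s t : ℝ} (hH : 1 / 2 < H) (hs : 0 ≤ s) (hst : s ≤ t) :
    ∫⁻ y in Ioc 0 s, ∫⁻ x in Ioc 0 t, ENNReal.ofReal (H * (2 * H - 1) * |y - x| ^ (2 * H - 2)) =
      ENNReal.ofReal (fbmCov H t s) := by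
  have hH0 : 0 < H := by linarith
  have hH1 : 0 < 2 * H - 1 := by linarith
  have ht : 0 ≤ t := hs.trans hst
  have e : ∀ y ∈ Ioc 0 s,
      ∫⁻ x in Ioc 0 t, ENNReal.ofReal (H * (2 * H - 1) * |y - x| ^ (2 * H - 2)) =
        ENNReal.ofReal (H * (y ^ (2 * H - 1) + |t - y| ^ (2 * H - 1))) := fun y hy => by
    simp_rw [ENNReal.ofReal_mul (show 0 ≤ H * (2 * H - 1) by positivity)]
    rw [lintegral_const_mul' _ _ ENNReal.ofReal_ne_top,
      lintegral_abs_sub_rpow (by linarith) hy.1.le (hy.2.trans hst),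
      ← ENNReal.ofReal_mul (by positivity), abs_of_nonneg (by linarith [hy.2])]
    congr 1
    rw [show 2 * H - 2 + 1 = 2 * H - 1 by ring, mul_assoc, mul_div_cancel₀ _ hH1.ne']
  rw [setLIntegral_congr_fun measurableSet_Ioc e]
  have i1 : IntervalIntegrable (fun y : ℝ => y ^ (2 * H - 1)) volume 0 s :=
    intervalIntegral.intervalIntegrable_rpow' (by linarith)
  have i2 : IntervalIntegrable (fun y : ℝ => |t - y| ^ (2 * H - 1)) volume 0 s := by
    have := (intervalIntegrable_abs_rpow (r := 2 * H - 1) (by linarith)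
      (t - 0) (t - s)).comp_sub_left t
    rwa [sub_sub_cancel, sub_sub_cancel] at this
  rw [← ofReal_integral_eq_lintegral_ofReal, ← intervalIntegral.integral_of_le hs,
    intervalIntegral.integral_const_mul, intervalIntegral.integral_add i1 i2,
    integral_rpow (Or.inl (by linarith)),
    intervalIntegral.integral_comp_sub_left (fun x : ℝ => |x| ^ (2 * H - 1))]
  · have : ∫ x in (t - s)..(t - 0), |x| ^ (2 * H - 1) = ∫ x in (t - s)..(t - 0), x ^ (2 * H - 1) := by
      refine intervalIntegral.integral_congr fun x hx => ?_
      rw [uIcc_of_le (by linarith)] at hx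
      simp only [abs_of_nonneg (show 0 ≤ x by linarith [hx.1])]
    rw [this, integral_rpow (Or.inl (by linarith))]
    unfold fbmCov
    congr 1
    rw [show 2 * H - 1 + 1 = 2 * H by ring, Real.zero_rpow (by linarith),
      abs_of_nonneg (by linarith : 0 ≤ t - s)]
    simp only [sub_zero]
    field_simp
    ring
  · exact ((i1.add i2).const_mul H).1
  · refine (ae_restrict_mem measurableSet_Ioc).mono fun y hy => ?_
    have := hy.1.le
    simp only [Pi.zero_apply]
    positivity

/-- The lift of the indicator function of `(0,t]`: the Molchan--Golosov kernel `k(t,·)`. -/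
def kernelLift (H t : ℝ) : ℝ → ℝ≥0∞ := volterraLift H ((Ioc 0 t).indicator 1)

theorem measurable_kernelLift (H t : ℝ) : Measurable (kernelLift H t) :=
  measurable_volterraLift H (measurable_one.indicator measurableSet_Ioc)

theorem kernelLift_eq (H t v : ℝ) :
    kernelLift H t v = ∫⁻ s in Ioc 0 t, ENNReal.ofReal (volterraDeriv H s v) := by
  unfold kernelLift volterraLift
  rw [← lintegral_indicator measurableSet_Ioc]
  refine lintegral_congr fun s => ?_
  by_cases hs : s ∈ Ioc 0 t <;> simp [hs]

/-- The operator identity applied to the indicators of `(0,s]` and `(0,t]`. -/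
theorem lintegral_kernelLift_mul_of_le {H s t : ℝ} (hH : 1 / 2 < H) (hH' : H < 1) (hs : 0 ≤ s)
    (hst : s ≤ t) :
    ∫⁻ v, kernelLift H t v * kernelLift H s v = ENNReal.ofReal (fbmCov H t s) := by
  have m : ∀ t : ℝ, Measurable ((Ioc 0 t).indicator (1 : ℝ → ℝ≥0∞)) := fun t =>
    measurable_one.indicator measurableSet_Ioc
  have z : ∀ t : ℝ, ∀ s ≤ 0, (Ioc 0 t).indicator (1 : ℝ → ℝ≥0∞) s = 0 := fun t s hs =>
    indicator_of_notMem (fun h => absurd h.1 (not_lt.2 hs)) _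
  rw [← lintegral_lintegral_eq_fbmCov hH hs hst]
  simp_rw [mul_comm (kernelLift H t _)]
  unfold kernelLift
  rw [lintegral_volterraLift_mul hH hH' (m s) (m t) (z s) (z t),
    ← lintegral_indicator measurableSet_Ioc]
  refine lintegral_congr fun x => ?_
  by_cases hx : x ∈ Ioc 0 s
  · simp only [indicator_of_mem hx, Pi.one_apply, one_mul]
    rw [← lintegral_indicator measurableSet_Ioc]
    refine lintegral_congr fun w => ?_
    by_cases hw : w ∈ Ioc 0 t <;> simp [hw]
  · simp [hx]

theorem lintegral_kernelLift_mul {H s t : ℝ} (hH : 1 / 2 < H) (hH' : H < 1) (hs : 0 ≤ s)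
    (ht : 0 ≤ t) :
    ∫⁻ v, kernelLift H t v * kernelLift H s v = ENNReal.ofReal (fbmCov H t s) := by
  rcases le_total s t with h | h
  · exact lintegral_kernelLift_mul_of_le hH hH' hs h
  · rw [fbmCov_symm, ← lintegral_kernelLift_mul_of_le hH hH' ht h]
    simp_rw [mul_comm]

/-- Causality of the kernel: `k(t,·)` lives on `(0,t)`. The orthogonality of the prediction error to
the past comes from this. -/
theorem kernelLift_eq_zero {H t v : ℝ} (hv : t ≤ v ∨ v ≤ 0) : kernelLift H t v = 0 := by
  rw [kernelLift_eq]
  refine setLIntegral_eq_zero measurableSet_Ioc fun s hs => ?_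
  have : volterraDeriv H s v = 0 := if_neg fun h => by
    rcases hv with hv | hv
    · linarith [hs.2, h.2]
    · linarith [h.1]
  simp [this]

theorem kernelLift_ae_lt_top {H t : ℝ} (hH : 1 / 2 < H) (hH' : H < 1) (ht : 0 ≤ t) :
    ∀ᵐ v, kernelLift H t v < ∞ := by
  have h := lintegral_kernelLift_mul hH hH' ht ht
  have : ∀ᵐ v, kernelLift H t v * kernelLift H t v < ∞ :=
    ae_lt_top ((measurable_kernelLift H t).mul (measurable_kernelLift H t))
      (by rw [h]; exact ENNReal.ofReal_ne_top)
  filter_upwards [this] with v hv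
  by_contra hc
  rw [not_lt_top_iff] at hc
  simp [hc] at hv

theorem integrableOn_volterraDeriv {H t v : ℝ} (hH : 1 / 2 < H) (h : kernelLift H t v < ∞) :
    IntegrableOn (fun s => volterraDeriv H s v) (Ioc 0 t) := by
  refine ⟨((measurable_volterraDeriv H).comp
    (measurable_id.prodMk measurable_const)).aestronglyMeasurable, ?_⟩
  rw [hasFiniteIntegral_iff_ofReal (ae_of_all _ fun s => volterraDeriv_nonneg hH s v),
    ← kernelLift_eq]
  exact h

theorem kernelLift_toReal_eq {H t v : ℝ} (hH : 1 / 2 < H) :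
    (kernelLift H t v).toReal = ∫ s in Ioc 0 t, volterraDeriv H s v := by
  rw [kernelLift_eq, integral_eq_lintegral_of_nonneg_ae]
  · exact ae_of_all _ fun s => volterraDeriv_nonneg hH s v
  · exact ((measurable_volterraDeriv H).comp
      (measurable_id.prodMk measurable_const)).aestronglyMeasurable

/-- The lift is the Molchan--Golosov kernel. -/
theorem kernelLift_toReal_eq_volterraKernel {H t v : ℝ} (hH : 1 / 2 < H) (hv : 0 < v)
    (hvt : v ≤ t) : (kernelLift H t v).toReal = volterraKernel H t v := by
  rw [kernelLift_toReal_eq hH]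
  unfold volterraKernel
  rw [intervalIntegral.integral_of_le hvt, ← integral_const_mul,
    ← integral_indicator measurableSet_Ioc, ← integral_indicator measurableSet_Ioc]
  congr 1
  ext s
  by_cases hs : s ∈ Ioc v t
  · have hs' : s ∈ Ioc 0 t := ⟨hv.trans hs.1, hs.2⟩
    rw [indicator_of_mem hs, indicator_of_mem hs']
    unfold volterraDeriv volterraConst
    rw [if_pos ⟨hv, hs.1⟩]
    ring
  · rw [indicator_of_notMem hs]
    by_cases hs' : s ∈ Ioc 0 t
    · rw [indicator_of_mem hs']
      exact if_neg fun h => hs ⟨h.2, hs'.2⟩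
    · rw [indicator_of_notMem hs']

theorem fbmCov_self_nonneg (H : ℝ) {t : ℝ} (ht : 0 ≤ t) (hH : 1 / 2 < H) : 0 ≤ fbmCov H t t := by
  unfold fbmCov
  rw [sub_self, abs_zero, Real.zero_rpow (by linarith)]
  have := Real.rpow_nonneg ht (2 * H)
  linarith

/-- The conditional variance is the tail of the integral of the squared kernel. -/
theorem lintegral_kernelLift_sq_Ioi {H a b : ℝ} (hH : 1 / 2 < H) (hH' : H < 1) (ha : 0 ≤ a)
    (hab : a ≤ b) :
    ENNReal.ofReal (condVar H b a) = ∫⁻ v in Ioi a, kernelLift H b v ^ 2 ∧ 0 ≤ condVar H b a := by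
  have hb := ha.trans hab
  have h1 := lintegral_kernelLift_mul hH hH' hb hb
  have h2 : ∫⁻ v, kernelLift H b v * kernelLift H b v =
      (∫⁻ v in Ioc 0 a, kernelLift H b v ^ 2) + ∫⁻ v in Ioi a, kernelLift H b v ^ 2 := by
    simp_rw [← sq]
    rw [← lintegral_union measurableSet_Ioi, Ioc_union_Ioi_eq_Ioi ha,
      ← lintegral_add_compl _ (measurableSet_Ioi (a := (0 : ℝ))),
      setLIntegral_eq_zero (s := (Ioi (0 : ℝ))ᶜ) measurableSet_Ioi.compl, add_zero]
    · intro v hv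
      simp [kernelLift_eq_zero (Or.inr (not_lt.1 hv) : b ≤ v ∨ v ≤ 0)]
    · exact disjoint_left.2 fun x hx hx' => absurd hx.2 (not_le.2 hx')
  rw [h1] at h2
  -- The total mass is the finite number `r(b,b)`, so both pieces are finite and the subtraction
  -- that defines `condVar` may be carried out in `ℝ`.
  have f1 : ∫⁻ v in Ioc 0 a, kernelLift H b v ^ 2 ≠ ∞ := fun h => by simp [h] at h2
  have f2 : ∫⁻ v in Ioi a, kernelLift H b v ^ 2 ≠ ∞ := fun h => by simp [h] at h2
  have e : ∫ v in (0 : ℝ)..a, volterraKernel H b v * volterraKernel H b v =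
      (∫⁻ v in Ioc 0 a, kernelLift H b v ^ 2).toReal := by
    rw [intervalIntegral.integral_of_le ha, setIntegral_congr_fun (g := fun v =>
      (kernelLift H b v ^ 2).toReal) measurableSet_Ioc, integral_toReal]
    · exact ((measurable_kernelLift H b).pow_const 2).aemeasurable
    · exact ae_lt_top ((measurable_kernelLift H b).pow_const 2) f1
    · intro v hv
      simp only [ENNReal.toReal_pow]
      rw [kernelLift_toReal_eq_volterraKernel hH hv.1 (hv.2.trans hab), sq]
  have h3 := congrArg ENNReal.toReal h2
  rw [ENNReal.toReal_ofReal (fbmCov_self_nonneg H hb hH), ENNReal.toReal_add f1 f2] at h3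
  have h4 : condVar H b a = (∫⁻ v in Ioi a, kernelLift H b v ^ 2).toReal := by
    unfold condVar condCov
    rw [e, h3]
    ring
  rw [h4]
  exact ⟨ENNReal.ofReal_toReal f2, ENNReal.toReal_nonneg⟩

/-! ### The prediction kernel -/

theorem intervalIntegrable_predKernel_inner {H a b s : ℝ} (hH : 1 / 2 < H) (hsa : s < a)
    (hab : a ≤ b) :
    IntervalIntegrable (fun z => z ^ (H - 1 / 2) * (z - a) ^ (H - 1 / 2) / (z - s)) volume a b := by
  refine ContinuousOn.intervalIntegrable fun z hz => ?_
  rw [uIcc_of_le hab] at hz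
  have h1 : z - s ≠ 0 := by linarith [hz.1]
  have h2 : 0 < H - 1 / 2 := by linarith
  refine ContinuousAt.continuousWithinAt ?_
  refine ContinuousAt.div (ContinuousAt.mul ?_ ?_) (by fun_prop) h1
  · exact Real.continuousAt_rpow_const _ _ (Or.inr h2.le)
  · exact (Real.continuousAt_rpow_const (z - a) _ (Or.inr h2.le)).comp
      (f := fun z => z - a) (by fun_prop)

/-- The normalizing constant of the prediction kernel. -/
theorem predConst_pos {H : ℝ} (hH : 1 / 2 < H) (hH' : H < 1) :
    0 < Real.sin (Real.pi * (H - 1 / 2)) / Real.pi :=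
  div_pos (Real.sin_pos_of_pos_of_lt_pi (mul_pos Real.pi_pos (by linarith))
    (by nlinarith [Real.pi_pos])) Real.pi_pos

/-- Since `Ψ ≤ 0`, its negative can be written entirely with nonnegative integrals, which makes
Tonelli's theorem available for the lift of `-Ψ`. -/
theorem ofReal_neg_predKernel {H a b s : ℝ} (hH : 1 / 2 < H) (hH' : H < 1) (hs : 0 < s)
    (hsa : s < a) (hab : a ≤ b) :
    ENNReal.ofReal (-predKernel H b a s) =
      ENNReal.ofReal (Real.sin (Real.pi * (H - 1 / 2)) / Real.pi * s ^ (1 / 2 - H) *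
        (a - s) ^ (1 / 2 - H)) *
      ∫⁻ z in Ioc a b, ENNReal.ofReal (z ^ (H - 1 / 2) * (z - a) ^ (H - 1 / 2) / (z - s)) := by
  have hc := predConst_pos hH hH'
  have h1 : 0 < a - s := by linarith
  rw [← ofReal_integral_eq_lintegral_ofReal, ← ENNReal.ofReal_mul (by positivity),
    ← intervalIntegral.integral_of_le hab]
  · unfold predKernel
    congr 1
    ring
  · exact (intervalIntegrable_predKernel_inner hH hsa hab).1
  · refine (ae_restrict_mem measurableSet_Ioc).mono fun z hz => ?_
    have z1 : 0 < z - s := by linarith [hz.1]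
    have z2 : 0 < z - a := by linarith [hz.1]
    have z3 : 0 < z := by linarith
    simp only [Pi.zero_apply]
    positivity

theorem predKernel_nonpos {H a b s : ℝ} (hH : 1 / 2 < H) (hH' : H < 1) (hs : 0 < s)
    (hsa : s < a) (hab : a ≤ b) : predKernel H b a s ≤ 0 := by
  have hc := predConst_pos hH hH'
  have h1 : 0 < a - s := by linarith
  have : 0 ≤ ∫ z in a..b, z ^ (H - 1 / 2) * (z - a) ^ (H - 1 / 2) / (z - s) := by
    refine intervalIntegral.integral_nonneg hab fun z hz => ?_
    have z1 : 0 < z - s := by linarith [hz.1]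
    have z2 : 0 ≤ z - a := by linarith [hz.1]
    have z3 : 0 < z := by linarith
    positivity
  unfold predKernel
  have h2 : 0 ≤ Real.sin (Real.pi * (H - 1 / 2)) / Real.pi * s ^ (1 / 2 - H) *
    (a - s) ^ (1 / 2 - H) := by positivity
  nlinarith [mul_nonneg h2 this]

theorem measurable_predKernel (H b a : ℝ) (hab : a ≤ b) : Measurable (predKernel H b a) := by
  unfold predKernel
  refine Measurable.mul (by fun_prop) ?_
  simp_rw [intervalIntegral.integral_of_le hab]
  refine StronglyMeasurable.measurable ?_
  refine StronglyMeasurable.integral_prod_right (f := fun s z : ℝ =>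
    z ^ (H - 1 / 2) * (z - a) ^ (H - 1 / 2) / (z - s)) ?_
  exact Measurable.stronglyMeasurable (by unfold Function.uncurry; fun_prop)

/-- The Möbius beta integral with `p = H - 1/2` and `q = 3/2 - H`. As `p + q = 1` the pole is
simple, and the reflection formula gives the beta value `π / sin(π(H - 1/2))`, which the constant of
the prediction kernel cancels. -/
theorem lintegral_predKernel_moebius {H a v z : ℝ} (hH : 1 / 2 < H) (hH' : H < 1)
    (hva : v < a) (haz : a < z) :
    ENNReal.ofReal (Real.sin (Real.pi * (H - 1 / 2)) / Real.pi * (z - a) ^ (H - 1 / 2)) *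
      ∫⁻ s in Ioo v a, ENNReal.ofReal ((a - s) ^ (1 / 2 - H) * (s - v) ^ (H - 3 / 2) / (z - s)) =
    ENNReal.ofReal ((z - v) ^ (H - 3 / 2)) := by
  have h := lintegral_Ioo_moebius hva haz (p := H - 1 / 2) (q := 3 / 2 - H) (by linarith)
    (by linarith)
  have h1 : 0 < z - a := by linarith
  have h2 : 0 < z - v := by linarith
  have hc := predConst_pos hH hH'
  have e : ∀ s ∈ Ioo v a, ENNReal.ofReal ((a - s) ^ (1 / 2 - H) * (s - v) ^ (H - 3 / 2) / (z - s)) =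
      ENNReal.ofReal ((s - v) ^ (H - 1 / 2 - 1) * (a - s) ^ (3 / 2 - H - 1) *
        (z - s) ^ (-(H - 1 / 2 + (3 / 2 - H)))) := fun s hs => by
    congr 1
    rw [show -(H - 1 / 2 + (3 / 2 - H)) = -1 by ring, Real.rpow_neg_one, div_eq_mul_inv,
      show H - 1 / 2 - 1 = H - 3 / 2 by ring, show 3 / 2 - H - 1 = 1 / 2 - H by ring]
    ring
  rw [setLIntegral_congr_fun measurableSet_Ioo e, h, ← ENNReal.ofReal_mul (by positivity)]
  congr 1
  have hbeta : beta (H - 1 / 2) (3 / 2 - H) = Real.pi / Real.sin (Real.pi * (H - 1 / 2)) := by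
    unfold beta
    rw [show H - 1 / 2 + (3 / 2 - H) = 1 by ring, Real.Gamma_one, div_one,
      show 3 / 2 - H = 1 - (H - 1 / 2) by ring, Real.Gamma_mul_Gamma_one_sub]
  have hs : 0 < Real.sin (Real.pi * (H - 1 / 2)) :=
    Real.sin_pos_of_pos_of_lt_pi (mul_pos Real.pi_pos (by linarith)) (by nlinarith [Real.pi_pos])
  have hpi := Real.pi_pos
  rw [hbeta, show H - 1 / 2 + (3 / 2 - H) - 1 = 0 by ring, Real.rpow_zero,
    Real.rpow_neg h1.le, show -(3 / 2 - H) = H - 3 / 2 by ring]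
  have := (Real.rpow_pos_of_pos h1 (H - 1 / 2)).ne'
  generalize Real.sin (Real.pi * (H - 1 / 2)) = x at *
  field_simp

/-- The lift of `1 - Ψ(b,·|a)` on `(0,a)` is the restriction of `k(b,·)` to `(0,a)`. -/
theorem volterraLift_predKernel {H a b v : ℝ} (hH : 1 / 2 < H) (hH' : H < 1) (hv : 0 < v)
    (hva : v < a) (hab : a ≤ b) :
    volterraLift H ((Ioo 0 a).indicator fun s => ENNReal.ofReal (-predKernel H b a s)) v +
      kernelLift H a v = kernelLift H b v := by
  have hc := predConst_pos hH hH'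
  have hcv := volterraConst_nonneg hH
  have split : kernelLift H b v =
      kernelLift H a v + ∫⁻ z in Ioc a b, ENNReal.ofReal (volterraDeriv H z v) := by
    rw [kernelLift_eq, kernelLift_eq, ← lintegral_union measurableSet_Ioc,
      Ioc_union_Ioc_eq_Ioc (hv.trans hva).le hab]
    exact disjoint_left.2 fun x hx hx' => absurd hx.2 (not_le.2 hx'.1)
  rw [split, add_comm]
  congr 1
  set C := Real.sin (Real.pi * (H - 1 / 2)) / Real.pi with hC
  -- The factor `s ^ (1/2 - H)` of `Ψ` cancels `s ^ (H - 1/2)` in the derivative kernel. After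
  -- exchanging the integrals, the inner one over `s` is the Möbius integral and leaves
  -- `∂k(z,v)/∂z`, whose integral over `(a,b]` is the increment of the kernel.
  calc volterraLift H ((Ioo 0 a).indicator fun s => ENNReal.ofReal (-predKernel H b a s)) v
      = ∫⁻ s in Ioo v a, ∫⁻ z in Ioc a b,
          ENNReal.ofReal (volterraConst H * v ^ (1 / 2 - H) * z ^ (H - 1 / 2) *
            (C * (z - a) ^ (H - 1 / 2)) *
            ((a - s) ^ (1 / 2 - H) * (s - v) ^ (H - 3 / 2) / (z - s))) := by
        unfold volterraLift
        rw [← lintegral_indicator measurableSet_Ioo]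
        refine lintegral_congr fun s => ?_
        by_cases hs : s ∈ Ioo v a
        · have hs0 : 0 < s := hv.trans hs.1
          have hs1 : 0 < a - s := by linarith [hs.2]
          have hs2 : 0 < s - v := by linarith [hs.1]
          rw [indicator_of_mem hs, indicator_of_mem (show s ∈ Ioo 0 a from ⟨hs0, hs.2⟩),
            ofReal_neg_predKernel hH hH' hs0 hs.2 hab, ← hC, mul_right_comm,
            ← ENNReal.ofReal_mul (by positivity),
            ← lintegral_const_mul' _ _ ENNReal.ofReal_ne_top]
          refine setLIntegral_congr_fun measurableSet_Ioc fun z hz => ?_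
          have z1 : 0 < z - s := by linarith [hz.1]
          have z2 : 0 < z - a := by linarith [hz.1]
          have z3 : 0 < z := by linarith
          have hvd : volterraDeriv H s v = volterraConst H * v ^ (1 / 2 - H) * s ^ (H - 1 / 2) *
            (s - v) ^ (H - 3 / 2) := if_pos ⟨hv, hs.1⟩
          rw [← ENNReal.ofReal_mul (mul_nonneg (by positivity) (volterraDeriv_nonneg hH _ _)), hvd,
            show 1 / 2 - H = -(H - 1 / 2) by ring, Real.rpow_neg hs0.le]
          congr 1
          have := (Real.rpow_pos_of_pos hs0 (H - 1 / 2)).ne'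
          field_simp
        · rw [indicator_of_notMem hs]
          by_cases hs' : s ∈ Ioo 0 a
          · have : volterraDeriv H s v = 0 := if_neg fun h => hs ⟨h.2, hs'.2⟩
            simp [this]
          · simp [hs']
    _ = ∫⁻ z in Ioc a b, ∫⁻ s in Ioo v a,
          ENNReal.ofReal (volterraConst H * v ^ (1 / 2 - H) * z ^ (H - 1 / 2) *
            (C * (z - a) ^ (H - 1 / 2)) *
            ((a - s) ^ (1 / 2 - H) * (s - v) ^ (H - 3 / 2) / (z - s))) := by
        refine lintegral_lintegral_swap (Measurable.aemeasurable ?_)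
        unfold Function.uncurry
        fun_prop
    _ = ∫⁻ z in Ioc a b, ENNReal.ofReal (volterraDeriv H z v) := by
        refine setLIntegral_congr_fun measurableSet_Ioc fun z hz => ?_
        have z2 : 0 < z - a := by linarith [hz.1]
        have z3 : 0 < z := by linarith
        simp_rw [ENNReal.ofReal_mul (show 0 ≤ volterraConst H * v ^ (1 / 2 - H) * z ^ (H - 1 / 2) *
          (C * (z - a) ^ (H - 1 / 2)) by positivity)]
        rw [lintegral_const_mul' _ _ ENNReal.ofReal_ne_top,
          ENNReal.ofReal_mul (show 0 ≤ volterraConst H * v ^ (1 / 2 - H) * z ^ (H - 1 / 2) by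
            positivity), mul_assoc, lintegral_predKernel_moebius hH hH' hva hz.1,
          ← ENNReal.ofReal_mul (by positivity)]
        congr 1
        exact (if_pos ⟨hv, by linarith⟩).symm

/-! ### Limits in `L²` -/

section L2

variable {Ω : Type*} [MeasurableSpace Ω] {μ : Measure Ω}

theorem tendsto_integral_mul_of_tendsto_eLpNorm {X Y : ℕ → Ω → ℝ} {X' Y' : Ω → ℝ}
    (hX : ∀ n, MemLp (X n) 2 μ) (hX' : MemLp X' 2 μ) (hY : ∀ n, MemLp (Y n) 2 μ)
    (hY' : MemLp Y' 2 μ)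
    (hXl : Tendsto (fun n => eLpNorm (fun ω => X n ω - X' ω) 2 μ) atTop (𝓝 0))
    (hYl : Tendsto (fun n => eLpNorm (fun ω => Y n ω - Y' ω) 2 μ) atTop (𝓝 0)) :
    Tendsto (fun n => ∫ ω, X n ω * Y n ω ∂μ) atTop (𝓝 (∫ ω, X' ω * Y' ω ∂μ)) := by
  have e : ∀ {f g : Ω → ℝ} (hf : MemLp f 2 μ) (hg : MemLp g 2 μ),
      inner ℝ (hf.toLp f) (hg.toLp g) = ∫ ω, f ω * g ω ∂μ := fun {f g} hf hg => by
    rw [L2.inner_def]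
    refine integral_congr_ae ?_
    filter_upwards [hf.coeFn_toLp, hg.coeFn_toLp] with ω h1 h2
    rw [h1, h2]
    simp [mul_comm]
  have h1 := (Lp.tendsto_Lp_iff_tendsto_eLpNorm'' X hX X' hX').2 hXl
  have h2 := (Lp.tendsto_Lp_iff_tendsto_eLpNorm'' Y hY Y' hY').2 hYl
  have h3 := h1.inner (𝕜 := ℝ) h2
  simpa only [e] using h3

theorem tendsto_integral_of_tendsto_eLpNorm [IsProbabilityMeasure μ] {X : ℕ → Ω → ℝ} {X' : Ω → ℝ}
    (hX : ∀ n, MemLp (X n) 2 μ) (hX' : MemLp X' 2 μ)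
    (hXl : Tendsto (fun n => eLpNorm (fun ω => X n ω - X' ω) 2 μ) atTop (𝓝 0)) :
    Tendsto (fun n => ∫ ω, X n ω ∂μ) atTop (𝓝 (∫ ω, X' ω ∂μ)) := by
  have := tendsto_integral_mul_of_tendsto_eLpNorm (Y := fun _ _ => 1) (Y' := fun _ => 1) hX hX'
    (fun _ => memLp_const 1) (memLp_const 1) hXl (by simp)
  simpa using this

/-- The limit in `L²` of Gaussian random variables is Gaussian. -/
theorem hasGaussianLaw_of_tendsto_eLpNorm [IsProbabilityMeasure μ] {X : ℕ → Ω → ℝ} {X' : Ω → ℝ}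
    (hX : ∀ n, HasGaussianLaw (X n) μ) (hX' : MemLp X' 2 μ)
    (hXl : Tendsto (fun n => eLpNorm (fun ω => X n ω - X' ω) 2 μ) atTop (𝓝 0)) :
    HasGaussianLaw X' μ := by
  have hX2 : ∀ n, MemLp (X n) 2 μ := fun n => (hX n).memLp_two
  have hXm : ∀ n, AEMeasurable (X n) μ := fun n => (hX n).aemeasurable
  have hm' : AEMeasurable X' μ := hX'.1.aemeasurable
  have mean := tendsto_integral_of_tendsto_eLpNorm hX2 hX' hXl
  have sec := tendsto_integral_mul_of_tendsto_eLpNorm hX2 hX' hX2 hX' hXl hXl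
  have var : Tendsto (fun n => Var[X n; μ]) atTop (𝓝 Var[X'; μ]) := by
    rw [variance_eq_sub hX']
    simp_rw [fun n => variance_eq_sub (hX2 n)]
    simp_rw [sq]
    exact sec.sub (mean.mul mean)
  -- Along an almost surely convergent subsequence the characteristic functions converge by
  -- dominated convergence. Means and variances converge in `L²`, so the limit has the
  -- characteristic function of a Gaussian law.
  obtain ⟨ns, hns, hae⟩ := (tendstoInMeasure_of_tendsto_eLpNorm (p := 2) (by norm_num)
    (fun n => (hX2 n).1) hX'.1 hXl).exists_seq_tendsto_ae
  rw [hasGaussianLaw_iff_charFun_map_eq hm']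
  intro t
  have c : ∀ {Y : Ω → ℝ}, AEMeasurable Y μ → charFun (μ.map Y) t =
      ∫ ω, Complex.exp (t * Y ω * Complex.I) ∂μ := fun {Y} hY => by
    rw [charFun_apply_real, integral_map hY (by fun_prop)]
  have e : ∀ {Y : Ω → ℝ}, Complex.exp (((∫ ω, inner ℝ t (Y ω) ∂μ : ℝ) : ℂ) * Complex.I -
      Var[fun ω => inner ℝ t (Y ω); μ] / 2) = Complex.exp (((t * ∫ ω, Y ω ∂μ : ℝ) : ℂ) * Complex.I -
      (t ^ 2 * Var[Y; μ] : ℝ) / 2) := fun {Y} => by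
    simp only [RCLike.inner_apply, conj_trivial]
    rw [integral_mul_const, variance_mul_const, mul_comm t, mul_comm (t ^ 2)]
  have l1 : Tendsto (fun n => charFun (μ.map (X (ns n))) t) atTop (𝓝 (charFun (μ.map X') t)) := by
    simp_rw [fun n => c (hXm (ns n)), c hm']
    refine tendsto_integral_of_dominated_convergence (fun _ => 1) (fun n => ?_)
      (integrable_const 1) (fun n => ae_of_all _ fun ω => ?_) ?_
    · exact (by fun_prop : Continuous fun x : ℝ => Complex.exp (t * x * Complex.I)).measurable
        |>.comp_aemeasurable (hXm (ns n)) |>.aestronglyMeasurable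
    · rw [← Complex.ofReal_mul, Complex.norm_exp_ofReal_mul_I]
    · filter_upwards [hae] with ω hω
      exact ((by fun_prop : Continuous fun x : ℝ =>
        Complex.exp (t * x * Complex.I)).tendsto (X' ω)).comp hω
  have l2 : Tendsto (fun n => charFun (μ.map (X (ns n))) t) atTop
      (𝓝 (Complex.exp (((t * ∫ ω, X' ω ∂μ : ℝ) : ℂ) * Complex.I -
      (t ^ 2 * Var[X'; μ] : ℝ) / 2))) := by
    simp_rw [fun n => (hX (ns n)).charFun_map_eq t, e]
    have hc : Continuous fun p : ℝ × ℝ => Complex.exp (((t * p.1 : ℝ) : ℂ) * Complex.I -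
      (t ^ 2 * p.2 : ℝ) / 2) := by fun_prop
    exact (hc.tendsto _).comp
      ((mean.comp hns.tendsto_atTop).prodMk_nhds (var.comp hns.tendsto_atTop))
  rw [e]
  exact tendsto_nhds_unique l1 l2

/-- Every continuous linear functional on `ι → ℝ` is a combination of coordinates, so it suffices to
test these. -/
theorem hasGaussianLaw_pi_of_forall_dual [IsProbabilityMeasure μ] {ι : Type*} [Fintype ι]
    {X : Ω → ι → ℝ} (hm : AEMeasurable X μ)
    (h : ∀ c : ι → ℝ, HasGaussianLaw (fun ω => ∑ i, c i * X ω i) μ) : HasGaussianLaw X μ := by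
  have : IsProbabilityMeasure (μ.map X) := Measure.isProbabilityMeasure_map hm
  refine ⟨isGaussian_of_isGaussian_map fun L => ?_⟩
  rw [AEMeasurable.map_map_of_aemeasurable (by fun_prop) hm]
  classical
  have e : (L ∘ X) = fun ω => ∑ i, L (Pi.single i 1) * X ω i := by
    ext ω
    simp only [Function.comp_apply]
    conv_lhs => rw [← Finset.univ_sum_single (X ω), map_sum]
    refine Finset.sum_congr rfl fun i _ => ?_
    rw [show Pi.single i (X ω i) = X ω i • (Pi.single i 1 : ι → ℝ) by
      rw [← Pi.single_smul]; simp, map_smul, smul_eq_mul, mul_comm]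
  rw [e]
  exact (h _).isGaussian_map

/-- The limit in `L²` of Gaussian processes is a Gaussian process. -/
theorem isGaussianProcess_of_tendsto_eLpNorm [IsProbabilityMeasure μ] {ι : Type*}
    {X : ℕ → ι → Ω → ℝ} {X' : ι → Ω → ℝ} (hX : ∀ n, IsGaussianProcess (X n) μ)
    (hX' : ∀ i, MemLp (X' i) 2 μ)
    (hXl : ∀ i, Tendsto (fun n => eLpNorm (fun ω => X n i ω - X' i ω) 2 μ) atTop (𝓝 0)) :
    IsGaussianProcess X' μ := by
  refine ⟨fun I => hasGaussianLaw_pi_of_forall_dual ?_ fun c => ?_⟩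
  · exact aemeasurable_pi_lambda _ fun i => (hX' i).1.aemeasurable
  · refine hasGaussianLaw_of_tendsto_eLpNorm (X := fun n ω => ∑ i : I, c i * X n i ω)
      (fun n => ?_) ?_ ?_
    · exact ((hX n).hasGaussianLaw I).map_fun
        (∑ i : I, c i • ContinuousLinearMap.proj (R := ℝ) (φ := fun _ : I => ℝ) i) |>.congr
        (ae_of_all _ fun ω => by simp)
    · exact memLp_finsetSum _ fun i _ => (hX' i).const_mul (c i)
    · have hle : ∀ n, eLpNorm (fun ω => (∑ i : I, c i * X n i ω) -
          ∑ i : I, c i * X' i ω) 2 μ ≤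
          ∑ i : I, ‖c i‖ₑ * eLpNorm (fun ω => X n i ω - X' i ω) 2 μ := fun n => by
        have : (fun ω => (∑ i : I, c i * X n i ω) - ∑ i : I, c i * X' i ω) =
            ∑ i : I, (c i) • (fun ω => X n i ω - X' i ω) := by
          ext ω
          simp [← Finset.sum_sub_distrib, mul_sub]
        rw [this]
        refine (eLpNorm_sum_le (fun i _ => ?_) (by norm_num)).trans ?_
        · exact ((((hX n).hasGaussianLaw_eval i).memLp_two.1.sub (hX' i).1).const_smul (c i))
        · exact Finset.sum_le_sum fun i _ => (eLpNorm_const_smul _ _ _ _).le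
      refine tendsto_of_tendsto_of_tendsto_of_le_of_le tendsto_const_nhds ?_ (fun _ => zero_le)
        hle
      have := tendsto_finsetSum (Finset.univ : Finset I) fun i _ =>
        ENNReal.Tendsto.const_mul (a := ‖c i‖ₑ) (hXl i) (Or.inr enorm_ne_top)
      simpa using this

end L2

/-! ### Linear combinations of two families with the same Gram matrix -/

section Gram

variable {Ω Ω' ι : Type*} [MeasurableSpace Ω] [MeasurableSpace Ω'] {μ : Measure Ω} {ν : Measure Ω'}

theorem memLp_linearCombination {x : ι → Ω → ℝ} (hx : ∀ i, MemLp (x i) 2 μ) (c : ι →₀ ℝ) :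
    MemLp (Finsupp.linearCombination ℝ x c) 2 μ := by
  induction c using Finsupp.induction_linear with
  | zero => simp
  | add c d hc hd => rw [map_add]; exact hc.add hd
  | single i r => rw [Finsupp.linearCombination_single]; exact (hx i).const_smul r

/-- Bilinearity extends equality of Gram matrices to all finite combinations. This is the isometry
`B_t ↦ k(t,·)` in finite form; limits are taken separately on both sides, so no closed span has to
be constructed. -/
theorem integral_linearCombination_mul {x : ι → Ω → ℝ} {y : ι → Ω' → ℝ}
    (hx : ∀ i, MemLp (x i) 2 μ) (hy : ∀ i, MemLp (y i) 2 ν)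
    (h : ∀ i j, ∫ ω, x i ω * x j ω ∂μ = ∫ ω, y i ω * y j ω ∂ν) (c d : ι →₀ ℝ) :
    ∫ ω, Finsupp.linearCombination ℝ x c ω * Finsupp.linearCombination ℝ x d ω ∂μ =
      ∫ ω, Finsupp.linearCombination ℝ y c ω * Finsupp.linearCombination ℝ y d ω ∂ν := by
  have hX := memLp_linearCombination hx
  have hY := memLp_linearCombination hy
  induction c using Finsupp.induction_linear with
  | zero => simp
  | add c c' hc hc' =>
    simp only [map_add, Pi.add_apply, add_mul]
    rw [integral_add (by exact (hX c).integrable_mul (hX d)) (by exact (hX c').integrable_mul (hX d)),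
      integral_add (by exact (hY c).integrable_mul (hY d))
        (by exact (hY c').integrable_mul (hY d)), hc, hc']
  | single i r =>
    induction d using Finsupp.induction_linear with
    | zero => simp
    | add d d' hd hd' =>
      have hXi := hX (Finsupp.single i r)
      have hYi := hY (Finsupp.single i r)
      simp only [map_add, Pi.add_apply, mul_add]
      rw [integral_add (by exact hXi.integrable_mul (hX d)) (by exact hXi.integrable_mul (hX d')),
        integral_add (by exact hYi.integrable_mul (hY d))
          (by exact hYi.integrable_mul (hY d')), hd, hd']
    | single j q =>
      simp only [Finsupp.linearCombination_single, Pi.smul_apply, smul_eq_mul]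
      have e : ∀ a b : ℝ, r * a * (q * b) = r * q * (a * b) := fun a b => by ring
      simp_rw [e, integral_const_mul, h]

theorem eLpNorm_two_eq_of_integral_eq {f : Ω → ℝ} {g : Ω' → ℝ} (hf : MemLp f 2 μ)
    (hg : MemLp g 2 ν) (h : ∫ ω, f ω * f ω ∂μ = ∫ ω, g ω * g ω ∂ν) :
    eLpNorm f 2 μ = eLpNorm g 2 ν := by
  rw [hf.eLpNorm_eq_integral_rpow_norm (by norm_num) (by norm_num),
    hg.eLpNorm_eq_integral_rpow_norm (by norm_num) (by norm_num)]
  have e : ∀ x : ℝ, ‖x‖ ^ (2 : ℝ≥0∞).toReal = x * x := fun x => by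
    simp [sq]
  simp_rw [e, h]

theorem eLpNorm_linearCombination {x : ι → Ω → ℝ} {y : ι → Ω' → ℝ}
    (hx : ∀ i, MemLp (x i) 2 μ) (hy : ∀ i, MemLp (y i) 2 ν)
    (h : ∀ i j, ∫ ω, x i ω * x j ω ∂μ = ∫ ω, y i ω * y j ω ∂ν) (c : ι →₀ ℝ) :
    eLpNorm (Finsupp.linearCombination ℝ x c) 2 μ =
      eLpNorm (Finsupp.linearCombination ℝ y c) 2 ν :=
  eLpNorm_two_eq_of_integral_eq (memLp_linearCombination hx c) (memLp_linearCombination hy c)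
    (integral_linearCombination_mul hx hy h c c)

theorem isGaussianProcess_linearCombination {κ : Type*} {x : ι → Ω → ℝ}
    (hx : IsGaussianProcess x μ) (D : κ → ι →₀ ℝ) :
    IsGaussianProcess (fun i => Finsupp.linearCombination ℝ x (D i)) μ := by
  refine hx.of_isGaussianProcess fun i => ⟨(D i).support, ∑ j : (D i).support,
    D i j • ContinuousLinearMap.proj (R := ℝ) (φ := fun _ : (D i).support => ℝ) j, fun ω => ?_⟩
  rw [Finsupp.linearCombination_apply, Finsupp.sum, Finset.sum_apply]
  simp only [Pi.smul_apply, smul_eq_mul, FunLike.coe_sum, Finset.sum_apply,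
    FunLike.coe_smul, ContinuousLinearMap.proj_apply, Finset.restrict]
  rw [← Finset.sum_coe_sort]

end Gram

/-! ### The kernels as a model of the process in `L²` -/

/-- The Molchan--Golosov kernel `k(t,·)` on the whole line. -/
def kernelFun (H t v : ℝ) : ℝ := (kernelLift H t v).toReal

theorem memLp_kernelFun {H t : ℝ} (hH : 1 / 2 < H) (hH' : H < 1) (ht : 0 ≤ t) :
    MemLp (kernelFun H t) 2 volume := by
  refine ⟨(measurable_kernelLift H t).ennreal_toReal.aestronglyMeasurable, ?_⟩
  rw [eLpNorm_lt_top_iff_lintegral_rpow_enorm_lt_top (by norm_num) (by norm_num)]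
  refine lt_of_le_of_lt ?_ (b := ENNReal.ofReal (fbmCov H t t)) ENNReal.ofReal_lt_top
  rw [← lintegral_kernelLift_mul hH hH' ht ht]
  refine lintegral_mono fun v => ?_
  have h1 : ‖kernelFun H t v‖ₑ ≤ kernelLift H t v := by
    unfold kernelFun
    rw [Real.enorm_of_nonneg ENNReal.toReal_nonneg]
    exact ENNReal.ofReal_toReal_le
  have h2 : ((2 : ℝ≥0∞).toReal) = (2 : ℕ) := by simp
  rw [h2, ENNReal.rpow_natCast, ← sq]
  exact pow_le_pow_left₀ zero_le h1 2

theorem integral_kernelFun_mul {H s t : ℝ} (hH : 1 / 2 < H) (hH' : H < 1) (hs : 0 ≤ s)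
    (ht : 0 ≤ t) :
    ∫ v, kernelFun H t v * kernelFun H s v = fbmCov H t s := by
  have h := lintegral_kernelLift_mul hH hH' hs ht
  have hpos : 0 ≤ fbmCov H t s := by
    unfold fbmCov
    rcases le_total s t with h | h
    · have h1 : |t - s| ^ (2 * H) ≤ t ^ (2 * H) :=
        Real.rpow_le_rpow (abs_nonneg _) (by rw [abs_of_nonneg (by linarith)]; linarith)
          (by linarith)
      have := Real.rpow_nonneg hs (2 * H)
      linarith
    · have h1 : |t - s| ^ (2 * H) ≤ s ^ (2 * H) :=
        Real.rpow_le_rpow (abs_nonneg _) (by rw [abs_of_nonpos (by linarith)]; linarith)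
          (by linarith)
      have := Real.rpow_nonneg ht (2 * H)
      linarith
  unfold kernelFun
  simp_rw [← ENNReal.toReal_mul]
  have hm : Measurable fun v => kernelLift H t v * kernelLift H s v :=
    (measurable_kernelLift H t).mul (measurable_kernelLift H s)
  rw [integral_toReal hm.aemeasurable (ae_lt_top hm (by rw [h]; exact ENNReal.ofReal_ne_top)), h,
    ENNReal.toReal_ofReal hpos]

section FBM

variable {Ω : Type*} [MeasurableSpace Ω] {P : Measure Ω} {H T : ℝ} {B : ℝ → Ω → ℝ}

theorem IsFBM.memLp (hB : IsFBM P H T B) (t : Icc (0 : ℝ) T) : MemLp (B t) 2 P :=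
  (hB.gaussian.hasGaussianLaw_eval t).memLp_two

/-- The Gram matrices of the process and of the kernels agree; this is the only link between `P` and
Lebesgue measure that the transfer arguments use. -/
theorem IsFBM.integral_mul [IsProbabilityMeasure P] (hB : IsFBM P H T B) (hH : 1 / 2 < H)
    (hH' : H < 1) (t s : Icc (0 : ℝ) T) :
    ∫ ω, B t ω * B s ω ∂P = ∫ v, kernelFun H t v * kernelFun H s v := by
  have h := hB.cov_eq t t.2 s s.2
  rw [covariance_eq_sub (hB.memLp t) (hB.memLp s), hB.mean_zero t t.2, zero_mul, sub_zero] at h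
  rw [integral_kernelFun_mul hH hH' s.2.1 t.2.1, ← h]
  rfl

end FBM

/-! ### Step functions as linear combinations of increments -/

/-- The step function as a linear combination of times: its elementary integral is the same
combination of the values of the integrator. -/
def StepIntegrand.combo {a T : ℝ} (φ : StepIntegrand a) (haT : a ≤ T) : Icc (0 : ℝ) T →₀ ℝ :=
  ∑ j, φ.coef j • (Finsupp.single ⟨φ.right j, (φ.left_nonneg j).trans (φ.left_le_right j),
    (φ.right_le j).trans haT⟩ 1 - Finsupp.single ⟨φ.left j, φ.left_nonneg j,
    ((φ.left_le_right j).trans (φ.right_le j)).trans haT⟩ 1)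

theorem StepIntegrand.linearCombination_combo {α : Type*} {a T : ℝ} (φ : StepIntegrand a)
    (haT : a ≤ T) (x : ℝ → α → ℝ) (ω : α) :
    Finsupp.linearCombination ℝ (fun t : Icc (0 : ℝ) T => x t) (φ.combo haT) ω =
      φ.integral x ω := by
  unfold StepIntegrand.combo StepIntegrand.integral
  simp [map_sum, Finset.sum_apply]

theorem StepIntegrand.measurable_eval {a : ℝ} (φ : StepIntegrand a) : Measurable φ.eval := by
  unfold StepIntegrand.eval
  exact Finset.measurable_sum _ fun j _ => measurable_const.indicator measurableSet_Ioc

theorem kernelFun_eq {H t v : ℝ} (hH : 1 / 2 < H) :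
    kernelFun H t v = ∫ s in Ioc 0 t, volterraDeriv H s v := kernelLift_toReal_eq hH

/-- An increment of `k(·,v)` is the integral of its derivative kernel. Hence integrating a step
function against `k(·,v)` is the same as applying the integral operator to it. -/
theorem StepIntegrand.integral_kernelFun {H a v : ℝ} (hH : 1 / 2 < H) (φ : StepIntegrand a)
    (hv : kernelLift H a v < ∞) :
    IntegrableOn (fun s => φ.eval s * volterraDeriv H s v) (Ioc 0 a) ∧
    φ.integral (kernelFun H) v = ∫ s in Ioc 0 a, φ.eval s * volterraDeriv H s v := by
  have hi := integrableOn_volterraDeriv hH hv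
  have hsub : ∀ j, Ioc (φ.left j) (φ.right j) ⊆ Ioc 0 a := fun j =>
    Ioc_subset_Ioc (φ.left_nonneg j) (φ.right_le j)
  have e : (fun s => φ.eval s * volterraDeriv H s v) = fun s => ∑ j,
      (Ioc (φ.left j) (φ.right j)).indicator (fun s => φ.coef j * volterraDeriv H s v) s := by
    ext s
    unfold StepIntegrand.eval
    rw [Finset.sum_mul]
    refine Finset.sum_congr rfl fun j _ => ?_
    by_cases h : s ∈ Ioc (φ.left j) (φ.right j) <;> simp [h]
  have hj : ∀ j, Integrable ((Ioc (φ.left j) (φ.right j)).indicator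
      (fun s => φ.coef j * volterraDeriv H s v)) (volume.restrict (Ioc 0 a)) := fun j =>
    (hi.const_mul (φ.coef j)).indicator measurableSet_Ioc
  rw [e]
  refine ⟨integrable_finsetSum _ fun j _ => hj j, ?_⟩
  rw [integral_finsetSum _ fun j _ => hj j]
  unfold StepIntegrand.integral
  refine Finset.sum_congr rfl fun j _ => ?_
  rw [integral_indicator measurableSet_Ioc, Measure.restrict_restrict measurableSet_Ioc,
    inter_eq_left.2 (hsub j), integral_const_mul, kernelFun_eq hH, kernelFun_eq hH]
  congr 1
  rw [← Ioc_union_Ioc_eq_Ioc (φ.left_nonneg j) (φ.left_le_right j), setIntegral_union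
    (disjoint_left.2 fun x hx hx' => absurd hx.2 (not_le.2 hx'.1)) measurableSet_Ioc
    (hi.mono_set (Ioc_subset_Ioc_right ((φ.left_le_right j).trans (φ.right_le j))))
    (hi.mono_set (hsub j))]
  ring

/-- The kernel identity read backwards: the energy of `h` is the squared `L²` norm of the lift of
`|h|`. Convergence in energy therefore controls convergence of the lifts. -/
theorem integrandEnergy_eq {H a : ℝ} (hH : 1 / 2 < H) (hH' : H < 1) {h : ℝ → ℝ}
    (hh : Measurable h) :
    integrandEnergy H a h =
      ∫⁻ v, volterraLift H ((Ioc 0 a).indicator fun s => ‖h s‖ₑ) v ^ 2 := by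
  have hm : Measurable ((Ioc 0 a).indicator fun s => ‖h s‖ₑ) :=
    hh.enorm.indicator measurableSet_Ioc
  have hz : ∀ s ≤ 0, (Ioc 0 a).indicator (fun s => ‖h s‖ₑ) s = 0 := fun s hs =>
    indicator_of_notMem (fun hc => absurd hc.1 (not_lt.2 hs)) _
  simp_rw [sq]
  rw [lintegral_volterraLift_mul hH hH' hm hm hz hz]
  unfold integrandEnergy
  rw [← lintegral_indicator measurableSet_Ioc]
  refine lintegral_congr fun s => ?_
  by_cases hs : s ∈ Ioc 0 a
  · simp only [indicator_of_mem hs]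
    rw [← lintegral_indicator measurableSet_Ioc]
    refine lintegral_congr fun w => ?_
    by_cases hw : w ∈ Ioc 0 a
    · simp only [indicator_of_mem hw]
      have h1 : 0 ≤ H * (2 * H - 1) := mul_nonneg (by linarith) (by linarith)
      rw [mul_comm (H * (2 * H - 1)), mul_assoc, mul_comm _ (H * (2 * H - 1)),
        ENNReal.ofReal_mul (by positivity), ENNReal.ofReal_mul (by positivity),
        Real.enorm_eq_ofReal_abs, Real.enorm_eq_ofReal_abs]
    · simp [hw]
  · simp [hs]

/-! ### The approximate prediction errors -/

/-- The combination `B_b - B_a + ∫ φ dB`. -/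
def residualCombo {T a b : ℝ} (ha : a ∈ Icc 0 T) (hb : b ∈ Icc 0 T) (φ : StepIntegrand a) :
    Icc (0 : ℝ) T →₀ ℝ :=
  Finsupp.single ⟨b, hb⟩ 1 - Finsupp.single ⟨a, ha⟩ 1 + φ.combo ha.2

theorem linearCombination_residualCombo {α : Type*} {T a b : ℝ} (ha : a ∈ Icc 0 T)
    (hb : b ∈ Icc 0 T) (φ : StepIntegrand a) (x : ℝ → α → ℝ) (ω : α) :
    Finsupp.linearCombination ℝ (fun t : Icc (0 : ℝ) T => x t) (residualCombo ha hb φ) ω =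
      x b ω - x a ω + φ.integral x ω := by
  unfold residualCombo
  rw [map_add, map_sub, Pi.add_apply, StepIntegrand.linearCombination_combo]
  simp

/-- On `(0,a)` the kernel increment is the lift of `-Ψ` and the elementary integral is the lift of
`φ`, so the residual is the lift of `φ - Ψ`; absolute values are then taken inside the integral. -/
theorem enorm_residual_kernelFun_le {H a b v : ℝ} (hH : 1 / 2 < H) (hH' : H < 1) (hab : a ≤ b)
    (hv : 0 < v) (hva : v < a) (hka : kernelLift H a v < ∞) (hkb : kernelLift H b v < ∞)
    (φ : StepIntegrand a) :
    ‖kernelFun H b v - kernelFun H a v + φ.integral (kernelFun H) v‖ₑ ≤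
      volterraLift H ((Ioc 0 a).indicator fun s => ‖predKernel H b a s - φ.eval s‖ₑ) v := by
  have hlift := volterraLift_predKernel hH hH' hv hva hab
  set L := volterraLift H ((Ioo 0 a).indicator fun s => ENNReal.ofReal (-predKernel H b a s)) v
    with hL
  have hLtop : L ≠ ∞ := fun h => by rw [h, top_add] at hlift; exact hkb.ne hlift.symm
  have hLeq : L = ∫⁻ s in Ioo 0 a, ENNReal.ofReal (-predKernel H b a s * volterraDeriv H s v) := by
    rw [hL]
    unfold volterraLift
    rw [← lintegral_indicator measurableSet_Ioo]
    refine lintegral_congr fun s => ?_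
    by_cases hs : s ∈ Ioo 0 a
    · simp only [indicator_of_mem hs]
      rw [ENNReal.ofReal_mul (by linarith [predKernel_nonpos hH hH' hs.1 hs.2 hab])]
    · simp [hs]
  have hmeas : Measurable fun s => -predKernel H b a s * volterraDeriv H s v :=
    (measurable_predKernel H b a hab).neg.mul
      ((measurable_volterraDeriv H).comp (measurable_id.prodMk measurable_const))
  have hnn : 0 ≤ᵐ[volume.restrict (Ioo 0 a)] fun s => -predKernel H b a s * volterraDeriv H s v :=
    (ae_restrict_mem measurableSet_Ioo).mono fun s hs =>
      mul_nonneg (by linarith [predKernel_nonpos hH hH' hs.1 hs.2 hab]) (volterraDeriv_nonneg hH _ _)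
  have hint : IntegrableOn (fun s => -predKernel H b a s * volterraDeriv H s v) (Ioc 0 a) := by
    rw [integrableOn_Ioc_iff_integrableOn_Ioo]
    refine ⟨hmeas.aestronglyMeasurable, ?_⟩
    rw [hasFiniteIntegral_iff_ofReal hnn, ← hLeq]
    exact hLtop.lt_top
  have hdiff : kernelFun H b v - kernelFun H a v =
      ∫ s in Ioc 0 a, -predKernel H b a s * volterraDeriv H s v := by
    rw [integral_Ioc_eq_integral_Ioo, integral_eq_lintegral_of_nonneg_ae hnn
      hmeas.aestronglyMeasurable, ← hLeq]
    unfold kernelFun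
    rw [← hlift, ENNReal.toReal_add hLtop hka.ne]
    ring
  obtain ⟨hφ1, hφ2⟩ := φ.integral_kernelFun hH hka
  rw [hdiff, hφ2, ← integral_add hint hφ1]
  refine (enorm_integral_le_lintegral_enorm _).trans ?_
  unfold volterraLift
  rw [← lintegral_indicator measurableSet_Ioc]
  refine lintegral_mono fun s => ?_
  by_cases hs : s ∈ Ioc 0 a
  · simp only [indicator_of_mem hs]
    rw [show -predKernel H b a s * volterraDeriv H s v + φ.eval s * volterraDeriv H s v =
      -((predKernel H b a s - φ.eval s) * volterraDeriv H s v) by ring, enorm_neg, enorm_mul,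
      Real.enorm_of_nonneg (volterraDeriv_nonneg hH s v)]
  · simp [hs]

/-- The combinations of kernels that correspond to approximate prediction errors differ from
`k(b,·)` restricted to `(a,∞)` by at most the energy of the error of the integrand. -/
theorem eLpNorm_residual_kernelFun_le {H a b : ℝ} (hH : 1 / 2 < H) (hH' : H < 1) (ha : 0 ≤ a)
    (hab : a ≤ b) (φ : StepIntegrand a) :
    eLpNorm (fun v => (kernelFun H b v - kernelFun H a v + φ.integral (kernelFun H) v) -
      (Ioi a).indicator (kernelFun H b) v) 2 volume ≤
      integrandEnergy H a (fun s => predKernel H b a s - φ.eval s) ^ (1 / 2 : ℝ) := by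
  rw [eLpNorm_eq_lintegral_rpow_enorm_toReal (by norm_num) (by norm_num),
    integrandEnergy_eq hH hH'
      (by exact (measurable_predKernel H b a hab).sub φ.measurable_eval)]
  simp only [ENNReal.toReal_ofNat]
  refine ENNReal.rpow_le_rpow (lintegral_mono_ae ?_) (by norm_num)
  have hne : ∀ᵐ v : ℝ, v ≠ a := by simp [ae_iff, measure_singleton]
  filter_upwards [kernelLift_ae_lt_top hH hH' ha, kernelLift_ae_lt_top hH hH' (ha.trans hab), hne]
    with v h1 h2 h3
  have hpow : ∀ x : ℝ≥0∞, x ^ (2 : ℝ) = x ^ 2 := fun x => by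
    rw [← ENNReal.rpow_natCast]; norm_num
  rw [hpow]
  refine pow_le_pow_left₀ zero_le ?_ 2
  have hzero : ∀ t, (t ≤ v ∨ v ≤ 0) → kernelFun H t v = 0 := fun t ht => by
    unfold kernelFun
    rw [kernelLift_eq_zero ht, ENNReal.toReal_zero]
  -- For `v ≤ 0` everything vanishes. For `0 < v < a` the pointwise bound applies. For `v > a` all
  -- kernels up to time `a` vanish and the difference is exactly zero.
  rcases le_or_gt v 0 with hv | hv
  · have : φ.integral (kernelFun H) v = 0 := Finset.sum_eq_zero fun j _ => by
      rw [hzero _ (Or.inr hv), hzero _ (Or.inr hv)]; ring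
    rw [this, hzero _ (Or.inr hv), hzero _ (Or.inr hv), indicator_of_notMem (by
      simp only [mem_Ioi]; linarith)]
    simp
  rcases lt_or_gt_of_ne h3 with hva | hva
  · rw [indicator_of_notMem (by simp only [mem_Ioi]; linarith), sub_zero]
    exact enorm_residual_kernelFun_le hH hH' hab hv hva h1 h2 φ
  · have : φ.integral (kernelFun H) v = 0 := Finset.sum_eq_zero fun j _ => by
      have := φ.left_le_right j
      have := φ.right_le j
      rw [hzero _ (Or.inl (by linarith)), hzero _ (Or.inl (by linarith))]; ring
    rw [this, hzero a (Or.inl hva.le), indicator_of_mem (show v ∈ Ioi a from hva)]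
    simp

/-! ### Density of step functions -/

/-- The step function that samples `h` at the left end points of `n` intervals of equal length. -/
def sampleStep {a : ℝ} (ha : 0 < a) (h : ℝ → ℝ) (n : ℕ) (hn : 0 < n) : StepIntegrand a where
  n := n
  left j := a * j / n
  right j := a * (j + 1) / n
  coef j := h (a * j / n)
  left_nonneg j := by positivity
  left_le_right j := by gcongr; linarith
  right_le j := by
    have hn' : (0 : ℝ) < n := by exact_mod_cast hn
    have hj : ((j : ℕ) : ℝ) + 1 ≤ n := by exact_mod_cast j.2
    rw [div_le_iff₀ hn']
    exact mul_le_mul_of_nonneg_left hj ha.le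

theorem sampleStep_eval {a : ℝ} (ha : 0 < a) (h : ℝ → ℝ) (n : ℕ) (hn : 0 < n) {s : ℝ}
    (hs : s ∈ Ioc 0 a) :
    ∃ r ∈ Icc 0 a, |s - r| ≤ a / n ∧ (sampleStep ha h n hn).eval s = h r := by
  have hn' : (0 : ℝ) < n := by exact_mod_cast hn
  -- The cells are open on the left, so a ceiling is needed: `s` lies in the `m`-th cell, counted
  -- from one, whose index is `j = m - 1`.
  obtain ⟨m, hm⟩ : ∃ m : ℕ, m = ⌈s * n / a⌉₊ := ⟨_, rfl⟩
  have hpos : 0 < s * n / a := div_pos (mul_pos hs.1 hn') ha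
  have hm1 : 1 ≤ m := hm ▸ Nat.one_le_ceil_iff.2 hpos
  have hmn : m ≤ n := by
    rw [hm]
    refine Nat.ceil_le.2 ?_
    rw [div_le_iff₀ ha]
    nlinarith [hs.2]
  have hle : s * n / a ≤ m := hm ▸ Nat.le_ceil _
  have hlt : (m : ℝ) - 1 < s * n / a := by
    have := Nat.ceil_lt_add_one hpos.le
    rw [← hm] at this
    linarith
  rw [div_le_iff₀ ha] at hle
  rw [lt_div_iff₀ ha] at hlt
  obtain ⟨j, rfl⟩ : ∃ j, m = j + 1 := ⟨m - 1, by omega⟩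
  push_cast at hle hlt
  have hl : a * j / n < s := by rw [div_lt_iff₀ hn']; nlinarith
  have hr : s ≤ a * (j + 1) / n := by rw [le_div_iff₀ hn']; nlinarith
  refine ⟨a * j / n, ⟨by positivity, hl.le.trans hs.2⟩, ?_, ?_⟩
  · rw [abs_of_pos (by linarith)]
    have : a * (j + 1) / n = a * j / n + a / n := by ring
    linarith
  · unfold StepIntegrand.eval
    refine (Finset.sum_eq_single (⟨j, hmn⟩ : Fin n) ?_ ?_).trans ?_
    rotate_left 2
    · exact indicator_of_mem (show s ∈ Ioc (a * j / n) (a * (j + 1) / n) from ⟨hl, hr⟩) _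
    · intro i _ hi
      refine indicator_of_notMem (fun hc => hi ?_) _
      have h1 : a * ((i : ℕ) : ℝ) / n < s := hc.1
      have h2 : s ≤ a * (((i : ℕ) : ℝ) + 1) / n := hc.2
      have h3 := h1.trans_le hr
      have h4 := hl.trans_le h2
      rw [div_lt_div_iff_of_pos_right hn'] at h3 h4
      have h5 := lt_of_mul_lt_mul_left h3 ha.le
      have h6 := lt_of_mul_lt_mul_left h4 ha.le
      have h7 : (i : ℕ) < j + 1 := by exact_mod_cast h5
      have h8 : j < (i : ℕ) + 1 := by exact_mod_cast h6
      exact Fin.ext (by simp only; omega)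
    · exact fun h => absurd (Finset.mem_univ _) h

/-- Half of the error goes into replacing `g` by a continuous function, half into sampling that
function, which is uniformly continuous on `[0,a]`; the finite length of the interval turns the
uniform bound into an `L²` bound. -/
theorem exists_stepIntegrand_eLpNorm_sub_le {a : ℝ} (ha : 0 < a) {g : ℝ → ℝ}
    (hg : MemLp g 2 (volume.restrict (Ioc 0 a))) {ε : ℝ≥0∞} (hε : ε ≠ 0) :
    ∃ φ : StepIntegrand a,
      eLpNorm (fun s => g s - φ.eval s) 2 (volume.restrict (Ioc 0 a)) ≤ ε := by
  have hε2 : ε / 2 ≠ 0 := by simpa using hε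
  obtain ⟨h, -, h1, hc, h2⟩ := hg.exists_hasCompactSupport_eLpNorm_sub_le (by norm_num) hε2
  have hfin : volume.restrict (Ioc 0 a) univ ^ ((2 : ℝ≥0∞).toReal)⁻¹ ≠ ∞ := by
    simp
  obtain ⟨δ, hδ, hδ'⟩ : ∃ δ : ℝ, 0 < δ ∧
      volume.restrict (Ioc 0 a) univ ^ ((2 : ℝ≥0∞).toReal)⁻¹ * ENNReal.ofReal δ ≤ ε / 2 := by
    have : Tendsto (fun δ : ℝ => volume.restrict (Ioc 0 a) univ ^ ((2 : ℝ≥0∞).toReal)⁻¹ *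
        ENNReal.ofReal δ) (𝓝[>] 0) (𝓝 0) := by
      have h3 : Tendsto (fun δ : ℝ => ENNReal.ofReal δ) (𝓝[>] 0) (𝓝 0) := by
        have := (ENNReal.continuous_ofReal.tendsto 0).mono_left (nhdsWithin_le_nhds (s := Ioi 0))
        simpa using this
      simpa using ENNReal.Tendsto.const_mul h3 (Or.inr hfin)
    have h4 := this.eventually (ge_mem_nhds (pos_iff_ne_zero.2 hε2))
    obtain ⟨δ, h5, h6⟩ := (h4.and self_mem_nhdsWithin).exists
    exact ⟨δ, h6, h5⟩
  have huc := isCompact_Icc.uniformContinuousOn_of_continuous (hc.continuousOn (s := Icc 0 a))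
  rw [Metric.uniformContinuousOn_iff] at huc
  obtain ⟨η, hη, hη'⟩ := huc δ hδ
  obtain ⟨n, hn⟩ := exists_nat_gt (a / η)
  have hn0 : (0 : ℝ) < n := (div_pos ha hη).trans hn
  have hnpos : 0 < n := by exact_mod_cast hn0
  have hstep : a / n < η := by
    rw [div_lt_iff₀ hn0]
    rwa [div_lt_iff₀ hη, mul_comm] at hn
  refine ⟨sampleStep ha h n hnpos, ?_⟩
  have e : (fun s => g s - (sampleStep ha h n hnpos).eval s) =
      (g - h) + fun s => h s - (sampleStep ha h n hnpos).eval s := by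
    ext s; simp
  rw [e]
  refine (eLpNorm_add_le (hg.1.sub h2.1)
    (h2.1.sub (StepIntegrand.measurable_eval _).aestronglyMeasurable) (by norm_num)).trans ?_
  refine (add_le_add h1 ((eLpNorm_le_of_ae_bound (C := δ) ?_).trans hδ')).trans
    (ENNReal.add_halves ε).le
  refine (ae_restrict_mem measurableSet_Ioc).mono fun s hs => ?_
  obtain ⟨r, hr, hsr, he⟩ := sampleStep_eval ha h n hnpos hs
  rw [Pi.sub_apply, he, ← dist_eq_norm]
  exact (hη' s ⟨hs.1.le, hs.2⟩ r hr (by rw [Real.dist_eq]; exact hsr.trans_lt hstep)).le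

/-! ### The energy is dominated by the `L²` norm -/

/-- Schur's test: `|h(s)||h(w)| ≤ |h(s)|² + |h(w)|²`, and the integral of `|s - w|^{2H-2}` over one
variable is bounded uniformly in the other. Density of step functions in `L²` thus yields density in
energy. -/
theorem integrandEnergy_le {H a : ℝ} (hH : 1 / 2 < H) {h : ℝ → ℝ}
    (hh : Measurable h) :
    integrandEnergy H a h ≤ 2 * (ENNReal.ofReal (H * (2 * H - 1)) *
      ENNReal.ofReal (2 * a ^ (2 * H - 1) / (2 * H - 1))) * ∫⁻ s in Ioc 0 a, ‖h s‖ₑ ^ 2 := by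
  have h1 : 0 < 2 * H - 1 := by linarith
  have h0 : 0 < H := by linarith
  set c := ENNReal.ofReal (H * (2 * H - 1)) with hc
  set M := ENNReal.ofReal (2 * a ^ (2 * H - 1) / (2 * H - 1)) with hM
  set I := ∫⁻ s in Ioc 0 a, ‖h s‖ₑ ^ 2 with hI
  have hker : ∀ s ∈ Ioc 0 a, ∫⁻ w in Ioc 0 a, ENNReal.ofReal (|s - w| ^ (2 * H - 2)) ≤ M := by
    intro s hs
    rw [lintegral_abs_sub_rpow (by linarith) hs.1.le hs.2]
    refine ENNReal.ofReal_le_ofReal ?_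
    rw [show 2 * H - 2 + 1 = 2 * H - 1 by ring]
    have e1 : s ^ (2 * H - 1) ≤ a ^ (2 * H - 1) := Real.rpow_le_rpow hs.1.le hs.2 h1.le
    have e2 : (a - s) ^ (2 * H - 1) ≤ a ^ (2 * H - 1) :=
      Real.rpow_le_rpow (by linarith [hs.2]) (by linarith [hs.1]) h1.le
    gcongr
    linarith
  have hmain : ∫⁻ s in Ioc 0 a, ∫⁻ w in Ioc 0 a,
      c * (‖h s‖ₑ ^ 2 * ENNReal.ofReal (|s - w| ^ (2 * H - 2))) ≤ c * M * I := by
    calc _ = ∫⁻ s in Ioc 0 a, c * (‖h s‖ₑ ^ 2 *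
          ∫⁻ w in Ioc 0 a, ENNReal.ofReal (|s - w| ^ (2 * H - 2))) := by
          refine lintegral_congr fun s => ?_
          rw [lintegral_const_mul _ (by fun_prop), lintegral_const_mul _ (by fun_prop)]
      _ ≤ ∫⁻ s in Ioc 0 a, c * M * ‖h s‖ₑ ^ 2 := by
          refine setLIntegral_mono (by fun_prop) fun s hs => ?_
          rw [mul_assoc, mul_comm M]
          exact mul_le_mul_right (mul_le_mul_right (hker s hs) _) _
      _ = c * M * I := lintegral_const_mul _ (by fun_prop)
  have hmain' : ∫⁻ s in Ioc 0 a, ∫⁻ w in Ioc 0 a,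
      c * (‖h w‖ₑ ^ 2 * ENNReal.ofReal (|s - w| ^ (2 * H - 2))) ≤ c * M * I := by
    rw [lintegral_lintegral_swap (by
      refine Measurable.aemeasurable ?_
      unfold Function.uncurry
      fun_prop)]
    simpa only [abs_sub_comm] using hmain
  calc integrandEnergy H a h
      ≤ ∫⁻ s in Ioc 0 a, ∫⁻ w in Ioc 0 a,
        (c * (‖h s‖ₑ ^ 2 * ENNReal.ofReal (|s - w| ^ (2 * H - 2))) +
          c * (‖h w‖ₑ ^ 2 * ENNReal.ofReal (|s - w| ^ (2 * H - 2)))) := by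
        unfold integrandEnergy
        refine lintegral_mono fun s => lintegral_mono fun w => ?_
        rw [ENNReal.ofReal_mul (show 0 ≤ H * (2 * H - 1) by positivity), ← mul_add, ← add_mul,
          ENNReal.ofReal_mul (show 0 ≤ |h s| * |h w| by positivity)]
        refine mul_le_mul_right ?_ c
        refine mul_le_mul_left ?_ _
        rw [Real.enorm_eq_ofReal_abs, Real.enorm_eq_ofReal_abs, ← ENNReal.ofReal_pow (abs_nonneg _),
          ← ENNReal.ofReal_pow (abs_nonneg _), ← ENNReal.ofReal_add (by positivity) (by positivity)]
        refine ENNReal.ofReal_le_ofReal ?_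
        nlinarith [sq_nonneg (|h s| - |h w|), sq_nonneg (|h s|), sq_nonneg (|h w|)]
    _ = (∫⁻ s in Ioc 0 a, ∫⁻ w in Ioc 0 a,
          c * (‖h s‖ₑ ^ 2 * ENNReal.ofReal (|s - w| ^ (2 * H - 2)))) +
        ∫⁻ s in Ioc 0 a, ∫⁻ w in Ioc 0 a,
          c * (‖h w‖ₑ ^ 2 * ENNReal.ofReal (|s - w| ^ (2 * H - 2))) := by
        rw [← lintegral_add_left]
        · refine lintegral_congr fun s => ?_
          rw [lintegral_add_left (by fun_prop)]
        · refine Measurable.lintegral_prod_right' (f := fun q : ℝ × ℝ =>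
            c * (‖h q.1‖ₑ ^ 2 * ENNReal.ofReal (|q.1 - q.2| ^ (2 * H - 2)))) ?_
          fun_prop
    _ ≤ c * M * I + c * M * I := add_le_add hmain hmain'
    _ = _ := by ring

/-- The inner integral is bounded in `s`, and the squares of the end-point singularities `s^{1/2-H}`
and `(a-s)^{1/2-H}` have exponent `1 - 2H > -1`. -/
theorem memLp_predKernel {H a b : ℝ} (hH : 1 / 2 < H) (hH' : H < 1) (ha : 0 < a) (hab : a ≤ b) :
    MemLp (predKernel H b a) 2 (volume.restrict (Ioc 0 a)) := by
  have hm := measurable_predKernel H b a hab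
  refine ⟨hm.aestronglyMeasurable, ?_⟩
  rw [eLpNorm_lt_top_iff_lintegral_rpow_enorm_lt_top (by norm_num) (by norm_num),
    ← restrict_Ioo_eq_restrict_Ioc]
  have hc := predConst_pos hH hH'
  set C := Real.sin (Real.pi * (H - 1 / 2)) / Real.pi with hC
  have hb : 0 < b := ha.trans_le hab
  -- Bounding `z - a` by `z - s` removes one power and all dependence on `s`, at the price of the
  -- integrable singularity `(z - a)^{H - 3/2}`.
  set J := ∫ z in a..b, b ^ (H - 1 / 2) * (z - a) ^ (H - 3 / 2) with hJ
  have iJ : IntervalIntegrable (fun z => b ^ (H - 1 / 2) * (z - a) ^ (H - 3 / 2)) volume a b := by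
    refine IntervalIntegrable.const_mul ?_ _
    have := (intervalIntegral.intervalIntegrable_rpow' (r := H - 3 / 2) (a := 0) (b := b - a)
      (by linarith)).comp_sub_right a
    simpa using this
  have inner : ∀ s ∈ Ioo 0 a, ∫ z in a..b, z ^ (H - 1 / 2) * (z - a) ^ (H - 1 / 2) / (z - s) ≤ J := by
    intro s hs
    refine intervalIntegral.integral_mono_on_of_le_Ioo hab
      (intervalIntegrable_predKernel_inner hH hs.2 hab) iJ fun z hz => ?_
    have z1 : 0 < z - a := by linarith [hz.1]
    have z2 : 0 < z - s := by linarith [hz.1, hs.2]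
    have z3 : 0 < z := by linarith
    rw [div_le_iff₀ z2, show H - 1 / 2 = (H - 3 / 2) + 1 by ring, Real.rpow_add_one z1.ne',
      show H - 3 / 2 + 1 = H - 1 / 2 by ring]
    have e1 : z ^ (H - 1 / 2) ≤ b ^ (H - 1 / 2) := Real.rpow_le_rpow z3.le hz.2.le (by linarith)
    have e2 : z - a ≤ z - s := by linarith [hs.2]
    rw [← mul_assoc]
    gcongr
  set r : ℝ := 1 - 2 * H with hr
  set K : ℝ := C ^ 2 * J ^ 2 * (a / 2) ^ r with hK
  have hK0 : 0 ≤ K := by positivity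
  have bound : ∀ s ∈ Ioo 0 a, ‖predKernel H b a s‖ₑ ^ (2 : ℝ≥0∞).toReal ≤
      ENNReal.ofReal K * ENNReal.ofReal (|0 - s| ^ r) +
        ENNReal.ofReal K * ENNReal.ofReal (|a - s| ^ r) := by
    intro s hs
    have s1 := hs.1
    have s2 : 0 < a - s := by linarith [hs.2]
    have hinner0 : 0 ≤ ∫ z in a..b, z ^ (H - 1 / 2) * (z - a) ^ (H - 1 / 2) / (z - s) := by
      refine intervalIntegral.integral_nonneg hab fun z hz => ?_
      have z1 : 0 < z - s := by linarith [hz.1]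
      have z2 : 0 ≤ z - a := by linarith [hz.1]
      have z3 : 0 < z := by linarith
      positivity
    have hsq : (predKernel H b a s) ^ 2 ≤ C ^ 2 * J ^ 2 * (s ^ r * (a - s) ^ r) := by
      have e3 : (predKernel H b a s) ^ 2 = C ^ 2 *
          (∫ z in a..b, z ^ (H - 1 / 2) * (z - a) ^ (H - 1 / 2) / (z - s)) ^ 2 *
          (s ^ r * (a - s) ^ r) := by
        have e4 : ∀ x : ℝ, 0 < x → x ^ r = x ^ (1 / 2 - H) * x ^ (1 / 2 - H) := fun x hx => by
          rw [← Real.rpow_add hx]; congr 1; rw [hr]; ring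
        unfold predKernel
        rw [e4 s s1, e4 _ s2]
        ring
      rw [e3]
      have := inner s hs
      gcongr
    -- At least one of `s` and `a - s` is at least `a/2`, so only one factor can be singular; this
    -- separates the two singularities.
    have hprod : s ^ r * (a - s) ^ r ≤ (a / 2) ^ r * (s ^ r + (a - s) ^ r) := by
      have hrneg : r ≤ 0 := by rw [hr]; linarith
      have p1 : 0 < s ^ r := Real.rpow_pos_of_pos s1 r
      have p2 : 0 < (a - s) ^ r := Real.rpow_pos_of_pos s2 r
      have p3 : 0 < (a / 2) ^ r := Real.rpow_pos_of_pos (by linarith) r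
      rcases le_total s (a / 2) with h | h
      · have := Real.rpow_le_rpow_of_nonpos (x := a / 2) (y := a - s) (by linarith) (by linarith)
          hrneg
        nlinarith
      · have := Real.rpow_le_rpow_of_nonpos (x := a / 2) (y := s) (by linarith) (by linarith)
          hrneg
        nlinarith
    rw [← mul_add, ← ENNReal.ofReal_add (by positivity) (by positivity), ← ENNReal.ofReal_mul hK0,
      show (2 : ℝ≥0∞).toReal = (2 : ℕ) by simp, ENNReal.rpow_natCast, Real.enorm_eq_ofReal_abs,
      ← ENNReal.ofReal_pow (abs_nonneg _), sq_abs, zero_sub, abs_neg, abs_of_pos s1, abs_of_pos s2]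
    refine ENNReal.ofReal_le_ofReal (hsq.trans ?_)
    rw [hK, mul_assoc (C ^ 2 * J ^ 2)]
    exact mul_le_mul_of_nonneg_left hprod (by positivity)
  refine (setLIntegral_mono (by fun_prop) bound).trans_lt ?_
  rw [lintegral_add_left (by fun_prop), lintegral_const_mul _ (by fun_prop),
    lintegral_const_mul _ (by fun_prop), restrict_Ioo_eq_restrict_Ioc,
    lintegral_abs_sub_rpow (by rw [hr]; linarith) le_rfl ha.le,
    lintegral_abs_sub_rpow (by rw [hr]; linarith) ha.le le_rfl]
  exact ENNReal.add_lt_top.2 ⟨ENNReal.mul_lt_top ENNReal.ofReal_lt_top ENNReal.ofReal_lt_top,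
    ENNReal.mul_lt_top ENNReal.ofReal_lt_top ENNReal.ofReal_lt_top⟩

theorem exists_stepIntegrand_energy_le {H a b : ℝ} (hH : 1 / 2 < H) (hH' : H < 1) (ha : 0 ≤ a)
    (hab : a ≤ b) {ε : ℝ≥0∞} (hε : ε ≠ 0) :
    ∃ φ : StepIntegrand a,
      integrandEnergy H a (fun s => predKernel H b a s - φ.eval s) ^ (1 / 2 : ℝ) ≤ ε := by
  -- For `a = 0` the energy is an integral over an empty interval and the empty step function
  -- suffices.
  rcases ha.eq_or_lt with rfl | ha
  · refine ⟨⟨0, Fin.elim0, Fin.elim0, Fin.elim0, fun j => j.elim0, fun j => j.elim0,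
      fun j => j.elim0⟩, ?_⟩
    simp [integrandEnergy]
  set c := 2 * (ENNReal.ofReal (H * (2 * H - 1)) *
    ENNReal.ofReal (2 * a ^ (2 * H - 1) / (2 * H - 1))) with hc
  have hctop : c ^ (1 / 2 : ℝ) ≠ ∞ :=
    ENNReal.rpow_ne_top_of_nonneg (by norm_num) (ENNReal.mul_ne_top (by norm_num)
      (ENNReal.mul_ne_top ENNReal.ofReal_ne_top ENNReal.ofReal_ne_top))
  obtain ⟨η, hη, hη'⟩ : ∃ η : ℝ≥0∞, η ≠ 0 ∧ c ^ (1 / 2 : ℝ) * η ≤ ε := by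
    rcases eq_or_ne (c ^ (1 / 2 : ℝ)) 0 with h0 | h0
    · exact ⟨1, one_ne_zero, by rw [h0, zero_mul]; exact zero_le⟩
    · exact ⟨ε / c ^ (1 / 2 : ℝ), (ENNReal.div_pos hε hctop).ne', by
        rw [ENNReal.mul_div_cancel h0 hctop]⟩
  obtain ⟨φ, hφ⟩ := exists_stepIntegrand_eLpNorm_sub_le ha (memLp_predKernel hH hH' ha hab) hη
  refine ⟨φ, le_trans ?_ hη'⟩
  refine le_trans ?_ (mul_le_mul_right hφ _)
  rw [eLpNorm_eq_lintegral_rpow_enorm_toReal (by norm_num) (by norm_num),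
    show (2 : ℝ≥0∞).toReal = 2 by simp,
    ← ENNReal.mul_rpow_of_nonneg _ _ (by norm_num : (0 : ℝ) ≤ 1 / 2)]
  refine ENNReal.rpow_le_rpow ?_ (by norm_num)
  refine (integrandEnergy_le hH
    ((measurable_predKernel H b a hab).sub φ.measurable_eval)).trans_eq ?_
  congr 1
  refine lintegral_congr fun s => ?_
  rw [← ENNReal.rpow_natCast]
  norm_num

/-! ### Existence of the Wiener integral of the prediction kernel -/

section Prediction

variable {Ω : Type*} [MeasurableSpace Ω] {P : Measure Ω} {H T a b : ℝ}
  {B : ℝ → Ω → ℝ}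

theorem IsFBM.memLp_integral (hB : IsFBM P H T B) (haT : a ≤ T) (φ : StepIntegrand a) :
    MemLp (φ.integral B) 2 P := by
  have := memLp_linearCombination hB.memLp (φ.combo haT)
  rwa [show Finsupp.linearCombination ℝ (fun t : Icc (0 : ℝ) T => B t) (φ.combo haT) =
    φ.integral B from funext fun ω => φ.linearCombination_combo haT B ω] at this

theorem memLp_kernelFun_coe (hH : 1 / 2 < H) (hH' : H < 1) (t : Icc (0 : ℝ) T) :
    MemLp (kernelFun H t) 2 volume := memLp_kernelFun hH hH' t.2.1

theorem memLp_tail_kernelFun (hH : 1 / 2 < H) (hH' : H < 1) (hb : 0 ≤ b) :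
    MemLp ((Ioi a).indicator (kernelFun H b)) 2 volume :=
  (memLp_kernelFun hH hH' hb).indicator measurableSet_Ioi

/-- The difference of two elementary integrals is the difference of two residuals. On the kernel
side both residuals approximate the same function, `k(b,·)` on `(a,∞)`, so approximation in energy
makes elementary integrals Cauchy in `L²(P)`. -/
theorem IsFBM.eLpNorm_integral_sub_le [IsProbabilityMeasure P] (hB : IsFBM P H T B)
    (hH : 1 / 2 < H) (hH' : H < 1)
    (ha : a ∈ Icc 0 T) (hb : b ∈ Icc 0 T) (hab : a ≤ b) (φ ψ : StepIntegrand a) :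
    eLpNorm (φ.integral B - ψ.integral B) 2 P ≤
      integrandEnergy H a (fun s => predKernel H b a s - φ.eval s) ^ (1 / 2 : ℝ) +
      integrandEnergy H a (fun s => predKernel H b a s - ψ.eval s) ^ (1 / 2 : ℝ) := by
  have h1 := eLpNorm_linearCombination hB.memLp (memLp_kernelFun_coe hH hH')
    (fun t s => hB.integral_mul hH hH' t s) (residualCombo ha hb φ - residualCombo ha hb ψ)
  have e1 : Finsupp.linearCombination ℝ (fun t : Icc (0 : ℝ) T => B t)
      (residualCombo ha hb φ - residualCombo ha hb ψ) = φ.integral B - ψ.integral B := by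
    ext ω
    rw [map_sub, Pi.sub_apply, linearCombination_residualCombo, linearCombination_residualCombo,
      Pi.sub_apply]
    ring
  set A : StepIntegrand a → ℝ → ℝ := fun φ v =>
    (kernelFun H b v - kernelFun H a v + φ.integral (kernelFun H) v) -
      (Ioi a).indicator (kernelFun H b) v with hA
  have hmem : ∀ φ, AEStronglyMeasurable (A φ) volume := fun φ => by
    have h2 := memLp_linearCombination (memLp_kernelFun_coe hH hH') (residualCombo ha hb φ)
    have h3 := (h2.sub (memLp_tail_kernelFun (a := a) hH hH' hb.1)).1
    refine h3.congr (ae_of_all _ fun v => ?_)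
    rw [Pi.sub_apply, linearCombination_residualCombo]
  have e2 : Finsupp.linearCombination ℝ (fun t : Icc (0 : ℝ) T => kernelFun H t)
      (residualCombo ha hb φ - residualCombo ha hb ψ) = A φ - A ψ := by
    ext v
    rw [map_sub, Pi.sub_apply, linearCombination_residualCombo, linearCombination_residualCombo,
      Pi.sub_apply]
    simp only [hA]
    ring
  rw [e1, e2] at h1
  rw [h1]
  refine (eLpNorm_sub_le (hmem φ) (hmem ψ) (by norm_num)).trans ?_
  exact add_le_add (eLpNorm_residual_kernelFun_le hH hH' ha.1 hab φ)
    (eLpNorm_residual_kernelFun_le hH hH' ha.1 hab ψ)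

theorem IsFBM.exists_isWienerIntegral [IsProbabilityMeasure P] (hB : IsFBM P H T B)
    (hH : 1 / 2 < H) (hH' : H < 1)
    (ha : a ∈ Icc 0 T) (hb : b ∈ Icc 0 T) (hab : a ≤ b) :
    ∃ I, IsWienerIntegral P B H a (fun s => predKernel H b a s) I := by
  have hε : ∀ n : ℕ, ((1 / 2 : ℝ≥0∞)) ^ n ≠ 0 := fun n => pow_ne_zero _ (by simp)
  choose φ hφ using fun n => exists_stepIntegrand_energy_le hH hH' ha.1 hab (hε n)
  have hfin : ∀ n : ℕ, ((1 / 2 : ℝ≥0∞)) ^ n ≠ ∞ := fun n => ENNReal.pow_ne_top (by simp)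
  have hanti : ∀ N n : ℕ, N ≤ n → ((1 / 2 : ℝ≥0∞)) ^ n ≤ (1 / 2) ^ N := fun N n h =>
    pow_le_pow_of_le_one zero_le (by simp) h
  -- The two errors are at most `(1/2)^N` each; the constant `3` instead of `2` gives the strict
  -- inequality required.
  obtain ⟨I, hI, hlim⟩ := Lp.cauchy_complete_eLpNorm (μ := P) (p := 2) (by norm_num)
    (fun n => hB.memLp_integral ha.2 (φ n)) (B := fun N => 3 * (1 / 2) ^ N) (by
      rw [ENNReal.tsum_mul_left, ENNReal.tsum_geometric]
      refine ENNReal.mul_ne_top (by norm_num) ?_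
      simp) (fun N n m hn hm => by
      refine (hB.eLpNorm_integral_sub_le hH hH' ha hb hab (φ n) (φ m)).trans_lt ?_
      refine (add_le_add ((hφ n).trans (hanti N n hn)) ((hφ m).trans (hanti N m hm))).trans_lt ?_
      rw [← two_mul]
      exact ENNReal.mul_lt_mul_left (hε N) (hfin N) (by norm_num))
  refine ⟨I, (measurable_predKernel H b a hab).aestronglyMeasurable, hI, φ, ?_, hlim⟩
  have h1 : Tendsto (fun n : ℕ => ((1 / 2 : ℝ≥0∞)) ^ n) atTop (𝓝 0) :=
    ENNReal.tendsto_pow_atTop_nhds_zero_of_lt_one (by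
      rw [one_div]; exact ENNReal.inv_lt_one.2 (by norm_num))
  have h2 := (ENNReal.continuous_rpow_const (y := 2)).tendsto 0 |>.comp h1
  rw [ENNReal.zero_rpow_of_pos (by norm_num)] at h2
  refine tendsto_of_tendsto_of_tendsto_of_le_of_le tendsto_const_nhds h2 (fun _ => zero_le)
    fun n => ?_
  have h3 := ENNReal.rpow_le_rpow (hφ n) (by norm_num : (0 : ℝ) ≤ 2)
  rw [← ENNReal.rpow_mul] at h3
  norm_num at h3
  simpa using h3

theorem wienerIntegral_spec {u : ℝ} {g : ℝ → ℝ} (h : ∃ I, IsWienerIntegral P B H u g I) :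
    IsWienerIntegral P B H u g (wienerIntegral P B H u g) := by
  unfold wienerIntegral
  rw [dif_pos h]
  exact h.choose_spec

/-! ### The prediction error -/

/-- The error `B_b - B̂_b(a)` of the prediction. -/
def predError (P : Measure Ω) (B : ℝ → Ω → ℝ) (H b a : ℝ) (ω : Ω) : ℝ :=
  B b ω - condMean P B H b a ω

/-- One sequence of step functions serves on both sides: its residuals tend to the prediction error
in `L²(P)` and to the truncated kernel in `L²(dv)`. The covariances of the error are then computed
by passing to the limit in both spaces. -/
theorem IsFBM.exists_seq_predError [IsProbabilityMeasure P] (hB : IsFBM P H T B) (hH : 1 / 2 < H)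
    (hH' : H < 1)
    (ha : a ∈ Icc 0 T) (hb : b ∈ Icc 0 T) (hab : a ≤ b) :
    ∃ φ : ℕ → StepIntegrand a,
      MemLp (wienerIntegral P B H a (fun s => predKernel H b a s)) 2 P ∧
      Tendsto (fun n => eLpNorm (fun ω => (φ n).integral B ω -
        wienerIntegral P B H a (fun s => predKernel H b a s) ω) 2 P) atTop (𝓝 0) ∧
      MemLp (predError P B H b a) 2 P ∧
      Tendsto (fun n => eLpNorm (fun ω => Finsupp.linearCombination ℝ
        (fun t : Icc (0 : ℝ) T => B t) (residualCombo ha hb (φ n)) ω - predError P B H b a ω) 2 P)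
        atTop (𝓝 0) ∧
      Tendsto (fun n => eLpNorm (fun v => Finsupp.linearCombination ℝ
        (fun t : Icc (0 : ℝ) T => kernelFun H t) (residualCombo ha hb (φ n)) v -
          (Ioi a).indicator (kernelFun H b) v) 2 volume) atTop (𝓝 0) := by
  obtain ⟨-, hI, φ, h1, h2⟩ := wienerIntegral_spec (hB.exists_isWienerIntegral hH hH' ha hb hab)
  refine ⟨φ, hI, h2, ?_, ?_, ?_⟩
  · exact (hB.memLp ⟨b, hb⟩).sub ((hB.memLp ⟨a, ha⟩).sub hI)
  · refine h2.congr fun n => ?_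
    congr 1
    ext ω
    rw [linearCombination_residualCombo]
    unfold predError condMean
    ring
  · have h3 := (ENNReal.continuous_rpow_const (y := 1 / 2)).tendsto 0 |>.comp h1
    rw [ENNReal.zero_rpow_of_pos (by norm_num)] at h3
    refine tendsto_of_tendsto_of_tendsto_of_le_of_le tendsto_const_nhds h3 (fun _ => zero_le)
      fun n => ?_
    simp only [linearCombination_residualCombo]
    exact eLpNorm_residual_kernelFun_le hH hH' ha.1 hab (φ n)

/-- The corresponding functions have disjoint supports: `k(t,·)` vanishes beyond `t ≤ a`, the
truncated kernel up to `a`. -/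
theorem IsFBM.integral_predError_mul [IsProbabilityMeasure P] (hB : IsFBM P H T B) (hH : 1 / 2 < H)
    (hH' : H < 1)
    (ha : a ∈ Icc 0 T) (hb : b ∈ Icc 0 T) (hab : a ≤ b) {t : ℝ} (ht : t ∈ Icc 0 a) :
    ∫ ω, predError P B H b a ω * B t ω ∂P = 0 := by
  obtain ⟨φ, -, -, hR, h1, h2⟩ := hB.exists_seq_predError hH hH' ha hb hab
  have htT : t ∈ Icc 0 T := ⟨ht.1, ht.2.trans ha.2⟩
  have l1 := tendsto_integral_mul_of_tendsto_eLpNorm (fun n => memLp_linearCombination hB.memLp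
    (residualCombo ha hb (φ n))) hR (Y := fun _ => B t) (fun _ => hB.memLp ⟨t, htT⟩)
    (hB.memLp ⟨t, htT⟩) h1 (by simp)
  have l2 := tendsto_integral_mul_of_tendsto_eLpNorm (fun n => memLp_linearCombination
    (memLp_kernelFun_coe hH hH') (residualCombo ha hb (φ n))) (memLp_tail_kernelFun hH hH' hb.1)
    (Y := fun _ => kernelFun H t) (fun _ => memLp_kernelFun hH hH' ht.1)
    (memLp_kernelFun hH hH' ht.1) h2 (by simp)
  have e : ∀ n, ∫ ω, Finsupp.linearCombination ℝ (fun t : Icc (0 : ℝ) T => B t)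
      (residualCombo ha hb (φ n)) ω * B t ω ∂P = ∫ v, Finsupp.linearCombination ℝ
      (fun t : Icc (0 : ℝ) T => kernelFun H t) (residualCombo ha hb (φ n)) v * kernelFun H t v :=
    fun n => by
      have := integral_linearCombination_mul hB.memLp (memLp_kernelFun_coe hH hH')
        (fun t s => hB.integral_mul hH hH' t s) (residualCombo ha hb (φ n))
        (Finsupp.single ⟨t, htT⟩ 1)
      simpa using this
  simp_rw [e] at l1
  rw [tendsto_nhds_unique l1 l2]
  refine integral_eq_zero_of_ae (ae_of_all _ fun v => ?_)
  by_cases hv : v ∈ Ioi a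
  · have : kernelFun H t v = 0 := by
      unfold kernelFun
      rw [kernelLift_eq_zero (Or.inl (ht.2.trans (le_of_lt hv))), ENNReal.toReal_zero]
    simp [this]
  · simp [hv]

/-- The second moment is the squared norm of the truncated kernel, and the integral of `k(b,·)²`
beyond `a` is the conditional variance. -/
theorem IsFBM.integral_predError_sq [IsProbabilityMeasure P] (hB : IsFBM P H T B) (hH : 1 / 2 < H)
    (hH' : H < 1)
    (ha : a ∈ Icc 0 T) (hb : b ∈ Icc 0 T) (hab : a ≤ b) :
    ∫ ω, predError P B H b a ω * predError P B H b a ω ∂P = condVar H b a := by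
  obtain ⟨φ, -, -, hR, h1, h2⟩ := hB.exists_seq_predError hH hH' ha hb hab
  have m1 := fun n => memLp_linearCombination hB.memLp (residualCombo ha hb (φ n))
  have m2 := fun n => memLp_linearCombination (memLp_kernelFun_coe hH hH')
    (residualCombo ha hb (φ n))
  have l1 := tendsto_integral_mul_of_tendsto_eLpNorm m1 hR m1 hR h1 h1
  have l2 := tendsto_integral_mul_of_tendsto_eLpNorm m2 (memLp_tail_kernelFun hH hH' hb.1) m2
    (memLp_tail_kernelFun hH hH' hb.1) h2 h2
  simp_rw [fun n => integral_linearCombination_mul hB.memLp (memLp_kernelFun_coe hH hH')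
        (fun t s => hB.integral_mul hH hH' t s) (residualCombo ha hb (φ n))
        (residualCombo ha hb (φ n))] at l1
  rw [tendsto_nhds_unique l1 l2]
  obtain ⟨h3, h4⟩ := lintegral_kernelLift_sq_Ioi hH hH' ha.1 hab
  have hm : Measurable fun v => kernelLift H b v ^ 2 := (measurable_kernelLift H b).pow_const 2
  have h5 : condVar H b a = ∫ v in Ioi a, (kernelLift H b v ^ 2).toReal := by
    rw [integral_toReal hm.aemeasurable (ae_lt_top hm (by rw [← h3]; exact ENNReal.ofReal_ne_top)),
      ← h3, ENNReal.toReal_ofReal h4]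
  rw [h5, ← integral_indicator measurableSet_Ioi]
  congr 1
  ext v
  by_cases hv : v ∈ Ioi a
  · simp only [indicator_of_mem hv]
    unfold kernelFun
    rw [ENNReal.toReal_pow, sq]
  · simp only [indicator_of_notMem hv, mul_zero]

theorem IsFBM.integral_predError [IsProbabilityMeasure P] (hB : IsFBM P H T B) (hH : 1 / 2 < H)
    (hH' : H < 1)
    (ha : a ∈ Icc 0 T) (hb : b ∈ Icc 0 T) (hab : a ≤ b) :
    ∫ ω, predError P B H b a ω ∂P = 0 := by
  obtain ⟨φ, -, -, hR, h1, -⟩ := hB.exists_seq_predError hH hH' ha hb hab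
  have l1 := tendsto_integral_of_tendsto_eLpNorm (fun n => memLp_linearCombination hB.memLp
    (residualCombo ha hb (φ n))) hR h1
  have e : ∀ c : Icc (0 : ℝ) T →₀ ℝ,
      ∫ ω, Finsupp.linearCombination ℝ (fun t : Icc (0 : ℝ) T => B t) c ω ∂P = 0 := fun c => by
    induction c using Finsupp.induction_linear with
    | zero => simp
    | add c d hc hd =>
      simp only [map_add, Pi.add_apply]
      rw [integral_add ((memLp_linearCombination hB.memLp c).integrable (by norm_num))
        ((memLp_linearCombination hB.memLp d).integrable (by norm_num)), hc, hd, add_zero]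
    | single t r =>
      simp only [Finsupp.linearCombination_single, Pi.smul_apply, smul_eq_mul]
      rw [integral_const_mul, hB.mean_zero t t.2, mul_zero]
  simp_rw [e] at l1
  exact tendsto_nhds_unique l1 tendsto_const_nhds

/-- Joint Gaussianity of the error with the whole past, which independence requires: the past enters
the approximating processes as constant sequences. -/
theorem IsFBM.isGaussianProcess_predError [IsProbabilityMeasure P] (hB : IsFBM P H T B)
    (hH : 1 / 2 < H) (hH' : H < 1)
    (ha : a ∈ Icc 0 T) (hb : b ∈ Icc 0 T) (hab : a ≤ b) :
    IsGaussianProcess (Sum.elim (fun t : Icc (0 : ℝ) a => B t)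
      (fun _ : Unit => predError P B H b a)) P := by
  obtain ⟨φ, -, -, hR, h1, -⟩ := hB.exists_seq_predError hH hH' ha hb hab
  refine isGaussianProcess_of_tendsto_eLpNorm
    (fun n => isGaussianProcess_linearCombination hB.gaussian
      (Sum.elim (fun t : Icc (0 : ℝ) a => Finsupp.single ⟨t, t.2.1, t.2.2.trans ha.2⟩ 1)
        (fun _ : Unit => residualCombo ha hb (φ n)))) ?_ ?_
  · rintro (t | _)
    · exact hB.memLp ⟨t, t.2.1, t.2.2.trans ha.2⟩
    · exact hR
  · rintro (t | _)
    · simp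
    · exact h1

/-- Uncorrelated and jointly Gaussian implies independent, here for the entire path up to `a` at
once. -/
theorem IsFBM.indepFun_predError [IsProbabilityMeasure P] (hB : IsFBM P H T B) (hH : 1 / 2 < H)
    (hH' : H < 1)
    (ha : a ∈ Icc 0 T) (hb : b ∈ Icc 0 T) (hab : a ≤ b) :
    IndepFun (fun ω (t : Icc (0 : ℝ) a) => B t ω) (predError P B H b a) P := by
  obtain ⟨φ, -, -, hR, -, -⟩ := hB.exists_seq_predError hH hH' ha hb hab
  have hBt : ∀ t : Icc (0 : ℝ) a, MemLp (B t) 2 P := fun t =>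
    hB.memLp ⟨t, t.2.1, t.2.2.trans ha.2⟩
  have h := (hB.isGaussianProcess_predError hH hH' ha hb hab).indepFun_of_covariance_eq_zero
    (fun t => (hBt t).1.aemeasurable) (fun _ => hR.1.aemeasurable) (fun t _ => by
      have h0 := hB.integral_predError_mul hH hH' ha hb hab t.2
      rw [covariance_eq_sub (hBt t) hR, hB.integral_predError hH hH' ha hb hab, mul_zero, sub_zero]
      simpa [mul_comm] using h0)
  exact h.comp (ψ := fun g : Unit → ℝ => g ()) measurable_id (measurable_pi_apply _)

theorem IsFBM.map_predError [IsProbabilityMeasure P] (hB : IsFBM P H T B) (hH : 1 / 2 < H)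
    (hH' : H < 1)
    (ha : a ∈ Icc 0 T) (hb : b ∈ Icc 0 T) (hab : a ≤ b) :
    P.map (predError P B H b a) = gaussianReal 0 (condVar H b a).toNNReal := by
  obtain ⟨φ, -, -, hR, -, -⟩ := hB.exists_seq_predError hH hH' ha hb hab
  have h : HasGaussianLaw (predError P B H b a) P :=
    (hB.isGaussianProcess_predError hH hH' ha hb hab).hasGaussianLaw_eval (Sum.inr ())
  have hv : Var[predError P B H b a; P] = condVar H b a := by
    rw [variance_eq_sub hR, hB.integral_predError hH hH' ha hb hab,
      ← hB.integral_predError_sq hH hH' ha hb hab]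
    simp [sq]
  rw [h.map_eq_gaussianReal, hB.integral_predError hH hH' ha hb hab, hv]

/-! ### Measurability with respect to the past -/

theorem measurable_past {Ω : Type*} {S : ℝ → Ω → ℝ} {s t : ℝ} (hs : s ∈ Icc 0 t) :
    Measurable[past S t] (S s) := by
  refine Measurable.mono (comap_measurable (S s)) ?_ le_rfl
  exact le_iSup₂ (f := fun s (_ : s ∈ Icc (0 : ℝ) t) => MeasurableSpace.comap (S s) inferInstance)
    s hs

theorem IsFBM.past_le (hB : IsFBM P H T B) (haT : a ≤ T) : past B a ≤ ‹MeasurableSpace Ω› :=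
  iSup₂_le fun s hs => (hB.measurable s ⟨hs.1, hs.2.trans haT⟩).comap_le

/-- Elementary integrals on `[0,a]` are functions of the past, and the functions with a
past-measurable version form a closed subspace of `L²`. Only almost everywhere measurability can
hold, since the Wiener integral is an arbitrarily chosen version. -/
theorem IsFBM.aestronglyMeasurable_condMean [IsProbabilityMeasure P] (hB : IsFBM P H T B)
    (hH : 1 / 2 < H) (hH' : H < 1)
    (ha : a ∈ Icc 0 T) (hb : b ∈ Icc 0 T) (hab : a ≤ b) :
    AEStronglyMeasurable[past B a] (condMean P B H b a) P := by
  obtain ⟨φ, hI, h1, -, -, -⟩ := hB.exists_seq_predError hH hH' ha hb hab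
  have hBm : ∀ t ∈ Icc 0 a, StronglyMeasurable[past B a] (B t) := fun t ht =>
    (measurable_past ht).stronglyMeasurable
  have hφ : ∀ n, StronglyMeasurable[past B a] ((φ n).integral B) := fun n => by
    unfold StepIntegrand.integral
    refine Finset.stronglyMeasurable_fun_sum _ fun j _ => ?_
    have l := (φ n).left_nonneg j
    have m := (φ n).left_le_right j
    have r := (φ n).right_le j
    exact ((hBm _ ⟨l.trans m, r⟩).sub (hBm _ ⟨l, m.trans r⟩)).const_mul _
  have hm := hB.past_le ha.2
  have hmem := fun n => hB.memLp_integral ha.2 (φ n)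
  have hlim := (Lp.tendsto_Lp_iff_tendsto_eLpNorm'' _ hmem _ hI).2 h1
  have hW := (isClosed_aestronglyMeasurable (F := ℝ) (p := 2) (μ := P) hm).mem_of_tendsto hlim
    (Eventually.of_forall fun n =>
      (hφ n).aestronglyMeasurable.congr (hmem n).coeFn_toLp.symm)
  exact (hBm a ⟨ha.1, le_rfl⟩).aestronglyMeasurable.sub (hW.congr hI.coeFn_toLp)

end Prediction

/-! ### Conditional expectations of functions of an independent variable -/

section CondExp

variable {Ω : Type*} [mΩ : MeasurableSpace Ω] {P : Measure Ω} [IsProbabilityMeasure P]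

/-- The freezing lemma: independence makes the joint law a product, and Fubini's theorem over the
sets `A ×ˢ univ` verifies the defining property of the conditional expectation. -/
theorem condExp_comap_indepFun {E : Type*} [mE : MeasurableSpace E] {X : Ω → E} {R : Ω → ℝ}
    (hX : Measurable X) (hR : AEMeasurable R P) (h : IndepFun X R P) {G : E × ℝ → ℝ}
    (hG : Measurable G) (hint : Integrable (fun ω => G (X ω, R ω)) P) :
    (∀ᵐ ω ∂P, Integrable (fun r => G (X ω, r)) (P.map R)) ∧
      P[fun ω => G (X ω, R ω) | mE.comap X] =ᵐ[P] fun ω => ∫ r, G (X ω, r) ∂(P.map R) := by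
  have hm : mE.comap X ≤ mΩ := hX.comap_le
  have : IsProbabilityMeasure (P.map R) := Measure.isProbabilityMeasure_map hR
  have : IsProbabilityMeasure (P.map X) := Measure.isProbabilityMeasure_map hX.aemeasurable
  have hprod := (indepFun_iff_map_prod_eq_prod_map_map hX.aemeasurable hR).1 h
  have hXR : AEMeasurable (fun ω => (X ω, R ω)) P := hX.aemeasurable.prodMk hR
  have hintp : Integrable G ((P.map X).prod (P.map R)) := by
    rw [← hprod]
    exact (integrable_map_measure hG.aestronglyMeasurable hXR).2 hint
  refine ⟨ae_of_ae_map hX.aemeasurable hintp.prod_right_ae, ?_⟩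
  have hinner : StronglyMeasurable fun x => ∫ r, G (x, r) ∂(P.map R) :=
    StronglyMeasurable.integral_prod_right (f := fun x r => G (x, r)) hG.stronglyMeasurable
  have hinnerInt : Integrable (fun ω => ∫ r, G (X ω, r) ∂(P.map R)) P :=
    (integrable_map_measure hinner.aestronglyMeasurable hX.aemeasurable).1 hintp.integral_prod_left
  symm
  refine ae_eq_condExp_of_forall_setIntegral_eq hm hint (fun s _ _ => hinnerInt.integrableOn) ?_ ?_
  · rintro s ⟨A, hA, rfl⟩ -
    have hAu : MeasurableSet (A ×ˢ (univ : Set ℝ)) := hA.prod MeasurableSet.univ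
    calc ∫ ω in X ⁻¹' A, ∫ r, G (X ω, r) ∂(P.map R) ∂P
        = ∫ x in A, ∫ r, G (x, r) ∂(P.map R) ∂(P.map X) :=
          (setIntegral_map hA hinner.aestronglyMeasurable hX.aemeasurable).symm
      _ = ∫ p in A ×ˢ univ, G p ∂((P.map X).prod (P.map R)) := by
          rw [setIntegral_prod _ hintp.integrableOn]
          simp
      _ = ∫ ω in (fun ω => (X ω, R ω)) ⁻¹' (A ×ˢ univ), G (X ω, R ω) ∂P := by
          rw [← hprod, setIntegral_map hAu hG.aestronglyMeasurable hXR]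
      _ = _ := by
          congr 2
          ext ω
          simp
  · exact (hinner.comp_measurable (comap_measurable X)).aestronglyMeasurable

theorem measurable_comp_fst_snd {E : Type*} [MeasurableSpace E] {f : E → ℝ} (hf : Measurable f)
    {G : ℝ × ℝ → ℝ} (hG : Measurable G) : Measurable fun p : E × ℝ => G (f p.1, p.2) :=
  hG.comp ((hf.comp measurable_fst).prodMk measurable_snd)

/-- The freezing lemma for a sub-σ-algebra `m`: take `X` to be the identity from `Ω` to `Ω` equipped
with `m`, and replace `M` by a measurable version. -/
theorem condExp_indep {Ω : Type*} {m : MeasurableSpace Ω} [mΩ : MeasurableSpace Ω] {P : Measure Ω}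
    [IsProbabilityMeasure P] (hm : m ≤ mΩ) {R : Ω → ℝ}
    (hR : AEMeasurable R P) (h : Indep m (MeasurableSpace.comap R inferInstance) P) {M : Ω → ℝ}
    (hM : AEStronglyMeasurable[m] M P) {G : ℝ × ℝ → ℝ} (hG : Measurable G)
    (hint : Integrable (fun ω => G (M ω, R ω)) P) :
    (∀ᵐ ω ∂P, Integrable (fun r => G (M ω, r)) (P.map R)) ∧
      P[fun ω => G (M ω, R ω) | m] =ᵐ[P] fun ω => ∫ r, G (M ω, r) ∂(P.map R) := by
  obtain ⟨M', hM', hMM'⟩ := hM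
  have e : (fun ω => G (M ω, R ω)) =ᵐ[P] fun ω => G (M' ω, R ω) := hMM'.mono fun ω hω => by
    simp only [hω]
  have h' : Indep (m.comap id) (MeasurableSpace.comap R inferInstance) P := by
    rwa [MeasurableSpace.comap_id]
  have key := @condExp_comap_indepFun Ω mΩ P _ Ω m id R (measurable_id'' hm) hR h' (fun p => G (M' p.1, p.2))
    (@measurable_comp_fst_snd Ω m M' hM'.measurable G hG) (hint.congr e)
  rw [MeasurableSpace.comap_id] at key
  refine ⟨?_, (condExp_congr_ae e).trans (key.2.trans ?_)⟩
  · filter_upwards [key.1, hMM'] with ω h1 h2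
    rw [h2]
    exact h1
  · filter_upwards [hMM'] with ω h2
    rw [h2]
    rfl

/-- Scaling the standard normal law also covers `v = 0`, where the law is a point mass without
density; integrals can then always be written against the standard density. -/
theorem gaussianReal_zero_eq_map {v : ℝ} (hv : 0 ≤ v) :
    gaussianReal 0 v.toNNReal = (gaussianReal 0 1).map (Real.sqrt v * ·) := by
  rw [gaussianReal_map_const_mul, mul_zero, mul_one]
  congr 1
  ext
  simp [Real.sq_sqrt hv, Real.coe_toNNReal _ hv]

theorem integral_gaussianReal_zero {v : ℝ} (hv : 0 ≤ v) {g : ℝ → ℝ} (hg : Measurable g) :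
    ∫ r, g r ∂(gaussianReal 0 v.toNNReal) = ∫ z, g (Real.sqrt v * z) * stdNormalPDF z := by
  rw [gaussianReal_zero_eq_map hv, integral_map (by fun_prop) hg.aestronglyMeasurable,
    integral_gaussianReal_eq_integral_smul one_ne_zero]
  refine integral_congr_ae (ae_of_all _ fun z => ?_)
  simp only [smul_eq_mul, stdNormalPDF]
  ring

theorem integrable_gaussianReal_zero_iff {v : ℝ} (hv : 0 ≤ v) {g : ℝ → ℝ} (hg : Measurable g) :
    Integrable g (gaussianReal 0 v.toNNReal) ↔
      Integrable fun z => g (Real.sqrt v * z) * stdNormalPDF z := by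
  rw [gaussianReal_zero_eq_map hv, integrable_map_measure hg.aestronglyMeasurable (by fun_prop),
    gaussianReal_of_var_ne_zero _ one_ne_zero,
    integrable_withDensity_iff_integrable_smul' (measurable_gaussianPDF _ _)
      (ae_of_all _ fun _ => gaussianPDF_lt_top)]
  refine integrable_congr (ae_of_all _ fun z => ?_)
  simp only [Function.comp_apply, smul_eq_mul, stdNormalPDF, toReal_gaussianPDF]
  ring

end CondExp

/-! ### Conditional laws in the fractional Black--Scholes market -/

section Market

variable {Ω : Type*} [MeasurableSpace Ω] {P : Measure Ω} {H T a b : ℝ} {B : ℝ → Ω → ℝ}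

theorem past_eq_comap {Ω : Type*} (B : ℝ → Ω → ℝ) (a : ℝ) :
    past B a = MeasurableSpace.comap (fun ω (t : Icc (0 : ℝ) a) => B t ω) inferInstance := by
  have : (inferInstance : MeasurableSpace (Icc (0 : ℝ) a → ℝ)) =
    ⨆ t, MeasurableSpace.comap (fun g => g t) inferInstance := rfl
  rw [this, MeasurableSpace.comap_iSup, past, iSup_subtype']
  simp_rw [MeasurableSpace.comap_comp]
  rfl

theorem past_assetPrice_le {Ω : Type*} (S₀ μ σ : ℝ) (B : ℝ → Ω → ℝ) (a : ℝ) :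
    past (assetPrice S₀ μ σ B) a ≤ past B a := by
  refine iSup₂_le fun s hs => ?_
  refine Measurable.comap_le (m₁ := past B a) ?_
  unfold assetPrice
  exact (((measurable_past hs).const_mul σ).const_add (μ * s)).exp.const_mul S₀

/-- For `σ ≠ 0` the driving process is recovered from the price by taking logarithms. -/
theorem le_past_assetPrice {Ω : Type*} {S₀ σ : ℝ} (hS₀ : 0 < S₀) (hσ : σ ≠ 0) (μ : ℝ)
    (B : ℝ → Ω → ℝ) (a : ℝ) : past B a ≤ past (assetPrice S₀ μ σ B) a := by
  refine iSup₂_le fun s hs => ?_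
  refine Measurable.comap_le (m₁ := past (assetPrice S₀ μ σ B) a) ?_
  have h : Measurable[past (assetPrice S₀ μ σ B) a] (assetPrice S₀ μ σ B s) := measurable_past hs
  have e : B s = fun ω => (Real.log (assetPrice S₀ μ σ B s ω / S₀) - μ * s) / σ := by
    ext ω
    unfold assetPrice
    rw [mul_div_cancel_left₀ _ hS₀.ne', Real.log_exp]
    field_simp
    ring
  rw [e]
  exact (((h.div_const S₀).log).sub_const (μ * s)).div_const σ

theorem IsFBM.past_assetPrice_le (hB : IsFBM P H T B) (S₀ μ σ : ℝ) (haT : a ≤ T) :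
    past (assetPrice S₀ μ σ B) a ≤ ‹MeasurableSpace Ω› :=
  (FracBS.past_assetPrice_le S₀ μ σ B a).trans (hB.past_le haT)

/-- If `σ = 0` the price carries no information and `B̂` itself need not be measurable with respect
to its past. The product `σ B̂` always is, and only this product enters the price. -/
theorem IsFBM.aestronglyMeasurable_mul_condMean [IsProbabilityMeasure P] (hB : IsFBM P H T B)
    (hH : 1 / 2 < H) (hH' : H < 1) (ha : a ∈ Icc 0 T) (hb : b ∈ Icc 0 T) (hab : a ≤ b) {S₀ : ℝ}
    (hS₀ : 0 < S₀) (μ σ : ℝ) :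
    AEStronglyMeasurable[past (assetPrice S₀ μ σ B) a] (fun ω => σ * condMean P B H b a ω) P := by
  rcases eq_or_ne σ 0 with rfl | hσ
  · simp only [zero_mul]
    exact stronglyMeasurable_const.aestronglyMeasurable
  · exact ((hB.aestronglyMeasurable_condMean hH hH' ha hb hab).mono
      (le_past_assetPrice hS₀ hσ μ B a)).const_mul σ

theorem IsFBM.condExp_assetPrice [IsProbabilityMeasure P] (hB : IsFBM P H T B)
    (hH : 1 / 2 < H) (hH' : H < 1) (ha : a ∈ Icc 0 T) (hb : b ∈ Icc 0 T) (hab : a ≤ b) {S₀ : ℝ}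
    (hS₀ : 0 < S₀) (μ σ : ℝ) {h : ℝ → ℝ} (hh : Measurable fun x => h (S₀ * Real.exp x))
    (hint : Integrable (fun ω => h (assetPrice S₀ μ σ B b ω)) P) :
    ∀ᵐ ω ∂P, Integrable (fun z => h (assetPrice S₀ μ σ B a ω * Real.exp (μ * (b - a) +
        σ * (condMean P B H b a ω - B a ω) + σ * Real.sqrt (condVar H b a) * z)) *
        stdNormalPDF z) ∧
      (P[fun ω => h (assetPrice S₀ μ σ B b ω) | past (assetPrice S₀ μ σ B) a]) ω =
        ∫ z, h (assetPrice S₀ μ σ B a ω * Real.exp (μ * (b - a) +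
          σ * (condMean P B H b a ω - B a ω) + σ * Real.sqrt (condVar H b a) * z)) *
          stdNormalPDF z := by
  have hvar := (lintegral_kernelLift_sq_Ioi hH hH' ha.1 hab).2
  obtain ⟨-, -, -, hR, -, -⟩ := hB.exists_seq_predError hH hH' ha hb hab
  have hindep : Indep (past (assetPrice S₀ μ σ B) a)
      (MeasurableSpace.comap (predError P B H b a) inferInstance) P := by
    have := hB.indepFun_predError hH hH' ha hb hab
    rw [IndepFun_iff_Indep, ← past_eq_comap] at this
    exact indep_of_indep_of_le_left this (FracBS.past_assetPrice_le S₀ μ σ B a)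
  -- The frozen variable is `σ B̂` and not `B̂`, so that the case `σ = 0` needs no separate
  -- treatment.
  set G : ℝ × ℝ → ℝ := fun p => h (S₀ * Real.exp (μ * b + p.1 + σ * p.2)) with hG
  have hGm : Measurable G := hh.comp (by fun_prop : Measurable fun p : ℝ × ℝ => μ * b + p.1 + σ * p.2)
  have e : (fun ω => h (assetPrice S₀ μ σ B b ω)) =
      fun ω => G (σ * condMean P B H b a ω, predError P B H b a ω) := by
    ext ω
    simp only [hG, assetPrice, predError]
    congr 3
    ring
  rw [e] at hint ⊢
  obtain ⟨h1, h2⟩ := condExp_indep (hB.past_assetPrice_le S₀ μ σ ha.2) hR.1.aemeasurable hindep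
    (hB.aestronglyMeasurable_mul_condMean hH hH' ha hb hab hS₀ μ σ) hGm hint
  rw [hB.map_predError hH hH' ha hb hab] at h1 h2
  filter_upwards [h1, h2] with ω w1 w2
  have hm : Measurable fun r => G (σ * condMean P B H b a ω, r) :=
    hGm.comp (measurable_const.prodMk measurable_id)
  have e2 : ∀ z, G (σ * condMean P B H b a ω, Real.sqrt (condVar H b a) * z) =
      h (assetPrice S₀ μ σ B a ω * Real.exp (μ * (b - a) +
        σ * (condMean P B H b a ω - B a ω) + σ * Real.sqrt (condVar H b a) * z)) := fun z => by
    simp only [hG, assetPrice]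
    rw [mul_assoc, ← Real.exp_add]
    congr 3
    ring
  rw [integrable_gaussianReal_zero_iff hvar hm] at w1
  rw [integral_gaussianReal_zero hvar hm] at w2
  simp only [e2] at w1 w2
  exact ⟨w1, w2⟩

theorem IsFBM.integrable_assetPrice (hB : IsFBM P H T B) {t : ℝ} (ht : t ∈ Icc 0 T) (S₀ μ σ : ℝ) :
    Integrable (assetPrice S₀ μ σ B t) P := by
  have hg : HasGaussianLaw (B t) P := hB.gaussian.hasGaussianLaw_eval ⟨t, ht⟩
  have h : Integrable (fun x => Real.exp (σ * x)) (P.map (B t)) := by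
    rw [hg.map_eq_gaussianReal]
    exact integrable_exp_mul_gaussianReal σ
  have h2 := (integrable_map_measure (by fun_prop) hg.aemeasurable).1 h
  have h3 := h2.const_mul (S₀ * Real.exp (μ * t))
  refine h3.congr (ae_of_all _ fun ω => ?_)
  simp only [assetPrice, Function.comp_apply]
  rw [Real.exp_add]
  ring

end Market

/-! ### Pathwise forward integrals -/

section Forward

variable {g g' x x' : ℝ → ℝ} {a b I I' : ℝ}

theorem partition_mem_Icc {s : ℕ → ℝ} {n : ℕ} (hs : Monotone s) (h0 : s 0 = a) (hn : s n = b)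
    {j : ℕ}
    (hj : j ≤ n) : s j ∈ Icc a b :=
  ⟨h0 ▸ hs (Nat.zero_le j), hn ▸ hs hj⟩

theorem exists_partition (hab : a ≤ b) {δ : ℝ} (hδ : 0 < δ) :
    ∃ (n : ℕ) (s : ℕ → ℝ), Monotone s ∧ s 0 = a ∧ s n = b ∧ ∀ j < n, s (j + 1) - s j < δ := by
  obtain ⟨n, hn⟩ := exists_nat_gt ((b - a) / δ)
  have hn0 : (0 : ℝ) < n := (div_nonneg (by linarith) hδ.le).trans_lt hn
  -- A partition is a monotone sequence on all of `ℕ`; `min j n` keeps it constant after the last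
  -- point.
  refine ⟨n, fun j => a + (min j n : ℕ) * ((b - a) / n), ?_, ?_, ?_, ?_⟩
  · intro i j hij
    have : (0 : ℝ) ≤ (b - a) / n := div_nonneg (by linarith) hn0.le
    simp only
    gcongr
  · simp
  · simp only [min_self]
    field_simp
    ring
  · intro j hj
    have h1 : ((j : ℕ) : ℝ) + 1 ≤ n := by exact_mod_cast hj
    simp only
    rw [min_eq_left (Nat.succ_le_of_lt hj), min_eq_left hj.le]
    push_cast
    have : (b - a) / n < δ := by
      rw [div_lt_iff₀ hn0]
      rwa [div_lt_iff₀ hδ, mul_comm] at hn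
    linarith

/-- Uniqueness needs partitions of arbitrarily small mesh, hence `a ≤ b`; otherwise there are no
partitions and every number is an integral. -/
theorem HasForwardIntegral.unique (hab : a ≤ b) (h : HasForwardIntegral g x a b I)
    (h' : HasForwardIntegral g x a b I') : I = I' := by
  by_contra hne
  have hpos : 0 < |I - I'| / 2 := half_pos (abs_pos.2 (sub_ne_zero.2 hne))
  obtain ⟨δ, hδ, h1⟩ := h _ hpos
  obtain ⟨δ', hδ', h2⟩ := h' _ hpos
  obtain ⟨n, s, hs, h0, hn, hm⟩ := exists_partition hab (lt_min hδ hδ')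
  have e1 := h1 n s hs h0 hn fun j hj => (hm j hj).trans_le (min_le_left _ _)
  have e2 := h2 n s hs h0 hn fun j hj => (hm j hj).trans_le (min_le_right _ _)
  set A := ∑ j ∈ Finset.range n, g (s j) * (x (s (j + 1)) - x (s j))
  have : |I - I'| ≤ |A - I| + |A - I'| := by
    rw [abs_sub_comm A I]
    exact abs_sub_le _ _ _
  linarith

theorem HasForwardIntegral.eq (hab : a ≤ b) (h : HasForwardIntegral g x a b I) :
    forwardIntegral g x a b = I := by
  have hex : ∃ I, HasForwardIntegral g x a b I := ⟨I, h⟩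
  unfold forwardIntegral
  rw [dif_pos hex]
  exact hex.choose_spec.unique hab h

theorem HasForwardIntegral.congr (h : HasForwardIntegral g x a b I)
    (hg : ∀ u ∈ Icc a b, g u = g' u) (hx : ∀ u ∈ Icc a b, x u = x' u) :
    HasForwardIntegral g' x' a b I := by
  intro ε hε
  obtain ⟨δ, hδ, h1⟩ := h ε hε
  refine ⟨δ, hδ, fun n s hs h0 hn hm => ?_⟩
  have e : ∑ j ∈ Finset.range n, g' (s j) * (x' (s (j + 1)) - x' (s j)) =
      ∑ j ∈ Finset.range n, g (s j) * (x (s (j + 1)) - x (s j)) := by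
    refine Finset.sum_congr rfl fun j hj => ?_
    have hj := Finset.mem_range.1 hj
    have m1 := partition_mem_Icc hs h0 hn hj.le
    have m2 := partition_mem_Icc hs h0 hn (Nat.succ_le_of_lt hj)
    rw [hg _ m1, hx _ m1, ← hx _ m2]
  rw [e]
  exact h1 n s hs h0 hn hm

/-- Stated on the elementary products, so that it gives additivity in the integrand and in the
integrator alike. -/
theorem HasForwardIntegral.combine {g₁ x₁ g₂ x₂ g₃ x₃ : ℝ → ℝ} {I₁ I₂ : ℝ}
    (h₁ : HasForwardIntegral g₁ x₁ a b I₁) (h₂ : HasForwardIntegral g₂ x₂ a b I₂)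
    (h : ∀ u v, g₃ u * (x₃ v - x₃ u) = g₁ u * (x₁ v - x₁ u) + g₂ u * (x₂ v - x₂ u)) :
    HasForwardIntegral g₃ x₃ a b (I₁ + I₂) := by
  intro ε hε
  obtain ⟨δ, hδ, h3⟩ := h₁ (ε / 2) (half_pos hε)
  obtain ⟨δ', hδ', h4⟩ := h₂ (ε / 2) (half_pos hε)
  refine ⟨min δ δ', lt_min hδ hδ', fun n s hs h0 hn hm => ?_⟩
  have e1 := h3 n s hs h0 hn fun j hj => (hm j hj).trans_le (min_le_left _ _)
  have e2 := h4 n s hs h0 hn fun j hj => (hm j hj).trans_le (min_le_right _ _)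
  simp_rw [h, Finset.sum_add_distrib]
  rw [abs_lt] at *
  constructor <;> linarith

theorem HasForwardIntegral.const_mul' {c : ℝ} (h : HasForwardIntegral g x a b I)
    (h' : ∀ u v, g' u * (x' v - x' u) = c * (g u * (x v - x u))) :
    HasForwardIntegral g' x' a b (c * I) := by
  intro ε hε
  have hc : 0 < |c| + 1 := by positivity
  obtain ⟨δ, hδ, h3⟩ := h (ε / (|c| + 1)) (div_pos hε hc)
  refine ⟨δ, hδ, fun n s hs h0 hn hm => ?_⟩
  have e1 := h3 n s hs h0 hn hm
  simp_rw [h', ← Finset.mul_sum]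
  rw [← mul_sub, abs_mul]
  rw [lt_div_iff₀ hc] at e1
  nlinarith [abs_nonneg c, abs_nonneg ((∑ j ∈ Finset.range n, g (s j) * (x (s (j + 1)) - x (s j))) - I)]

theorem HasForwardIntegral.add_left (h : HasForwardIntegral g x a b I)
    (h' : HasForwardIntegral g' x a b I') :
    HasForwardIntegral (fun u => g u + g' u) x a b (I + I') :=
  h.combine h' fun u v => by ring

theorem HasForwardIntegral.add_right (h : HasForwardIntegral g x a b I)
    (h' : HasForwardIntegral g x' a b I') :
    HasForwardIntegral g (fun u => x u + x' u) a b (I + I') :=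
  h.combine h' fun u v => by ring

theorem HasForwardIntegral.mul_left (h : HasForwardIntegral g x a b I) (c : ℝ) :
    HasForwardIntegral (fun u => c * g u) x a b (c * I) :=
  h.const_mul' fun u v => by ring

theorem HasForwardIntegral.mul_right (h : HasForwardIntegral g x a b I) (c : ℝ) :
    HasForwardIntegral g (fun u => c * x u) a b (c * I) :=
  h.const_mul' fun u v => by ring

theorem hasForwardIntegral_zero_left : HasForwardIntegral (fun _ => 0) x a b 0 :=
  fun ε hε => ⟨1, one_pos, fun n s _ _ _ _ => by simpa using hε⟩

theorem hasForwardIntegral_zero_right : HasForwardIntegral g (fun _ => 0) a b 0 :=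
  fun ε hε => ⟨1, one_pos, fun n s _ _ _ _ => by simpa using hε⟩

theorem hasForwardIntegral_sum_left {ι : Type*} (s : Finset ι) {g : ι → ℝ → ℝ} {I : ι → ℝ}
    (h : ∀ i ∈ s, HasForwardIntegral (g i) x a b (I i)) :
    HasForwardIntegral (fun u => ∑ i ∈ s, g i u) x a b (∑ i ∈ s, I i) := by
  classical
  induction s using Finset.induction_on with
  | empty => simpa using hasForwardIntegral_zero_left
  | insert i s hi ih =>
    simp_rw [Finset.sum_insert hi]
    exact (h i (Finset.mem_insert_self i s)).add_left
      (ih fun j hj => h j (Finset.mem_insert_of_mem hj))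

theorem hasForwardIntegral_sum_right {ι : Type*} (s : Finset ι) {x : ι → ℝ → ℝ} {I : ι → ℝ}
    (h : ∀ i ∈ s, HasForwardIntegral g (x i) a b (I i)) :
    HasForwardIntegral g (fun u => ∑ i ∈ s, x i u) a b (∑ i ∈ s, I i) := by
  classical
  induction s using Finset.induction_on with
  | empty => simpa using hasForwardIntegral_zero_right
  | insert i s hi ih =>
    simp_rw [Finset.sum_insert hi]
    exact (h i (Finset.mem_insert_self i s)).add_right
      (ih fun j hj => h j (Finset.mem_insert_of_mem hj))

theorem hasForwardIntegral_one : HasForwardIntegral (fun _ => 1) x a b (x b - x a) := by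
  refine fun ε hε => ⟨1, one_pos, fun n s _ h0 hn _ => ?_⟩
  simp_rw [one_mul]
  rw [Finset.sum_range_sub (fun j => x (s j)), h0, hn, sub_self, abs_zero]
  exact hε

/-- The unit jump immediately after time `c`. -/
def unitJump (c u : ℝ) : ℝ := (Ioi c).indicator (fun _ => 1) u

theorem unitJump_of_lt {c u : ℝ} (h : c < u) : unitJump c u = 1 := indicator_of_mem (mem_Ioi.2 h) _

theorem unitJump_of_le {c u : ℝ} (h : u ≤ c) : unitJump c u = 0 :=
  indicator_of_notMem (fun hc => absurd hc (not_lt.2 h)) _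

theorem unitJump_nonneg (c u : ℝ) : 0 ≤ unitJump c u := indicator_nonneg (fun _ _ => zero_le_one) _

/-- The terms after `c` telescope to `x b - x p`, where `p` is the first partition point beyond `c`,
and `p` tends to `c` with the mesh. The minimum with `b` covers a jump outside the interval. -/
theorem hasForwardIntegral_unitJump (hx : ContinuousOn x (Icc a b)) {c : ℝ} (hc : a ≤ c) :
    HasForwardIntegral (unitJump c) x a b (x b - x (min c b)) := by
  intro ε hε
  rcases le_or_gt b c with hbc | hbc
  · refine ⟨1, one_pos, fun n s hs h0 hn _ => ?_⟩
    rw [Finset.sum_eq_zero]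
    · simpa [min_eq_right hbc] using hε
    · intro j hj
      have := (partition_mem_Icc hs h0 hn (Finset.mem_range.1 hj).le).2
      rw [unitJump_of_le (this.trans hbc), zero_mul]
  have hcw := hx c ⟨hc, hbc.le⟩
  rw [Metric.continuousWithinAt_iff] at hcw
  obtain ⟨δ, hδ, h1⟩ := hcw ε hε
  refine ⟨δ, hδ, fun n s hs h0 hn hm => ?_⟩
  have key : ∀ m ≤ n, (s m ≤ c → ∑ j ∈ Finset.range m,
        unitJump c (s j) * (x (s (j + 1)) - x (s j)) = 0) ∧
      (c < s m → ∃ p ∈ Icc a b, |p - c| < δ ∧ ∑ j ∈ Finset.range m,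
        unitJump c (s j) * (x (s (j + 1)) - x (s j)) = x (s m) - x p) := by
    intro m
    induction m with
    | zero => exact fun _ => ⟨fun _ => by simp, fun h => absurd h (by rw [h0]; exact not_lt.2 hc)⟩
    | succ m ih =>
      intro hmn
      obtain ⟨i1, i2⟩ := ih (by omega)
      have hmono := hs (Nat.le_succ m)
      have hstep := hm m (by omega)
      rw [Finset.sum_range_succ]
      refine ⟨fun h => ?_, fun h => ?_⟩
      · rw [i1 (hmono.trans h), unitJump_of_le (hmono.trans h)]
        ring
      · rcases le_or_gt (s m) c with hsm | hsm
        · refine ⟨s (m + 1), partition_mem_Icc hs h0 hn hmn, ?_, ?_⟩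
          · rw [abs_of_pos (by linarith)]
            linarith
          · rw [i1 hsm, unitJump_of_le hsm]
            ring
        · obtain ⟨p, hp, hpc, e⟩ := i2 hsm
          refine ⟨p, hp, hpc, ?_⟩
          rw [e, unitJump_of_lt hsm]
          ring
  obtain ⟨p, hp, hpc, e⟩ := (key n le_rfl).2 (by rwa [hn])
  have h2 := h1 hp (by rwa [Real.dist_eq])
  rw [Real.dist_eq] at h2
  rw [e, hn, min_eq_left hbc.le, show x b - x p - (x b - x c) = -(x p - x c) by ring, abs_neg]
  exact h2

/-- Only the partition interval straddling `c` contributes, with `g` evaluated at its left end `p ≤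
c`, which tends to `c`. -/
theorem hasForwardIntegral_unitJump_right (hg : ContinuousOn g (Icc a b)) {c : ℝ} (hc : a ≤ c) :
    HasForwardIntegral g (unitJump c) a b (unitJump c b * g c) := by
  intro ε hε
  rcases le_or_gt b c with hbc | hbc
  · refine ⟨1, one_pos, fun n s hs h0 hn _ => ?_⟩
    rw [Finset.sum_eq_zero]
    · simpa [unitJump_of_le hbc] using hε
    · intro j hj
      have hj := Finset.mem_range.1 hj
      have m1 := (partition_mem_Icc hs h0 hn hj.le).2
      have m2 := (partition_mem_Icc hs h0 hn (Nat.succ_le_of_lt hj)).2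
      rw [unitJump_of_le (m1.trans hbc), unitJump_of_le (m2.trans hbc)]
      ring
  have hcw := hg c ⟨hc, hbc.le⟩
  rw [Metric.continuousWithinAt_iff] at hcw
  obtain ⟨δ, hδ, h1⟩ := hcw ε hε
  refine ⟨δ, hδ, fun n s hs h0 hn hm => ?_⟩
  have key : ∀ m ≤ n, (s m ≤ c → ∑ j ∈ Finset.range m,
        g (s j) * (unitJump c (s (j + 1)) - unitJump c (s j)) = 0) ∧
      (c < s m → ∃ p ∈ Icc a b, |p - c| < δ ∧ ∑ j ∈ Finset.range m,
        g (s j) * (unitJump c (s (j + 1)) - unitJump c (s j)) = g p) := by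
    intro m
    induction m with
    | zero => exact fun _ => ⟨fun _ => by simp, fun h => absurd h (by rw [h0]; exact not_lt.2 hc)⟩
    | succ m ih =>
      intro hmn
      obtain ⟨i1, i2⟩ := ih (by omega)
      have hmono := hs (Nat.le_succ m)
      have hstep := hm m (by omega)
      rw [Finset.sum_range_succ]
      refine ⟨fun h => ?_, fun h => ?_⟩
      · rw [i1 (hmono.trans h), unitJump_of_le h, unitJump_of_le (hmono.trans h)]
        ring
      · rcases le_or_gt (s m) c with hsm | hsm
        · refine ⟨s m, partition_mem_Icc hs h0 hn (by omega), ?_, ?_⟩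
          · rw [abs_of_nonpos (by linarith)]
            linarith
          · rw [i1 hsm, unitJump_of_le hsm, unitJump_of_lt h]
            ring
        · obtain ⟨p, hp, hpc, e⟩ := i2 hsm
          refine ⟨p, hp, hpc, ?_⟩
          rw [e, unitJump_of_lt hsm, unitJump_of_lt h]
          ring
  obtain ⟨p, hp, hpc, e⟩ := (key n le_rfl).2 (by rwa [hn])
  have h2 := h1 hp (by rwa [Real.dist_eq])
  rw [Real.dist_eq] at h2
  rw [e, unitJump_of_lt hbc, one_mul]
  exact h2

end Forward

/-! ### Discrete strategies -/

section Strategy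

variable {Ω : Type*} {N : ℕ} {t : Fin (N + 1) → ℝ} {pre : Ω → ℝ} {pos : Fin N → Ω → ℝ}

/-- For `u ≥ 0` the indicator of `{0}` is `1` minus the jump at `0`, and the indicator of `(c,d]` is
a difference of two jumps; linearity then reduces forward integrals to single jumps. -/
theorem strategyPath_eq_unitJump (ht : StrictMono t) (ω : Ω) {u : ℝ} (hu : 0 ≤ u) :
    strategyPath t pre pos u ω = (pre ω * 1 + (-pre ω) * unitJump 0 u) +
      ∑ i : Fin N, (pos i ω * unitJump (t i.castSucc) u + (-pos i ω) * unitJump (t i.succ) u) := by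
  unfold strategyPath
  congr 1
  · rcases hu.eq_or_lt with rfl | hu
    · simp [unitJump_of_le]
    · rw [unitJump_of_lt hu, indicator_of_notMem (by simpa using hu.ne')]
      ring
  · refine Finset.sum_congr rfl fun i _ => ?_
    have hlt := ht i.castSucc_lt_succ
    rcases le_or_gt u (t i.castSucc) with h | h
    · rw [unitJump_of_le h, unitJump_of_le (h.trans hlt.le), indicator_of_notMem]
      · ring
      · exact fun hc => absurd hc.1 (not_lt.2 h)
    · rcases le_or_gt u (t i.succ) with h' | h'
      · rw [unitJump_of_lt h, unitJump_of_le h', indicator_of_mem (show u ∈ Ioc _ _ from ⟨h, h'⟩)]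
        ring
      · rw [unitJump_of_lt h, unitJump_of_lt h', indicator_of_notMem]
        · ring
        · exact fun hc => absurd hc.2 (not_le.2 h')

theorem hasForwardIntegral_strategyPath (ht : StrictMono t) (ht0 : t 0 = 0) (ω : Ω) {x : ℝ → ℝ}
    {s : ℝ} (hs : 0 ≤ s) (hx : ContinuousOn x (Icc 0 s)) :
    HasForwardIntegral (fun u => strategyPath t pre pos u ω) x 0 s
      (∑ i : Fin N, pos i ω * (x (min (t i.succ) s) - x (min (t i.castSucc) s))) := by
  have hnn : ∀ i, 0 ≤ t i := fun i => ht0 ▸ ht.monotone (Fin.zero_le i)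
  have h1 := ((hasForwardIntegral_one (x := x) (a := 0) (b := s)).mul_left (pre ω)).add_left
    ((hasForwardIntegral_unitJump hx le_rfl).mul_left (-pre ω))
  have h2 := h1.add_left (hasForwardIntegral_sum_left Finset.univ fun (i : Fin N) _ =>
    ((hasForwardIntegral_unitJump hx (hnn i.castSucc)).mul_left (pos i ω)).add_left
      ((hasForwardIntegral_unitJump hx (hnn i.succ)).mul_left (-pos i ω)))
  have h3 := h2.congr (g' := fun u => strategyPath t pre pos u ω) (x' := x)
    (fun u hu => (strategyPath_eq_unitJump ht ω hu.1).symm) (fun _ _ => rfl)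
  convert h3 using 1
  rw [min_eq_left hs]
  -- The position before the trade is held only at the single time `0` and earns nothing.
  have : pre ω * (x s - x 0) + -pre ω * (x s - x 0) = 0 := by ring
  rw [this, zero_add]
  refine Finset.sum_congr rfl fun i _ => ?_
  ring

theorem strategyPath_of_mem (ht : StrictMono t) (ht0 : t 0 = 0) (ω : Ω) {u : ℝ} {i : Fin N}
    (hu : u ∈ Ioc (t i.castSucc) (t i.succ)) : strategyPath t pre pos u ω = pos i ω := by
  have hnn : 0 ≤ t i.castSucc := ht0 ▸ ht.monotone (Fin.zero_le _)
  unfold strategyPath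
  rw [indicator_of_notMem (by simpa using (hnn.trans_lt hu.1).ne'), zero_add,
    Finset.sum_eq_single i, indicator_of_mem hu]
  · intro j _ hji
    refine indicator_of_notMem (fun hc => ?_) _
    rcases lt_or_gt_of_ne hji with h | h
    · have : t j.succ ≤ t i.castSucc := ht.monotone (by
        rw [Fin.le_def]; simp only [Fin.val_succ, Fin.val_castSucc]; omega)
      linarith [hu.1, hc.2]
    · have : t i.succ ≤ t j.castSucc := ht.monotone (by
        rw [Fin.le_def]; simp only [Fin.val_succ, Fin.val_castSucc]; omega)
      linarith [hu.2, hc.1]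
  · exact fun h => absurd (Finset.mem_univ _) h

/-- The path is left-continuous at positive trading times, so at `t_i` it still shows the position
held before the trade there; for `i = 0` this is `pre`. -/
theorem strategyPath_castSucc (ht : StrictMono t) (ht0 : t 0 = 0) (ω : Ω) (i : Fin N) :
    strategyPath t pre pos (t i.castSucc) ω =
      (Fin.cons pre pos : Fin (N + 1) → Ω → ℝ) i.castSucc ω := by
  obtain ⟨n, hn⟩ := i
  cases n with
  | zero =>
    have : (Fin.castSucc ⟨0, hn⟩ : Fin (N + 1)) = 0 := rfl
    rw [this, ht0, Fin.cons_zero]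
    unfold strategyPath
    rw [indicator_of_mem (by simp), Finset.sum_eq_zero, add_zero]
    intro j _
    refine indicator_of_notMem (fun hc => ?_) _
    have : 0 ≤ t j.castSucc := ht0 ▸ ht.monotone (Fin.zero_le _)
    linarith [hc.1]
  | succ m =>
    have : (Fin.castSucc ⟨m + 1, hn⟩ : Fin (N + 1)) = Fin.succ ⟨m, by omega⟩ := rfl
    rw [this, Fin.cons_succ]
    exact strategyPath_of_mem ht ht0 ω ⟨ht Fin.castSucc_lt_succ, le_rfl⟩

/-- A path that jumps once, right after `p`, is monotone or antitone according to the sign of the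
jump, so its variation is the size of the jump. -/
theorem eVariationOn_jump {y : ℝ → ℝ} {p u c : ℝ} (hpu : p < u) (hy : ∀ v ∈ Ioc p u, y v = c) :
    eVariationOn y (Icc p u) = ENNReal.ofReal |c - y p| := by
  have hp : p ∈ Icc p u := ⟨le_rfl, hpu.le⟩
  have hu : u ∈ Icc p u := ⟨hpu.le, le_rfl⟩
  have hyu : y u = c := hy u ⟨hpu, le_rfl⟩
  have mono : ∀ z : ℝ → ℝ, (∀ v ∈ Ioc p u, z v = z u) → z p ≤ z u → MonotoneOn z (Icc p u) := by
    intro z hz hpu' v hv w hw hvw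
    rcases hv.1.eq_or_lt with rfl | h1
    · rcases hw.1.eq_or_lt with rfl | h2
      · exact le_rfl
      · rw [hz w ⟨h2, hw.2⟩]
        exact hpu'
    · rw [hz v ⟨h1, hv.2⟩, hz w ⟨h1.trans_le hvw, hw.2⟩]
  rcases le_total (y p) (y u) with h | h
  · have h1 := (mono y (fun v hv => by rw [hy v hv, hyu]) h).eVariationOn_eq hp hu
    rw [inter_self] at h1
    rw [h1, hyu, abs_of_nonneg (by rw [← hyu]; linarith)]
  · have h1 := (mono (fun v => -y v) (fun v hv => by rw [hy v hv, hyu])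
      (by simpa using h)).eVariationOn_eq hp hu
    rw [inter_self] at h1
    have h2 : eVariationOn (fun v => -y v) (Icc p u) = eVariationOn y (Icc p u) := by
      unfold eVariationOn
      simp only [edist_neg_neg]
    rw [← h2, h1, hyu, abs_of_nonpos (by rw [← hyu]; linarith)]
    congr 1
    ring

/-- Induction over the trading times: variation is additive under concatenation, and on each new
interval the path makes a single jump at the left end. A trade at `t_i` is therefore counted only
strictly after `t_i`. -/
theorem eVariationOn_strategyPath (ht : StrictMono t) (ht0 : t 0 = 0) (ω : Ω) (n : ℕ) (hn : n ≤ N)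
    {u : ℝ} (hu : u ∈ Icc 0 (t ⟨n, Nat.lt_succ_of_le hn⟩)) :
    eVariationOn (fun u => strategyPath t pre pos u ω) (Icc 0 u) =
      ENNReal.ofReal (∑ i : Fin N, |trade pre pos i ω| * unitJump (t i.castSucc) u) := by
  induction n generalizing u with
  | zero =>
    have h0 : t ⟨0, Nat.lt_succ_of_le hn⟩ = 0 := ht0
    rw [h0] at hu
    have hu0 : u = 0 := le_antisymm hu.2 hu.1
    subst hu0
    rw [eVariationOn.subsingleton _ (by simp), Finset.sum_eq_zero, ENNReal.ofReal_zero]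
    intro i _
    rw [unitJump_of_le (ht0 ▸ ht.monotone (Fin.zero_le _)), mul_zero]
  | succ n ih =>
    set i : Fin N := ⟨n, hn⟩ with hi
    have ei : (⟨n, Nat.lt_succ_of_le (Nat.le_of_succ_le hn)⟩ : Fin (N + 1)) = i.castSucc := rfl
    have ei' : (⟨n + 1, Nat.lt_succ_of_le hn⟩ : Fin (N + 1)) = i.succ := rfl
    rw [ei'] at hu
    have ih' := fun {u : ℝ} => @ih (Nat.le_of_succ_le hn) u
    simp only [ei] at ih'
    rcases le_or_gt u (t i.castSucc) with h | h
    · exact ih' ⟨hu.1, h⟩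
    have hnn : 0 ≤ t i.castSucc := ht0 ▸ ht.monotone (Fin.zero_le _)
    have hadd := eVariationOn.Icc_add_Icc (fun u => strategyPath t pre pos u ω) (s := univ) hnn h.le
      (mem_univ _)
    simp only [univ_inter] at hadd
    rw [← hadd, ih' ⟨hnn, le_rfl⟩, eVariationOn_jump h (c := pos i ω)
      (fun v hv => strategyPath_of_mem ht ht0 ω ⟨hv.1, hv.2.trans hu.2⟩),
      strategyPath_castSucc ht ht0, ← ENNReal.ofReal_add
        (Finset.sum_nonneg fun j _ => mul_nonneg (abs_nonneg _)
          (unitJump_nonneg _ _)) (abs_nonneg _)]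
    congr 1
    symm
    rw [← sub_eq_iff_eq_add', ← Finset.sum_sub_distrib, Finset.sum_eq_single i]
    · rw [unitJump_of_lt h, unitJump_of_le le_rfl]
      unfold trade
      ring
    · intro j _ hji
      rcases lt_or_gt_of_ne hji with hlt | hlt
      · have : t j.castSucc < t i.castSucc := ht (by simpa using hlt)
        rw [unitJump_of_lt (this.trans h), unitJump_of_lt this, sub_self]
      · have : t i.succ ≤ t j.castSucc := ht.monotone (by
          rw [Fin.le_def]; simp only [Fin.val_succ, Fin.val_castSucc]; omega)
        rw [unitJump_of_le (hu.2.trans this), unitJump_of_le (h.le.trans (hu.2.trans this)),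
          sub_self]
    · exact fun h => absurd (Finset.mem_univ _) h

theorem totalVariation_strategyPath (ht : StrictMono t) (ht0 : t 0 = 0) (ω : Ω) {u : ℝ}
    (hu : u ∈ Icc 0 (t (Fin.last N))) :
    totalVariation (fun u => strategyPath t pre pos u ω) u =
      ∑ i : Fin N, |trade pre pos i ω| * unitJump (t i.castSucc) u := by
  unfold totalVariation
  rw [eVariationOn_strategyPath ht ht0 ω N le_rfl hu, ENNReal.toReal_ofReal]
  exact Finset.sum_nonneg fun j _ => mul_nonneg (abs_nonneg _)
    (unitJump_nonneg _ _)

theorem hasForwardIntegral_totalVariation (ht : StrictMono t) (ht0 : t 0 = 0) (ω : Ω)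
    {g : ℝ → ℝ} {s : ℝ} (hs : s ≤ t (Fin.last N)) (hg : ContinuousOn g (Icc 0 s)) :
    HasForwardIntegral g (totalVariation fun u => strategyPath t pre pos u ω) 0 s
      (∑ i : Fin N, |trade pre pos i ω| * (unitJump (t i.castSucc) s * g (t i.castSucc))) := by
  have h := hasForwardIntegral_sum_right Finset.univ fun (i : Fin N) _ =>
    (hasForwardIntegral_unitJump_right hg (ht0 ▸ ht.monotone (Fin.zero_le i.castSucc))).mul_right
      |trade pre pos i ω|
  exact h.congr (fun _ _ => rfl) fun u hu =>
    (totalVariation_strategyPath ht ht0 ω ⟨hu.1, hu.2.trans hs⟩).symm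

/-- The wealth of a discrete strategy under transaction costs. -/
theorem valueWithCosts_strategyPath (ht : StrictMono t) (ht0 : t 0 = 0) {k : ℝ}
    {S : ℝ → Ω → ℝ} {v₀ : Ω → ℝ} {ω : Ω} {s : ℝ} (hs : s ∈ Icc 0 (t (Fin.last N)))
    (hS : ContinuousOn (fun u => S u ω) (Icc 0 s)) :
    valueWithCosts k S v₀ (strategyPath t pre pos) s ω =
      v₀ ω + (∑ i : Fin N, pos i ω * (S (min (t i.succ) s) ω - S (min (t i.castSucc) s) ω)) -
      ∑ i : Fin N, |trade pre pos i ω| * (unitJump (t i.castSucc) s * (k * S (t i.castSucc) ω)) := by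
  unfold valueWithCosts
  rw [(hasForwardIntegral_strategyPath ht ht0 ω hs.1 hS).eq hs.1,
    (hasForwardIntegral_totalVariation ht ht0 ω (g := fun u => k * S u ω) hs.2
      (continuousOn_const.mul hS)).eq hs.1]

/-- In the difference of the two closed formulas the terms of earlier periods agree and those of
later periods vanish. The cost of the trade at `t_i` belongs to this period, because the unit jump
at `t_i` is still zero at time `t_i`. -/
theorem valueWithCosts_succ (ht : StrictMono t) (ht0 : t 0 = 0) {k : ℝ}
    {S : ℝ → Ω → ℝ} {v₀ : Ω → ℝ} {ω : Ω} (i : Fin N)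
    (hS : ContinuousOn (fun u => S u ω) (Icc 0 (t (Fin.last N)))) :
    valueWithCosts k S v₀ (strategyPath t pre pos) (t i.succ) ω =
      valueWithCosts k S v₀ (strategyPath t pre pos) (t i.castSucc) ω +
        pos i ω * (S (t i.succ) ω - S (t i.castSucc) ω) -
        k * S (t i.castSucc) ω * |trade pre pos i ω| := by
  have hmem : ∀ j, t j ∈ Icc 0 (t (Fin.last N)) := fun j =>
    ⟨ht0 ▸ ht.monotone (Fin.zero_le j), ht.monotone (Fin.le_last j)⟩
  rw [valueWithCosts_strategyPath ht ht0 (hmem _) (hS.mono (Icc_subset_Icc_right (hmem _).2)),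
    valueWithCosts_strategyPath ht ht0 (hmem _) (hS.mono (Icc_subset_Icc_right (hmem _).2))]
  have hlt : t i.castSucc < t i.succ := ht i.castSucc_lt_succ
  have e1 : (∑ j : Fin N, pos j ω * (S (min (t j.succ) (t i.succ)) ω -
        S (min (t j.castSucc) (t i.succ)) ω)) -
      (∑ j : Fin N, pos j ω * (S (min (t j.succ) (t i.castSucc)) ω -
        S (min (t j.castSucc) (t i.castSucc)) ω)) =
      pos i ω * (S (t i.succ) ω - S (t i.castSucc) ω) := by
    rw [← Finset.sum_sub_distrib, Finset.sum_eq_single i]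
    · rw [min_self, min_self, min_eq_left hlt.le, min_eq_right hlt.le]
      ring
    · intro j _ hji
      rcases lt_or_gt_of_ne hji with h | h
      · have h1 : t j.succ ≤ t i.castSucc := ht.monotone (by
          rw [Fin.le_def]; simp only [Fin.val_succ, Fin.val_castSucc]; omega)
        have h2 : t j.castSucc ≤ t j.succ := (ht j.castSucc_lt_succ).le
        rw [min_eq_left h1, min_eq_left (h1.trans hlt.le), min_eq_left (h2.trans h1),
          min_eq_left (h2.trans (h1.trans hlt.le)), sub_self]
      · have h1 : t i.succ ≤ t j.castSucc := ht.monotone (by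
          rw [Fin.le_def]; simp only [Fin.val_succ, Fin.val_castSucc]; omega)
        have h2 : t j.castSucc ≤ t j.succ := (ht j.castSucc_lt_succ).le
        rw [min_eq_right h1, min_eq_right (h1.trans h2), min_eq_right (hlt.le.trans h1),
          min_eq_right (hlt.le.trans (h1.trans h2))]
        ring
    · exact fun h => absurd (Finset.mem_univ _) h
  have e2 : (∑ j : Fin N, |trade pre pos j ω| *
        (unitJump (t j.castSucc) (t i.succ) * (k * S (t j.castSucc) ω))) -
      (∑ j : Fin N, |trade pre pos j ω| *
        (unitJump (t j.castSucc) (t i.castSucc) * (k * S (t j.castSucc) ω))) =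
      k * S (t i.castSucc) ω * |trade pre pos i ω| := by
    rw [← Finset.sum_sub_distrib, Finset.sum_eq_single i]
    · rw [unitJump_of_lt hlt, unitJump_of_le le_rfl]
      ring
    · intro j _ hji
      rcases lt_or_gt_of_ne hji with h | h
      · have h1 : t j.castSucc < t i.castSucc := ht (by simpa using h)
        rw [unitJump_of_lt h1, unitJump_of_lt (h1.trans hlt), sub_self]
      · have h1 : t i.succ ≤ t j.castSucc := ht.monotone (by
          rw [Fin.le_def]; simp only [Fin.val_succ, Fin.val_castSucc]; omega)
        rw [unitJump_of_le h1, unitJump_of_le (hlt.le.trans h1), sub_self]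
    · exact fun h => absurd (Finset.mem_univ _) h
  linarith

end Strategy

/-! ### Modulus of continuity of the fractional Brownian motion -/

section Modulus

/-- A continuous function whose increments over the dyadic intervals of level `n` are at most
`C * r ^ n` has modulus of continuity of order `r ^ n` at scale `2⁻ⁿ`. -/
theorem exists_modulus_of_dyadic {f : ℝ → ℝ} {T C r : ℝ} (hT : 0 < T)
    (hf : ContinuousOn f (Icc 0 T)) (hr0 : 0 < r) (hr : r < 1) (hC : 0 ≤ C)
    (h : ∀ n k : ℕ, k < 2 ^ n → |f (T * (k + 1) / 2 ^ n) - f (T * k / 2 ^ n)| ≤ C * r ^ n) :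
    ∃ K, ∀ n : ℕ, ∀ u ∈ Icc 0 T, ∀ v ∈ Icc 0 T, |u - v| ≤ T / 2 ^ n → |f u - f v| ≤ K * r ^ n := by
  have adj : ∀ n k l : ℕ, k ≤ l → l ≤ k + 1 → l ≤ 2 ^ n →
      |f (T * l / 2 ^ n) - f (T * k / 2 ^ n)| ≤ C * r ^ n := by
    intro n k l hkl hlk hl
    rcases hkl.eq_or_lt with rfl | hlt
    · simpa using by positivity
    · have : l = k + 1 := by omega
      subst this
      have := h n k (by omega)
      push_cast
      exact this
  -- `D u n` is the largest dyadic point of level `n` not exceeding `u`. Consecutive approximations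
  -- agree or are neighbours at the finer level, so `f (D u n)` converges geometrically to `f u`.
  set m : ℝ → ℕ → ℕ := fun u n => ⌊u / T * 2 ^ n⌋₊ with hm
  set D : ℝ → ℕ → ℝ := fun u n => T * m u n / 2 ^ n with hD
  have m_le : ∀ u ∈ Icc 0 T, ∀ n, m u n ≤ 2 ^ n := by
    intro u hu n
    refine Nat.floor_le_of_le ?_
    push_cast
    have : u / T ≤ 1 := (div_le_one hT).2 hu.2
    nlinarith [pow_pos (two_pos (α := ℝ)) n]
  have floor_le : ∀ u ∈ Icc 0 T, ∀ n, (m u n : ℝ) ≤ u / T * 2 ^ n := fun u hu n =>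
    Nat.floor_le (mul_nonneg (div_nonneg hu.1 hT.le) (by positivity))
  have lt_floor : ∀ u : ℝ, ∀ n, u / T * 2 ^ n < m u n + 1 := fun u n => Nat.lt_floor_add_one _
  have D_le : ∀ u ∈ Icc 0 T, ∀ n, D u n ≤ u := by
    intro u hu n
    have := mul_le_mul_of_nonneg_left (floor_le u hu n) hT.le
    rw [hD]
    simp only
    rw [div_le_iff₀ (by positivity)]
    calc T * (m u n : ℝ) ≤ T * (u / T * 2 ^ n) := this
      _ = u * 2 ^ n := by field_simp
  have le_D : ∀ u : ℝ, ∀ n, u - T / 2 ^ n ≤ D u n := by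
    intro u n
    have := mul_le_mul_of_nonneg_left (lt_floor u n).le hT.le
    rw [hD]
    simp only
    rw [sub_le_iff_le_add, ← add_div, le_div_iff₀ (by positivity)]
    calc u * 2 ^ n = T * (u / T * 2 ^ n) := by field_simp
      _ ≤ T * ((m u n : ℝ) + 1) := this
      _ = _ := by ring
  have D_mem : ∀ u ∈ Icc 0 T, ∀ n, D u n ∈ Icc 0 T := fun u hu n =>
    ⟨by rw [hD]; positivity, (D_le u hu n).trans hu.2⟩
  have D_tendsto : ∀ u ∈ Icc 0 T, Tendsto (fun n => f (D u n)) atTop (𝓝 (f u)) := by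
    intro u hu
    have h1 : Tendsto (D u) atTop (𝓝 u) := by
      have h2 : Tendsto (fun n : ℕ => u - T / 2 ^ n) atTop (𝓝 u) := by
        have := (tendsto_pow_atTop_nhds_zero_of_lt_one (r := (1 / 2 : ℝ)) (by norm_num)
          (by norm_num)).const_mul T
        have := this.const_sub u
        simp only [mul_zero, sub_zero] at this
        refine this.congr fun n => ?_
        rw [div_pow, one_pow]
        ring
      exact tendsto_of_tendsto_of_tendsto_of_le_of_le h2 tendsto_const_nhds (le_D u) (D_le u hu)
    exact ((hf u hu).tendsto).comp (tendsto_nhdsWithin_iff.2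
      ⟨h1, Eventually.of_forall (D_mem u hu)⟩)
  have chain : ∀ u ∈ Icc 0 T, ∀ n, |f (D u n) - f u| ≤ C * r ^ n / (1 - r) := by
    intro u hu n
    refine dist_le_of_le_geometric_of_tendsto (f := fun n => f (D u n)) r C hr (fun n => ?_)
      (D_tendsto u hu) n
    rw [dist_comm]
    have e : D u n = T * ((2 * m u n : ℕ) : ℝ) / 2 ^ (n + 1) := by
      rw [hD]; push_cast; field_simp; ring
    have h1 : 2 * m u n ≤ m u (n + 1) := by
      refine Nat.le_floor ?_
      push_cast
      have := floor_le u hu n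
      rw [pow_succ]; linarith
    have h2 : m u (n + 1) ≤ 2 * m u n + 1 := by
      have h3 := floor_le u hu (n + 1)
      have h4 := lt_floor u n
      rw [pow_succ] at h3
      have : (m u (n + 1) : ℝ) < ((2 * m u n + 2 : ℕ) : ℝ) := by push_cast; linarith
      have := Nat.cast_lt.1 this
      omega
    rw [e]
    refine (adj (n + 1) _ _ h1 h2 (m_le u hu _)).trans ?_
    rw [pow_succ]
    exact mul_le_mul_of_nonneg_left (mul_le_of_le_one_right (by positivity) hr.le) hC
  -- At most one step between neighbouring dyadic points of level `n`, plus one geometric chain for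
  -- each of `u` and `v`.
  refine ⟨C + 2 * (C / (1 - r)), fun n u hu v hv huv => ?_⟩
  have mid : ∀ u ∈ Icc 0 T, ∀ v ∈ Icc 0 T, v ≤ u → |u - v| ≤ T / 2 ^ n →
      |f (D u n) - f (D v n)| ≤ C * r ^ n := by
    intro u hu v hv hvu huv
    rw [abs_of_nonneg (sub_nonneg.2 hvu)] at huv
    refine adj n _ _ ?_ ?_ (m_le u hu n)
    · exact Nat.floor_mono (by gcongr)
    · have h3 := floor_le u hu n
      have h4 := lt_floor v n
      have h5 : u / T * 2 ^ n ≤ v / T * 2 ^ n + 1 := by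
        have : (u - v) / T * 2 ^ n ≤ 1 := by
          rw [div_mul_eq_mul_div, div_le_one hT]
          rwa [le_div_iff₀ (by positivity)] at huv
        rw [sub_div] at this
        linarith
      have : (m u n : ℝ) < ((m v n + 2 : ℕ) : ℝ) := by push_cast; linarith
      have := Nat.cast_lt.1 this
      omega
  have mid' : |f (D u n) - f (D v n)| ≤ C * r ^ n := by
    rcases le_total v u with hvu | hvu
    · exact mid u hu v hv hvu huv
    · rw [abs_sub_comm]
      exact mid v hv u hu hvu (by rwa [abs_sub_comm])
  have c1 := chain u hu n
  have c2 := chain v hv n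
  rw [abs_sub_comm] at c1
  calc |f u - f v| = |(f u - f (D u n)) + (f (D u n) - f (D v n)) + (f (D v n) - f v)| := by ring_nf
    _ ≤ _ := abs_add_three _ _ _
    _ ≤ C * r ^ n / (1 - r) + C * r ^ n + C * r ^ n / (1 - r) := by linarith
    _ = _ := by ring

variable {Ω : Type*} [MeasurableSpace Ω] {P : Measure Ω} {H T : ℝ} {B : ℝ → Ω → ℝ}

theorem IsFBM.map_eq [IsProbabilityMeasure P] (hB : IsFBM P H T B) (hH : 1 / 2 < H) {t : ℝ}
    (ht : t ∈ Icc 0 T) : P.map (B t) = gaussianReal 0 (t ^ (2 * H)).toNNReal := by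
  have hg : HasGaussianLaw (B t) P := hB.gaussian.hasGaussianLaw_eval ⟨t, ht⟩
  have hv : Var[B t; P] = t ^ (2 * H) := by
    rw [← covariance_self (hB.measurable t ht).aemeasurable, hB.cov_eq t ht t ht, fbmCov, sub_self,
      abs_zero, Real.zero_rpow (by linarith)]
    ring
  rw [hg.map_eq_gaussianReal, hB.mean_zero t ht, hv]

theorem IsFBM.map_sub_eq [IsProbabilityMeasure P] (hB : IsFBM P H T B) (hH : 1 / 2 < H) {s t : ℝ}
    (hs : s ∈ Icc 0 T) (ht : t ∈ Icc 0 T) :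
    P.map (fun ω => B t ω - B s ω) = gaussianReal 0 (|t - s| ^ (2 * H)).toNNReal := by
  have hg : HasGaussianLaw (fun ω => B t ω - B s ω) P :=
    hB.gaussian.hasGaussianLaw_fun_sub (s := ⟨t, ht⟩) (t := ⟨s, hs⟩)
  have hLt : MemLp (B t) 2 P := hB.memLp ⟨t, ht⟩
  have hLs : MemLp (B s) 2 P := hB.memLp ⟨s, hs⟩
  have hself : ∀ u ∈ Icc 0 T, Var[B u; P] = u ^ (2 * H) := fun u hu => by
    rw [← covariance_self (hB.measurable u hu).aemeasurable, hB.cov_eq u hu u hu, fbmCov, sub_self,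
      abs_zero, Real.zero_rpow (by linarith)]
    ring
  have hv : Var[fun ω => B t ω - B s ω; P] = |t - s| ^ (2 * H) := by
    rw [variance_fun_sub hLt hLs, hself t ht, hself s hs, hB.cov_eq t ht s hs, fbmCov]
    ring
  have hm : ∫ ω, B t ω - B s ω ∂P = 0 := by
    rw [integral_sub (hLt.integrable (by norm_num)) (hLs.integrable (by norm_num)),
      hB.mean_zero t ht, hB.mean_zero s hs, sub_zero]
  rw [hg.map_eq_gaussianReal, hm, hv]

theorem lintegral_abs_pow_gaussianReal_lt_top (p : ℕ) :
    ∫⁻ z, ENNReal.ofReal (|z| ^ p) ∂(gaussianReal 0 1) < ∞ := by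
  have h := (memLp_id_gaussianReal (μ := 0) (v := 1) (p : NNReal)).integrable_norm_pow'
  have h2 : Integrable (fun z : ℝ => |z| ^ p) (gaussianReal 0 1) := by simpa using h
  exact h2.lintegral_lt_top

theorem IsFBM.lintegral_abs_sub_pow [IsProbabilityMeasure P] (hB : IsFBM P H T B) (hH : 1 / 2 < H)
    {s t : ℝ} (hs : s ∈ Icc 0 T) (ht : t ∈ Icc 0 T) (p : ℕ) :
    ∫⁻ ω, ENNReal.ofReal (|B t ω - B s ω| ^ p) ∂P =
      ENNReal.ofReal ((|t - s| ^ H) ^ p) *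
        ∫⁻ z, ENNReal.ofReal (|z| ^ p) ∂(gaussianReal 0 1) := by
  have hm : Measurable fun x : ℝ => ENNReal.ofReal (|x| ^ p) := by fun_prop
  have hsq : Real.sqrt (|t - s| ^ (2 * H)) = |t - s| ^ H := by
    rw [mul_comm, Real.rpow_mul (abs_nonneg _), Real.rpow_two,
      Real.sqrt_sq (Real.rpow_nonneg (abs_nonneg _) _)]
  calc ∫⁻ ω, ENNReal.ofReal (|B t ω - B s ω| ^ p) ∂P
      = ∫⁻ x, ENNReal.ofReal (|x| ^ p) ∂(P.map fun ω => B t ω - B s ω) :=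
        (lintegral_map hm ((hB.measurable t ht).sub (hB.measurable s hs))).symm
    _ = ∫⁻ z, ENNReal.ofReal (|(|t - s| ^ H) * z| ^ p) ∂(gaussianReal 0 1) := by
        rw [hB.map_sub_eq hH hs ht, gaussianReal_zero_eq_map (by positivity),
          lintegral_map hm (by fun_prop), hsq]
    _ = _ := by
        rw [← lintegral_const_mul _ hm]
        refine lintegral_congr fun z => ?_
        rw [abs_mul, mul_pow, abs_of_nonneg (Real.rpow_nonneg (abs_nonneg _) _),
          ENNReal.ofReal_mul (by positivity)]

/-- Almost surely, the fractional Brownian motion has modulus of continuity of order `r ^ n` at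
scale `2⁻ⁿ`, for every `r > 2 ^ (-H)`. -/
theorem IsFBM.exists_modulus [IsProbabilityMeasure P] (hB : IsFBM P H T B) (hH : 1 / 2 < H)
    (hT : 0 < T) {r : ℝ} (hr : (2 : ℝ) ^ (-H) < r) (hr1 : r < 1) :
    ∀ᵐ ω ∂P, ∃ K, ∀ n : ℕ, ∀ u ∈ Icc 0 T, ∀ v ∈ Icc 0 T, |u - v| ≤ T / 2 ^ n →
      |B u ω - B v ω| ≤ K * r ^ n := by
  have hq0 : (0 : ℝ) < 2 ^ (-H) := by positivity
  have hr0 : 0 < r := hq0.trans hr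
  -- Level `n` has `2 ^ n` increments, each with normalized `p`-th moment of order
  -- `((2^{-H}/r)^p)^n`; the moment `p` is taken large enough to make the ratio `2 (2^{-H}/r)^p`
  -- less than one.
  obtain ⟨p, hp⟩ := exists_pow_lt_of_lt_one (x := (1 / 2 : ℝ)) (y := 2 ^ (-H) / r) (by norm_num)
    ((div_lt_one hr0).2 hr)
  have hp0 : p ≠ 0 := by
    rintro rfl
    norm_num at hp
  set c := ∫⁻ z, ENNReal.ofReal (|z| ^ p) ∂(gaussianReal 0 1) with hc
  have mem : ∀ n k : ℕ, k ≤ 2 ^ n → T * (k : ℝ) / 2 ^ n ∈ Icc 0 T := fun n k hk => by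
    refine ⟨by positivity, ?_⟩
    rw [div_le_iff₀ (by positivity)]
    exact mul_le_mul_of_nonneg_left (by exact_mod_cast hk) hT.le
  have mem' : ∀ n k : ℕ, k < 2 ^ n → T * ((k : ℝ) + 1) / 2 ^ n ∈ Icc 0 T := fun n k hk => by
    have := mem n (k + 1) hk
    rwa [Nat.cast_succ] at this
  set X : ℕ → ℕ → Ω → ℝ≥0∞ := fun n k ω =>
    ENNReal.ofReal ((r ^ n)⁻¹ ^ p) *
      ENNReal.ofReal (|B (T * (k + 1) / 2 ^ n) ω - B (T * k / 2 ^ n) ω| ^ p) with hX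
  have Xm : ∀ n, ∀ k ∈ Finset.range (2 ^ n), Measurable (X n k) := fun n k hk => by
    have hk := Finset.mem_range.1 hk
    have h1 := hB.measurable _ (mem' n k hk)
    have h2 := hB.measurable _ (mem n k hk.le)
    rw [hX]
    fun_prop
  have hterm : ∀ n, ∀ k ∈ Finset.range (2 ^ n), ∫⁻ ω, X n k ω ∂P =
      ENNReal.ofReal ((T ^ H) ^ p * (((2 : ℝ) ^ (-H) / r) ^ p) ^ n) * c := fun n k hk => by
    have hk := Finset.mem_range.1 hk
    have h1 := hB.measurable _ (mem' n k hk)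
    have h2 := hB.measurable _ (mem n k hk.le)
    rw [hX]
    simp only
    rw [lintegral_const_mul _ (by fun_prop), hB.lintegral_abs_sub_pow hH (mem n k hk.le)
      (mem' n k hk), ← mul_assoc, ← ENNReal.ofReal_mul (by positivity)]
    congr 2
    have e : |T * ((k : ℝ) + 1) / 2 ^ n - T * k / 2 ^ n| = T / 2 ^ n := by
      rw [← sub_div, ← mul_sub, add_sub_cancel_left, mul_one, abs_of_pos (by positivity)]
    rw [e, Real.div_rpow hT.le (by positivity), ← Real.rpow_natCast 2 n, ← Real.rpow_mul two_pos.le,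
      mul_comm (n : ℝ) H, Real.rpow_mul two_pos.le, Real.rpow_natCast, Real.rpow_neg two_pos.le,
      ← pow_mul, mul_comm p n, pow_mul, ← mul_pow, ← mul_pow]
    congr 1
    rw [div_pow, inv_pow]
    field_simp
  have hfin : ∫⁻ ω, ∑' n, ∑ k ∈ Finset.range (2 ^ n), X n k ω ∂P ≠ ∞ := by
    rw [lintegral_tsum fun n => (Finset.measurable_fun_sum _ (Xm n)).aemeasurable]
    have e : ∀ n, ∫⁻ ω, ∑ k ∈ Finset.range (2 ^ n), X n k ω ∂P =
        ENNReal.ofReal ((T ^ H) ^ p * (2 * ((2 : ℝ) ^ (-H) / r) ^ p) ^ n) * c := fun n => by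
      rw [lintegral_finsetSum _ (Xm n), Finset.sum_congr rfl (hterm n), Finset.sum_const,
        Finset.card_range, nsmul_eq_mul, ← mul_assoc, mul_pow 2, mul_left_comm,
        ENNReal.ofReal_mul (p := 2 ^ n) (by positivity)]
      congr 2
      rw [ENNReal.ofReal_pow two_pos.le]
      norm_num
    simp_rw [e]
    rw [ENNReal.tsum_mul_right]
    refine ENNReal.mul_ne_top ?_ (lintegral_abs_pow_gaussianReal_lt_top p).ne
    refine Summable.tsum_ofReal_ne_top ?_
    exact (summable_geometric_of_lt_one (by positivity) (by linarith)).mul_left _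
  have hae := ae_lt_top' (AEMeasurable.tsum fun n =>
    (Finset.measurable_fun_sum _ (Xm n)).aemeasurable) hfin
  filter_upwards [hae, hB.continuous_paths] with ω hω hcont
  set M := (∑' n, ∑ k ∈ Finset.range (2 ^ n), X n k ω).toReal with hM
  -- The maximum with `1` avoids a `p`-th root: a normalized increment is at most `1`, or it is at
  -- most its own `p`-th power and hence at most `M`.
  refine exists_modulus_of_dyadic (C := max 1 M) hT hcont hr0 hr1 (by positivity) fun n k hk => ?_
  set x := |B (T * (k + 1) / 2 ^ n) ω - B (T * k / 2 ^ n) ω| with hx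
  have hle : ENNReal.ofReal (((r ^ n)⁻¹ * x) ^ p) ≤
      ∑' n, ∑ k ∈ Finset.range (2 ^ n), X n k ω := by
    refine le_trans ?_ (ENNReal.le_tsum n)
    refine le_trans (le_of_eq ?_) (Finset.single_le_sum (f := fun k => X n k ω)
      (fun _ _ => zero_le) (Finset.mem_range.2 hk))
    rw [mul_pow, ENNReal.ofReal_mul (by positivity)]
  have hle' : ((r ^ n)⁻¹ * x) ^ p ≤ M := by
    have := ENNReal.toReal_mono hω.ne hle
    rwa [ENNReal.toReal_ofReal (by positivity)] at this
  have hx' : (r ^ n)⁻¹ * x ≤ max 1 M := by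
    rcases le_total ((r ^ n)⁻¹ * x) 1 with h1 | h1
    · exact h1.trans (le_max_left _ _)
    · exact ((le_self_pow₀ h1 hp0).trans hle').trans (le_max_right _ _)
  rwa [inv_mul_le_iff₀ (by positivity), mul_comm] at hx'

end Modulus

/-! ### Forward integrals of derivatives of convex functions -/

section Convex

variable {f x : ℝ → ℝ} {a b : ℝ}

/-- The left derivative is a subgradient: it lies between the slopes to the left and to the right.
-/
theorem leftDeriv_mul_sub_le (hf : ConvexOn ℝ (Ioi 0) f) {x y : ℝ} (hx : 0 < x) (hy : 0 < y) :
    leftDeriv f x * (y - x) ≤ f y - f x := by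
  have hxi : x ∈ interior (Ioi (0 : ℝ)) := by rwa [interior_Ioi]
  rcases lt_trichotomy x y with h | rfl | h
  · have h1 := (hf.leftDeriv_le_rightDeriv_of_mem_interior hxi).trans
      (hf.rightDeriv_le_slope_of_mem_interior hxi (mem_Ioi.2 hy) h)
    rw [slope_def_field, le_div_iff₀ (sub_pos.2 h)] at h1
    exact h1
  · simp
  · have h1 := hf.slope_le_leftDeriv_of_mem_interior (mem_Ioi.2 hy) hxi h
    rw [slope_def_field, div_le_iff₀ (sub_pos.2 h)] at h1
    unfold leftDeriv
    linarith

theorem monotoneOn_leftDeriv (hf : ConvexOn ℝ (Ioi 0) f) : MonotoneOn (leftDeriv f) (Ioi 0) := by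
  have := hf.monotoneOn_leftDeriv
  rwa [interior_Ioi] at this

theorem leftDeriv_sub_mul_sub_nonneg (hf : ConvexOn ℝ (Ioi 0) f) {x y : ℝ} (hx : 0 < x)
    (hy : 0 < y) : 0 ≤ (leftDeriv f y - leftDeriv f x) * (y - x) := by
  linarith [leftDeriv_mul_sub_le hf hx hy, leftDeriv_mul_sub_le hf hy hx]

theorem leftDeriv_neg (f : ℝ → ℝ) (x : ℝ) : leftDeriv (-f) x = -leftDeriv f x := by
  unfold leftDeriv
  rw [derivWithin.neg]

/-- The error in the forward sums for `∫ f'(x) dx` is controlled by the sums of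
`Δ f'(x) * Δ x`. -/
theorem hasForwardIntegral_leftDeriv (hf : ConvexOn ℝ (Ioi 0) f) (hx : ∀ u ∈ Icc a b, 0 < x u)
    (h : ∀ ε > 0, ∃ δ > 0, ∀ (n : ℕ) (s : ℕ → ℝ), Monotone s → s 0 = a → s n = b →
      (∀ j < n, s (j + 1) - s j < δ) →
      ∑ j ∈ Finset.range n, (leftDeriv f (x (s (j + 1))) - leftDeriv f (x (s j))) *
        (x (s (j + 1)) - x (s j)) < ε) :
    HasForwardIntegral (fun u => leftDeriv f (x u)) x a b (f (x b) - f (x a)) := by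
  intro ε hε
  obtain ⟨δ, hδ, hs⟩ := h ε hε
  refine ⟨δ, hδ, fun n s hm h0 hn hmesh => ?_⟩
  have key := hs n s hm h0 hn hmesh
  have pos : ∀ j ≤ n, 0 < x (s j) := fun j hj => hx _ (partition_mem_Icc hm h0 hn hj)
  have etel : f (x b) - f (x a) = ∑ j ∈ Finset.range n, (f (x (s (j + 1))) - f (x (s j))) := by
    rw [Finset.sum_range_sub (fun j => f (x (s j))), h0, hn]
  -- The subgradient inequality at the left end makes each error nonnegative; the one at the right
  -- end bounds it by `Δf'(x) Δx`.
  rw [etel, abs_sub_comm, ← Finset.sum_sub_distrib, abs_of_nonneg]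
  · refine lt_of_le_of_lt (Finset.sum_le_sum fun j hj => ?_) key
    have hj := Finset.mem_range.1 hj
    linarith [leftDeriv_mul_sub_le hf (pos _ (Nat.succ_le_of_lt hj)) (pos j hj.le)]
  · refine Finset.sum_nonneg fun j hj => ?_
    have hj := Finset.mem_range.1 hj
    linarith [leftDeriv_mul_sub_le hf (pos j hj.le) (pos _ (Nat.succ_le_of_lt hj))]

/-- Along a monotone path the increments of `f'(x)` have one sign and telescope, while those of `x`
are uniformly small. The sign `c` treats increasing and decreasing paths together. -/
theorem hasForwardIntegral_leftDeriv_of_monotone (hf : ConvexOn ℝ (Ioi 0) f)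
    (hx : ∀ u ∈ Icc a b, 0 < x u) (hab : a ≤ b) (hc : ContinuousOn x (Icc a b)) {c : ℝ}
    (hc1 : c = 1 ∨ c = -1) (hmono : ∀ u ∈ Icc a b, ∀ v ∈ Icc a b, u ≤ v → 0 ≤ c * (x v - x u)) :
    HasForwardIntegral (fun u => leftDeriv f (x u)) x a b (f (x b) - f (x a)) := by
  refine hasForwardIntegral_leftDeriv hf hx fun ε hε => ?_
  set D := c * (leftDeriv f (x b) - leftDeriv f (x a)) with hD
  have hmono' : ∀ u ∈ Icc a b, ∀ v ∈ Icc a b, u ≤ v →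
      0 ≤ c * (leftDeriv f (x v) - leftDeriv f (x u)) := by
    intro u hu v hv huv
    have h := hmono u hu v hv huv
    rcases hc1 with rfl | rfl
    · have := monotoneOn_leftDeriv hf (hx u hu) (hx v hv) (by linarith)
      linarith
    · have := monotoneOn_leftDeriv hf (hx v hv) (hx u hu) (by linarith)
      linarith
  have hD0 : 0 ≤ D := hmono' a ⟨le_rfl, hab⟩ b ⟨hab, le_rfl⟩ hab
  have huc : UniformContinuousOn x (Icc a b) := isCompact_Icc.uniformContinuousOn_of_continuous hc
  obtain ⟨δ, hδ, hu⟩ := Metric.uniformContinuousOn_iff.1 huc (ε / (D + 1)) (by positivity)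
  refine ⟨δ, hδ, fun n s hm h0 hn hmesh => ?_⟩
  have hc2 : c * c = 1 := by rcases hc1 with rfl | rfl <;> norm_num
  calc ∑ j ∈ Finset.range n, (leftDeriv f (x (s (j + 1))) - leftDeriv f (x (s j))) *
        (x (s (j + 1)) - x (s j))
      ≤ ∑ j ∈ Finset.range n,
          (c * (leftDeriv f (x (s (j + 1))) - leftDeriv f (x (s j)))) * (ε / (D + 1)) := by
        refine Finset.sum_le_sum fun j hj => ?_
        have hj := Finset.mem_range.1 hj
        have m1 := partition_mem_Icc hm h0 hn hj.le
        have m2 := partition_mem_Icc hm h0 hn (Nat.succ_le_of_lt hj)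
        have hle : s j ≤ s (j + 1) := hm (Nat.le_succ j)
        have h1 := hmono _ m1 _ m2 hle
        have h2 := hmono' _ m1 _ m2 hle
        have h3 := hu _ m2 _ m1 (by
          rw [Real.dist_eq, abs_of_nonneg (sub_nonneg.2 hle)]
          exact hmesh j hj)
        have h4 : c * (x (s (j + 1)) - x (s j)) ≤ ε / (D + 1) := by
          rw [Real.dist_eq, abs_lt] at h3
          rcases hc1 with rfl | rfl <;> linarith
        calc _ = (c * c) * ((leftDeriv f (x (s (j + 1))) - leftDeriv f (x (s j))) *
              (x (s (j + 1)) - x (s j))) := by rw [hc2, one_mul]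
          _ = (c * (leftDeriv f (x (s (j + 1))) - leftDeriv f (x (s j)))) *
              (c * (x (s (j + 1)) - x (s j))) := by ring
          _ ≤ _ := mul_le_mul_of_nonneg_left h4 h2
    _ = D * (ε / (D + 1)) := by
        rw [← Finset.sum_mul, ← Finset.mul_sum,
          Finset.sum_range_sub (fun j => leftDeriv f (x (s j))), h0, hn]
    _ < ε := by
        rw [mul_div_assoc', div_lt_iff₀ (by positivity)]
        nlinarith

theorem sum_lintegral_Ioc (w : ℝ → ℝ≥0∞) {s : ℕ → ℝ} (hs : Monotone s) (n : ℕ) :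
    ∑ j ∈ Finset.range n, ∫⁻ u in Ioc (s j) (s (j + 1)), w u = ∫⁻ u in Ioc (s 0) (s n), w u := by
  induction n with
  | zero => simp
  | succ n ih =>
    rw [Finset.sum_range_succ, ih, ← lintegral_union measurableSet_Ioc,
      Ioc_union_Ioc_eq_Ioc (hs (Nat.zero_le n)) (hs (Nat.le_succ n))]
    exact disjoint_left.2 fun u hu hu' => not_lt.2 hu.2 hu'.1

theorem abs_exp_sub_exp_le {p q M : ℝ} (hp : |p| ≤ M) (hq : |q| ≤ M) :
    |Real.exp p - Real.exp q| ≤ Real.exp M * |p - q| := by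
  have key : ∀ p q : ℝ, |p| ≤ M → Real.exp p - Real.exp q ≤ Real.exp M * |p - q| := by
    intro p q hp
    have h1 := Real.add_one_le_exp (q - p)
    have h2 : Real.exp q = Real.exp p * Real.exp (q - p) := by rw [← Real.exp_add]; ring_nf
    have h3 : Real.exp p ≤ Real.exp M := Real.exp_le_exp.2 ((le_abs_self p).trans hp)
    calc Real.exp p - Real.exp q ≤ Real.exp p * (p - q) := by
          rw [h2]; nlinarith [Real.exp_pos p]
      _ ≤ Real.exp p * |p - q| := mul_le_mul_of_nonneg_left (le_abs_self _) (Real.exp_pos p).le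
      _ ≤ _ := mul_le_mul_of_nonneg_right h3 (abs_nonneg _)
  rw [abs_sub_le_iff]
  exact ⟨key p q hp, by rw [abs_sub_comm]; exact key q p hq⟩

theorem monotone_leftDeriv_exp (hf : ConvexOn ℝ (Ioi 0) f) :
    Monotone fun y => leftDeriv f (Real.exp y) := fun _ _ h =>
  monotoneOn_leftDeriv hf (Real.exp_pos _) (Real.exp_pos _) (Real.exp_le_exp.2 h)

/-- The forward integral `∫ f'(x) dx` of a path `x = exp z` exists if the oscillations of `f'`
along the path are summable over the dyadic scales. -/
theorem hasForwardIntegral_leftDeriv_exp (hf : ConvexOn ℝ (Ioi 0) f) {z : ℝ → ℝ} {T M : ℝ}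
    (hT : 0 < T) {h : ℕ → ℝ} (hz : ∀ n : ℕ, ∀ u ∈ Icc 0 T, ∀ v ∈ Icc 0 T, |u - v| ≤ T / 2 ^ n →
      |z u - z v| ≤ h n) (hM : ∀ u ∈ Icc 0 T, |z u| ≤ M)
    (hsum : ∑' n : ℕ, ENNReal.ofReal (h n * 2 ^ n) * ∫⁻ u in Ioc 0 T, ENNReal.ofReal
      (leftDeriv f (Real.exp (z u + h n)) - leftDeriv f (Real.exp (z u - h n))) ≠ ∞)
    {t : ℝ} (ht : t ∈ Icc 0 T) :
    HasForwardIntegral (fun u => leftDeriv f (Real.exp (z u))) (fun u => Real.exp (z u)) 0 t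
      (f (Real.exp (z t)) - f (Real.exp (z 0))) := by
  refine hasForwardIntegral_leftDeriv hf (x := fun u => Real.exp (z u))
    (fun u _ => Real.exp_pos _) fun ε hε => ?_
  set g : ℝ → ℝ := fun y => leftDeriv f (Real.exp y) with hg
  have gm : Monotone g := monotone_leftDeriv_exp hf
  set w : ℕ → ℝ → ℝ≥0∞ := fun n u => ENNReal.ofReal (g (z u + h n) - g (z u - h n)) with hw
  -- `exp M` is the Lipschitz constant of `exp` on the range of `z`; `2 / T` comes from the length
  -- of an interval of scale `p` exceeding `T / 2^(p+1)`.
  set C : ℝ≥0∞ := ENNReal.ofReal (2 * Real.exp M / T) with hC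
  have htail := ENNReal.Tendsto.const_mul (a := C) (ENNReal.tendsto_sum_nat_add _ hsum)
    (Or.inr ENNReal.ofReal_ne_top)
  rw [mul_zero] at htail
  obtain ⟨m, hm⟩ := ((tendsto_order.1 htail).2 (ENNReal.ofReal ε) (ENNReal.ofReal_pos.2 hε)).exists
  refine ⟨T / 2 ^ m, by positivity, fun n s hs h0 hn hmesh => ?_⟩
  have hh : ∀ n, 0 ≤ h n := fun n => (abs_nonneg _).trans
    (hz n 0 ⟨le_rfl, hT.le⟩ 0 ⟨le_rfl, hT.le⟩ (by simpa using by positivity))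
  have hmem : ∀ j ≤ n, s j ∈ Icc 0 T := fun j hj => by
    have := partition_mem_Icc hs h0 hn hj
    exact ⟨this.1, this.2.trans ht.2⟩
  have hpos : ∀ j, 0 ≤ (g (z (s (j + 1))) - g (z (s j))) *
      (Real.exp (z (s (j + 1))) - Real.exp (z (s j))) := fun j =>
    leftDeriv_sub_mul_sub_nonneg hf (Real.exp_pos _) (Real.exp_pos _)
  have hstep : ∀ j < n, ENNReal.ofReal ((g (z (s (j + 1))) - g (z (s j))) *
      (Real.exp (z (s (j + 1))) - Real.exp (z (s j)))) ≤
      C * ∑' k, ENNReal.ofReal (h (k + m) * 2 ^ (k + m)) *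
        ∫⁻ u in Ioc (s j) (s (j + 1)), w (k + m) u := by
    intro j hj
    have m1 := hmem j hj.le
    have m2 := hmem (j + 1) (Nat.succ_le_of_lt hj)
    rcases (hs (Nat.le_succ j)).eq_or_lt with he | hlt
    · rw [Nat.succ_eq_add_one] at he
      simp [← he]
    rw [Nat.succ_eq_add_one] at hlt
    set l := s (j + 1) - s j with hl
    have l0 : 0 < l := sub_pos.2 hlt
    -- `p` is the dyadic scale of this interval, `T / 2^(p+1) < l ≤ T / 2^p`. A mesh below `T / 2^m`
    -- forces `p ≥ m`, so only the tail of the convergent series is used.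
    obtain ⟨p, hp1, hp2⟩ := exists_nat_pow_near_of_lt_one (x := l / T) (y := (1 / 2 : ℝ))
      (by positivity) ((div_le_one hT).2 (by linarith [m1.1, m2.2])) (by norm_num) (by norm_num)
    rw [div_pow, one_pow, lt_div_iff₀ hT, one_div_mul_eq_div] at hp1
    rw [div_pow, one_pow, div_le_iff₀ hT, one_div_mul_eq_div] at hp2
    have hmp : m ≤ p := by
      by_contra hcon
      have h1 : (2 : ℝ) ^ (p + 1) ≤ 2 ^ m := pow_le_pow_right₀ one_le_two (by omega)
      have h2 : T / 2 ^ m ≤ T / 2 ^ (p + 1) := by gcongr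
      linarith [hmesh j hj]
    obtain ⟨k, rfl⟩ := Nat.exists_eq_add_of_le' hmp
    set E := (g (z (s (j + 1))) - g (z (s j))) *
      (Real.exp (z (s (j + 1))) - Real.exp (z (s j))) with hE
    -- The bound holds at every `u` of the interval, since both end values of `z` lie within `h p`
    -- of `z u`. Averaging it over `u` replaces the partition-dependent increment by an integral
    -- along the path.
    have hEle : ∀ u ∈ Ioc (s j) (s (j + 1)), ENNReal.ofReal E ≤
        ENNReal.ofReal (Real.exp M * h (k + m)) * w (k + m) u := by
      intro u hu
      have mu : u ∈ Icc 0 T := ⟨m1.1.trans hu.1.le, hu.2.trans m2.2⟩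
      have d1 := abs_le.1 (hz (k + m) _ m1 u mu (by
        rw [abs_sub_comm, abs_of_nonneg (by linarith [hu.1])]; linarith [hu.2]))
      have d2 := abs_le.1 (hz (k + m) _ m2 u mu (by
        rw [abs_of_nonneg (by linarith [hu.2])]; linarith [hu.1]))
      have d3 := hz (k + m) _ m2 _ m1 (by rw [abs_of_nonneg l0.le]; exact hp2)
      have e1 := abs_exp_sub_exp_le (hM _ m2) (hM _ m1)
      have g1 := gm (show z u - h (k + m) ≤ z (s j) by linarith)
      have g2 := gm (show z (s j) ≤ z u + h (k + m) by linarith)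
      have g3 := gm (show z u - h (k + m) ≤ z (s (j + 1)) by linarith)
      have g4 := gm (show z (s (j + 1)) ≤ z u + h (k + m) by linarith)
      rw [hw, ← ENNReal.ofReal_mul (mul_nonneg (Real.exp_pos M).le (hh _))]
      refine ENNReal.ofReal_le_ofReal ?_
      calc E ≤ |E| := le_abs_self E
        _ = |g (z (s (j + 1))) - g (z (s j))| * |Real.exp (z (s (j + 1))) - Real.exp (z (s j))| :=
            abs_mul _ _
        _ ≤ (g (z u + h (k + m)) - g (z u - h (k + m))) * (Real.exp M * h (k + m)) := by
            refine mul_le_mul ?_ ?_ (abs_nonneg _) (by linarith)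
            · rw [abs_sub_le_iff]
              constructor <;> linarith
            · exact e1.trans (mul_le_mul_of_nonneg_left d3 (Real.exp_pos M).le)
        _ = _ := mul_comm _ _
    have hint : ENNReal.ofReal E * ENNReal.ofReal l ≤
        ENNReal.ofReal (Real.exp M * h (k + m)) * ∫⁻ u in Ioc (s j) (s (j + 1)), w (k + m) u := by
      rw [← lintegral_const_mul' _ _ ENNReal.ofReal_ne_top, hl, ← Real.volume_Ioc,
        ← setLIntegral_const]
      exact setLIntegral_mono' measurableSet_Ioc hEle
    calc ENNReal.ofReal E = ENNReal.ofReal E * ENNReal.ofReal l * ENNReal.ofReal l⁻¹ := by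
          rw [mul_assoc, ← ENNReal.ofReal_mul l0.le, mul_inv_cancel₀ l0.ne', ENNReal.ofReal_one,
            mul_one]
      _ ≤ (ENNReal.ofReal (Real.exp M * h (k + m)) *
            ∫⁻ u in Ioc (s j) (s (j + 1)), w (k + m) u) * ENNReal.ofReal (2 ^ (k + m + 1) / T) := by
          refine mul_le_mul' hint (ENNReal.ofReal_le_ofReal ?_)
          rw [inv_le_comm₀ l0 (by positivity), inv_div]
          exact hp1.le
      _ = C * (ENNReal.ofReal (h (k + m) * 2 ^ (k + m)) *
            ∫⁻ u in Ioc (s j) (s (j + 1)), w (k + m) u) := by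
          rw [mul_right_comm, ← mul_assoc, hC, ← ENNReal.ofReal_mul
            (mul_nonneg (Real.exp_pos M).le (hh _)), ← ENNReal.ofReal_mul (by positivity)]
          congr 2
          rw [pow_succ]
          ring
      _ ≤ _ := mul_le_mul_right (ENNReal.le_tsum (f := fun k =>
          ENNReal.ofReal (h (k + m) * 2 ^ (k + m)) *
            ∫⁻ u in Ioc (s j) (s (j + 1)), w (k + m) u) k) C
  -- The partition intervals are disjoint, so for each scale their integrals add up to at most the
  -- integral over `(0,T]`.
  rw [← ENNReal.ofReal_lt_ofReal_iff hε, ENNReal.ofReal_sum_of_nonneg fun j _ => hpos j]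
  refine lt_of_le_of_lt ?_ hm
  refine (Finset.sum_le_sum fun j hj => hstep j (Finset.mem_range.1 hj)).trans ?_
  rw [← Finset.mul_sum, ← Summable.tsum_finsetSum fun _ _ => ENNReal.summable]
  refine mul_le_mul_right (ENNReal.tsum_le_tsum fun k => ?_) C
  rw [← Finset.mul_sum, sum_lintegral_Ioc _ hs, h0, hn]
  exact mul_le_mul_right (lintegral_mono_set (Ioc_subset_Ioc_right ht.2)) _

/-- The two shifted integrals cancel except on end pieces of length `2h`. The average oscillation
over windows of width of order `h` is thus `O(h)` even if `g` has jumps. -/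
theorem lintegral_monotone_shift_sub_le {g : ℝ → ℝ} (hg : Monotone g) {m h : ℝ} (hh : 0 ≤ h)
    (hhm : h ≤ m) :
    ∫⁻ z in Icc (-m) m, ENNReal.ofReal (g (z + h) - g (z - h)) ≤
      ENNReal.ofReal (2 * h * (g (2 * m) - g (-(2 * m)))) := by
  have hi : ∀ a b, IntervalIntegrable g volume a b := fun a b => hg.intervalIntegrable
  have i1 : IntervalIntegrable (fun z => g (z + h)) volume (-m) m :=
    Monotone.intervalIntegrable fun _ _ hxy => hg (by linarith)
  have i2 : IntervalIntegrable (fun z => g (z - h)) volume (-m) m :=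
    Monotone.intervalIntegrable fun _ _ hxy => hg (by linarith)
  have hm : -m ≤ m := by linarith
  rw [setLIntegral_congr Ioc_ae_eq_Icc.symm, ← ofReal_integral_eq_lintegral_ofReal
    ((intervalIntegrable_iff_integrableOn_Ioc_of_le hm).1 (i1.sub i2))
    (ae_of_all _ fun z => sub_nonneg.2 (hg (by linarith))),
    ← intervalIntegral.integral_of_le hm, intervalIntegral.integral_sub i1 i2,
    intervalIntegral.integral_comp_add_right, intervalIntegral.integral_comp_sub_right]
  refine ENNReal.ofReal_le_ofReal ?_
  rw [intervalIntegral.integral_interval_sub_interval_comm' (hi _ _) (hi _ _) (hi _ _)]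
  have u1 : ∫ z in (m - h)..(m + h), g z ≤ ∫ _ in (m - h)..(m + h), g (2 * m) :=
    intervalIntegral.integral_mono_on (by linarith) (hi _ _) intervalIntegrable_const
      fun z hz => hg (by linarith [hz.2])
  have u2 : ∫ _ in (-m - h)..(-m + h), g (-(2 * m)) ≤ ∫ z in (-m - h)..(-m + h), g z :=
    intervalIntegral.integral_mono_on (by linarith) intervalIntegrable_const (hi _ _)
      fun z hz => hg (by linarith [hz.1])
  rw [intervalIntegral.integral_const, smul_eq_mul] at u1 u2
  linarith

end Convex

/-! ### Oscillations of monotone functions along the fractional Brownian motion -/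

section Oscillation

variable {Ω : Type*} [MeasurableSpace Ω] {P : Measure Ω} {H T : ℝ} {B : ℝ → Ω → ℝ}

/-- If the laws of the jointly measurable process `Z` have densities that are integrable in time,
the oscillations of a monotone function along the paths of `Z` are summable over the dyadic
scales. -/
theorem ae_tsum_oscillation_ne_top [IsProbabilityMeasure P] {Z : ℝ → Ω → ℝ}
    (hZ : Measurable (Function.uncurry Z)) {κ : ℝ → ℝ≥0∞}
    (hκ : ∫⁻ u in Ioc 0 T, κ u ≠ ∞)
    (hlaw : ∀ u ∈ Ioc 0 T, ∀ φ : ℝ → ℝ≥0∞, Measurable φ →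
      ∫⁻ ω, φ (Z u ω) ∂P ≤ κ u * ∫⁻ y, φ y)
    {g : ℝ → ℝ} (hg : Monotone g) {r : ℝ} (hr0 : 0 < r) (hr : 2 * r ^ 2 < 1) (m : ℕ) :
    ∀ᵐ ω ∂P, ∑' n : ℕ, ENNReal.ofReal (m * r ^ n * 2 ^ n) * ∫⁻ u in Ioc 0 T,
      (Icc (-(m : ℝ)) m).indicator
        (fun y => ENNReal.ofReal (g (y + m * r ^ n) - g (y - m * r ^ n))) (Z u ω) ≠ ∞ := by
  have hgm : Measurable g := hg.measurable
  have hr1 : r ≤ 1 := by nlinarith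
  set φ : ℕ → ℝ → ℝ≥0∞ := fun n => (Icc (-(m : ℝ)) m).indicator
    (fun y => ENNReal.ofReal (g (y + m * r ^ n) - g (y - m * r ^ n))) with hφ
  have φm : ∀ n, Measurable (φ n) := fun n =>
    Measurable.indicator (by fun_prop) measurableSet_Icc
  have jm : ∀ n, Measurable (Function.uncurry fun (ω : Ω) (u : ℝ) => φ n (Z u ω)) := fun n =>
    (φm n).comp (hZ.comp measurable_swap)
  have im : ∀ n, Measurable fun ω => ∫⁻ u in Ioc 0 T, φ n (Z u ω) := fun n =>
    (jm n).lintegral_prod_right'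
  have hfin : ∫⁻ ω, ∑' n : ℕ, ENNReal.ofReal (m * r ^ n * 2 ^ n) *
      (∫⁻ u in Ioc 0 T, φ n (Z u ω)) ∂P ≠ ∞ := by
    rw [lintegral_tsum fun n => ((im n).const_mul _).aemeasurable]
    set G := g (2 * m) - g (-(2 * m)) with hG
    have hG0 : 0 ≤ G := sub_nonneg.2 (hg (by linarith [(Nat.cast_nonneg m : (0 : ℝ) ≤ m)]))
    -- The weight contributes `r ^ n * 2 ^ n` and the mean oscillation another `r ^ n`. The cut-off
    -- to `[-m, m]` keeps the total rise `G` of `g` finite.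
    have hb : ∀ n : ℕ, ∫⁻ ω, ENNReal.ofReal (m * r ^ n * 2 ^ n) *
        (∫⁻ u in Ioc 0 T, φ n (Z u ω)) ∂P ≤
        (∫⁻ u in Ioc 0 T, κ u) * ENNReal.ofReal (2 * m * m * G * (2 * r ^ 2) ^ n) := by
      intro n
      have hle : (m : ℝ) * r ^ n ≤ m :=
        mul_le_of_le_one_right (Nat.cast_nonneg m) (pow_le_one₀ hr0.le hr1)
      rw [lintegral_const_mul _ (im n), lintegral_lintegral_swap (jm n).aemeasurable]
      have h1 : ∫⁻ u in Ioc 0 T, ∫⁻ ω, φ n (Z u ω) ∂P ≤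
          ∫⁻ u in Ioc 0 T, κ u * ENNReal.ofReal (2 * (m * r ^ n) * G) := by
        refine setLIntegral_mono' measurableSet_Ioc fun u hu => (hlaw u hu _ (φm n)).trans ?_
        refine mul_le_mul_right ?_ _
        rw [hφ]
        simp only
        rw [lintegral_indicator measurableSet_Icc]
        exact lintegral_monotone_shift_sub_le hg (by positivity) hle
      refine (mul_le_mul_right h1 _).trans (le_of_eq ?_)
      rw [lintegral_mul_const' _ _ ENNReal.ofReal_ne_top, mul_left_comm,
        ← ENNReal.ofReal_mul (by positivity)]
      congr 2
      rw [mul_pow, ← pow_mul, mul_comm 2 n, pow_mul]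
      ring
    refine ne_top_of_le_ne_top ?_ (ENNReal.tsum_le_tsum hb)
    rw [ENNReal.tsum_mul_left]
    refine ENNReal.mul_ne_top hκ (Summable.tsum_ofReal_ne_top ?_)
    exact (summable_geometric_of_lt_one (by positivity) hr).mul_left _
  exact (ae_lt_top' (AEMeasurable.tsum fun n => ((im n).const_mul _).aemeasurable) hfin).mono
    fun ω hω => hω.ne

theorem lintegral_gaussianReal_le (μ : ℝ) {v : NNReal} (hv : v ≠ 0) {φ : ℝ → ℝ≥0∞}
    (hφ : Measurable φ) :
    ∫⁻ y, φ y ∂(gaussianReal μ v) ≤ ENNReal.ofReal (Real.sqrt v)⁻¹ * ∫⁻ y, φ y := by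
  rw [gaussianReal_of_var_ne_zero _ hv,
    lintegral_withDensity_eq_lintegral_mul _ (measurable_gaussianPDF _ _) hφ,
    ← lintegral_const_mul _ hφ]
  refine lintegral_mono fun y => mul_le_mul_left (ENNReal.ofReal_le_ofReal ?_) _
  have hv0 : (0 : ℝ) < v := by positivity
  unfold gaussianPDFReal
  calc (Real.sqrt (2 * Real.pi * v))⁻¹ * Real.exp (-(y - μ) ^ 2 / (2 * v))
      ≤ (Real.sqrt v)⁻¹ * 1 := by
        refine mul_le_mul ?_ ?_ (Real.exp_pos _).le (by positivity)
        · refine inv_anti₀ (Real.sqrt_pos.2 hv0) (Real.sqrt_le_sqrt ?_)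
          nlinarith [Real.pi_gt_three]
        · rw [Real.exp_le_one_iff]
          exact div_nonpos_of_nonpos_of_nonneg (neg_nonpos.2 (sq_nonneg _)) (by positivity)
    _ = _ := mul_one _

theorem IsFBM.lintegral_affine_le [IsProbabilityMeasure P] (hB : IsFBM P H T B) (hH : 1 / 2 < H)
    {σ : ℝ} (hσ : σ ≠ 0) (c : ℝ) {u : ℝ} (hu : u ∈ Ioc 0 T) {φ : ℝ → ℝ≥0∞} (hφ : Measurable φ) :
    ∫⁻ ω, φ (c + σ * B u ω) ∂P ≤ ENNReal.ofReal (|σ|⁻¹ * u ^ (-H)) * ∫⁻ y, φ y := by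
  have hu' : u ∈ Icc 0 T := ⟨hu.1.le, hu.2⟩
  have h1 : ∫⁻ ω, φ (c + σ * B u ω) ∂P = ∫⁻ y, φ y ∂(gaussianReal (σ * 0 + c)
      (NNReal.mk (σ ^ 2) (sq_nonneg σ) * (u ^ (2 * H)).toNNReal)) := by
    rw [← gaussianReal_map_const_add, ← gaussianReal_map_const_mul, lintegral_map hφ (by fun_prop),
      lintegral_map (by fun_prop) (by fun_prop), ← hB.map_eq hH hu',
      lintegral_map (by fun_prop) (hB.measurable u hu')]
  have hup : 0 < u ^ (2 * H) := Real.rpow_pos_of_pos hu.1 _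
  rw [h1]
  refine (lintegral_gaussianReal_le _ ?_ hφ).trans (le_of_eq ?_)
  · refine mul_ne_zero ?_ ?_
    · intro h
      exact pow_ne_zero 2 hσ (congrArg NNReal.toReal h)
    · exact (Real.toNNReal_pos.2 hup).ne'
  · congr 2
    rw [NNReal.coe_mul, Real.coe_toNNReal _ hup.le, NNReal.coe_mk, Real.sqrt_mul (sq_nonneg _),
      Real.sqrt_sq_eq_abs, mul_inv, Real.rpow_neg hu.1.le, mul_comm 2 H, Real.rpow_mul hu.1.le,
      Real.rpow_two, Real.sqrt_sq (Real.rpow_nonneg hu.1.le _)]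

/-- The density bound of the driving process blows up like `u^{-H}` at time zero, which is
integrable because `H < 1`. -/
theorem lintegral_rpow_neg_ne_top {H : ℝ} (hH' : H < 1) (hT : 0 ≤ T) (c : ℝ) :
    ∫⁻ u in Ioc 0 T, ENNReal.ofReal (c * u ^ (-H)) ≠ ∞ := by
  have h : IntegrableOn (fun u : ℝ => c * u ^ (-H)) (Ioc 0 T) :=
    ((intervalIntegrable_iff_integrableOn_Ioc_of_le hT).1
      (intervalIntegral.intervalIntegrable_rpow' (by linarith))).const_mul c
  exact h.lintegral_lt_top.ne

/-- A version of the fractional Brownian motion all of whose paths are continuous. -/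
theorem IsFBM.exists_continuous (hB : IsFBM P H T B) (hT : 0 ≤ T) :
    ∃ B' : ℝ → Ω → ℝ, Measurable (Function.uncurry B') ∧
      ∀ᵐ ω ∂P, ∀ u ∈ Icc 0 T, B' u ω = B u ω := by
  classical
  -- The set of discontinuous paths need not be measurable, so a measurable null set containing it
  -- is removed; clamping time to `[0,T]` makes the remaining paths continuous on the whole line.
  set N := toMeasurable P {ω | ¬ ContinuousOn (fun t => B t ω) (Icc (0 : ℝ) T)} with hN
  have hN0 : P N = 0 := by
    rw [hN, measure_toMeasurable]
    exact hB.continuous_paths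
  have hNm : MeasurableSet N := measurableSet_toMeasurable _ _
  refine ⟨fun u ω => Nᶜ.indicator (fun ω => B (projIcc 0 T hT u) ω) ω, ?_, ?_⟩
  · refine measurable_uncurry_of_continuous_of_measurable (fun ω => ?_) fun u => ?_
    · by_cases hω : ω ∈ N
      · have : ω ∉ Nᶜ := fun h => h hω
        simp only [indicator_of_notMem this]
        exact continuous_const
      · simp only [indicator_of_mem (mem_compl hω)]
        have hc : ContinuousOn (fun t => B t ω) (Icc (0 : ℝ) T) := by
          by_contra hcon
          exact hω (subset_toMeasurable _ _ hcon)
        exact (continuousOn_iff_continuous_domRestrict.1 hc).comp continuous_projIcc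
    · exact (hB.measurable _ (projIcc 0 T hT u).2).indicator hNm.compl
  · have : ∀ᵐ ω ∂P, ω ∉ N := measure_eq_zero_iff_ae_notMem.1 hN0
    filter_upwards [this] with ω hω u hu
    rw [indicator_of_mem (mem_compl hω), projIcc_of_mem hT hu]

theorem continuousOn_assetPrice {Ω : Type*} {B : ℝ → Ω → ℝ} {S₀ μ σ : ℝ} {ω : Ω}
    (h : ContinuousOn (fun t => B t ω) (Icc (0 : ℝ) T)) :
    ContinuousOn (fun t => assetPrice S₀ μ σ B t ω) (Icc (0 : ℝ) T) := by
  unfold assetPrice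
  fun_prop

/-- For `σ ≠ 0` write `S = exp Z` and apply the oscillation estimate with `2^{-H} < r < 2^{-1/2}`, a
range that is nonempty because `H > 1/2`. For `σ = 0` the law of `Z_u` has no density, but `S` is a
monotone exponential. -/
theorem IsFBM.hasForwardIntegral_convex [IsProbabilityMeasure P] (hB : IsFBM P H T B)
    (hH : 1 / 2 < H) (hH' : H < 1) (hT : 0 < T) {S₀ : ℝ} (hS₀ : 0 < S₀) (μ σ : ℝ) {f : ℝ → ℝ}
    (hf : ConvexOn ℝ (Ioi 0) f) :
    ∀ᵐ ω ∂P, ∀ s ∈ Icc 0 T, HasForwardIntegral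
      (fun u => leftDeriv f (assetPrice S₀ μ σ B u ω)) (fun u => assetPrice S₀ μ σ B u ω) 0 s
      (f (assetPrice S₀ μ σ B s ω) - f (assetPrice S₀ μ σ B 0 ω)) := by
  rcases eq_or_ne σ 0 with rfl | hσ
  · filter_upwards [hB.continuous_paths] with ω hω s hs
    have hc := (continuousOn_assetPrice (S₀ := S₀) (μ := μ) (σ := 0) hω).mono
      (Icc_subset_Icc_right hs.2)
    have hpos : ∀ u ∈ Icc 0 s, 0 < assetPrice S₀ μ 0 B u ω := fun u _ =>
      mul_pos hS₀ (Real.exp_pos _)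
    rcases le_total 0 μ with hμ | hμ
    · refine hasForwardIntegral_leftDeriv_of_monotone hf hpos hs.1 hc (Or.inl rfl)
        fun u _ v _ huv => ?_
      have : μ * u ≤ μ * v := mul_le_mul_of_nonneg_left huv hμ
      have : S₀ * Real.exp (μ * u) ≤ S₀ * Real.exp (μ * v) :=
        mul_le_mul_of_nonneg_left (Real.exp_le_exp.2 this) hS₀.le
      simpa [assetPrice] using this
    · refine hasForwardIntegral_leftDeriv_of_monotone hf hpos hs.1 hc (Or.inr rfl)
        fun u _ v _ huv => ?_
      have : μ * v ≤ μ * u := mul_le_mul_of_nonpos_left huv hμ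
      have : S₀ * Real.exp (μ * v) ≤ S₀ * Real.exp (μ * u) :=
        mul_le_mul_of_nonneg_left (Real.exp_le_exp.2 this) hS₀.le
      simpa [assetPrice] using this
  obtain ⟨r, hr, hr'⟩ := exists_between (show (2 : ℝ) ^ (-H) < 2 ^ (-(1 / 2) : ℝ) from
    Real.rpow_lt_rpow_of_exponent_lt one_lt_two (by linarith))
  have hr0 : 0 < r := lt_trans (by positivity) hr
  have hr2 : 2 * r ^ 2 < 1 := by
    have h1 : r ^ 2 < ((2 : ℝ) ^ (-(1 / 2) : ℝ)) ^ 2 := by gcongr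
    rw [← Real.rpow_natCast, ← Real.rpow_natCast, ← Real.rpow_mul two_pos.le] at h1
    norm_num [Real.rpow_neg_one] at h1
    linarith
  have hr1 : r < 1 := by nlinarith
  -- This makes the linear drift `μ u` also of order `r ^ n` at scale `2⁻ⁿ`.
  have hrhalf : 1 / 2 ≤ r := by
    have : (2 : ℝ) ^ (-1 : ℝ) ≤ 2 ^ (-H) :=
      Real.rpow_le_rpow_of_exponent_le one_le_two (by linarith)
    rw [Real.rpow_neg_one] at this
    linarith
  obtain ⟨B', hB'm, hB'⟩ := hB.exists_continuous hT.le
  set Z : ℝ → Ω → ℝ := fun u ω => (Real.log S₀ + μ * u) + σ * B' u ω with hZ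
  have hZm : Measurable (Function.uncurry Z) := by
    have : Measurable fun p : ℝ × Ω => (Real.log S₀ + μ * p.1) + σ * Function.uncurry B' p := by
      fun_prop
    exact this
  have hlaw : ∀ u ∈ Ioc 0 T, ∀ φ : ℝ → ℝ≥0∞, Measurable φ →
      ∫⁻ ω, φ (Z u ω) ∂P ≤ ENNReal.ofReal (|σ|⁻¹ * u ^ (-H)) * ∫⁻ y, φ y := by
    intro u hu φ hφ
    refine le_trans (le_of_eq (lintegral_congr_ae ?_))
      (hB.lintegral_affine_le hH hσ (Real.log S₀ + μ * u) hu hφ)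
    filter_upwards [hB'] with ω hω
    simp only [hZ, hω u ⟨hu.1.le, hu.2⟩]
  have hosc := ae_all_iff.2 (ae_tsum_oscillation_ne_top hZm
    (lintegral_rpow_neg_ne_top hH' hT.le _) hlaw
    (monotone_leftDeriv_exp hf) hr0 hr2)
  filter_upwards [hosc, hB', hB.exists_modulus hH hT hr hr1, hB.continuous_paths] with
    ω hω hBω ⟨K, hK⟩ hcont s hs
  have hZeq : ∀ u ∈ Icc 0 T, Real.exp (Z u ω) = assetPrice S₀ μ σ B u ω := fun u hu => by
    simp only [hZ, assetPrice, hBω u hu]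
    rw [add_assoc, Real.exp_add, Real.exp_log hS₀]
  have hZc : ContinuousOn (fun u => Z u ω) (Icc 0 T) := by
    refine ContinuousOn.congr (f := fun u => (Real.log S₀ + μ * u) + σ * B u ω) (by fun_prop) ?_
    intro u hu
    simp only [hZ, hBω u hu]
  obtain ⟨M, hM⟩ := isCompact_Icc.exists_bound_of_continuousOn hZc
  simp only [Real.norm_eq_abs] at hM
  -- `m` dominates both the bound of the path, so that the cut-off is inactive, and the constant of
  -- the modulus. It depends on `ω`; for this reason the oscillation estimate was taken for all `m`
  -- at once.
  obtain ⟨m, hm⟩ := exists_nat_ge (max M (|μ| * T + |σ| * K))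
  have hmM := (le_max_left _ _).trans hm
  have hmK := (le_max_right _ _).trans hm
  have key := hasForwardIntegral_leftDeriv_exp hf (z := fun u => Z u ω) (T := T) (M := M)
    (h := fun n => m * r ^ n) hT ?_ hM ?_ hs
  · rw [hZeq s hs, hZeq 0 ⟨le_rfl, hT.le⟩] at key
    refine key.congr (fun u hu => ?_) (fun u hu => ?_)
    · rw [hZeq u ⟨hu.1, hu.2.trans hs.2⟩]
    · rw [hZeq u ⟨hu.1, hu.2.trans hs.2⟩]
  · intro n u hu v hv huv
    have h1 := hK n u hu v hv huv
    have h2 : T / 2 ^ n ≤ T * r ^ n := by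
      rw [div_eq_mul_inv, ← inv_pow]
      have : ((2 : ℝ)⁻¹) ^ n ≤ r ^ n := by gcongr; linarith
      gcongr
    simp only [hZ, hBω u hu, hBω v hv]
    calc |Real.log S₀ + μ * u + σ * B u ω - (Real.log S₀ + μ * v + σ * B v ω)|
        = |μ * (u - v) + σ * (B u ω - B v ω)| := by ring_nf
      _ ≤ |μ| * |u - v| + |σ| * |B u ω - B v ω| := by
          rw [← abs_mul, ← abs_mul]
          exact abs_add_le _ _
      _ ≤ |μ| * (T * r ^ n) + |σ| * (K * r ^ n) := by
          gcongr
          exact huv.trans h2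
      _ = (|μ| * T + |σ| * K) * r ^ n := by ring
      _ ≤ m * r ^ n := by gcongr
  · refine ne_of_eq_of_ne ?_ (hω m)
    refine tsum_congr fun n => ?_
    congr 1
    refine setLIntegral_congr_fun measurableSet_Ioc fun u hu => ?_
    have : Z u ω ∈ Icc (-(m : ℝ)) m := abs_le.1 ((hM u ⟨hu.1.le, hu.2⟩).trans hmM)
    rw [indicator_of_mem this]

/-- The change of variables formula `f(S_s) = f(S_0) + ∫₀ˢ f'(S_u) dS_u`. -/
theorem IsFBM.hasForwardIntegral_leftDeriv_assetPrice [IsProbabilityMeasure P] (hB : IsFBM P H T B)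
    (hH : 1 / 2 < H) (hH' : H < 1) (hT : 0 < T) {S₀ : ℝ} (hS₀ : 0 < S₀) (μ σ : ℝ) {f : ℝ → ℝ}
    (hf : ConvexOn ℝ (Ioi 0) f ∨ ConcaveOn ℝ (Ioi 0) f) :
    ∀ᵐ ω ∂P, ∀ s ∈ Icc 0 T, HasForwardIntegral
      (fun u => leftDeriv f (assetPrice S₀ μ σ B u ω)) (fun u => assetPrice S₀ μ σ B u ω) 0 s
      (f (assetPrice S₀ μ σ B s ω) - f (assetPrice S₀ μ σ B 0 ω)) := by
  rcases hf with hf | hf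
  · exact hB.hasForwardIntegral_convex hH hH' hT hS₀ μ σ hf
  · filter_upwards [hB.hasForwardIntegral_convex hH hH' hT hS₀ μ σ hf.neg] with ω hω s hs
    have h := (hω s hs).mul_left (-1)
    simp only [Pi.neg_apply] at h
    have e : -1 * (-f (assetPrice S₀ μ σ B s ω) - -f (assetPrice S₀ μ σ B 0 ω)) =
      f (assetPrice S₀ μ σ B s ω) - f (assetPrice S₀ μ σ B 0 ω) := by ring
    rw [e] at h
    refine h.congr (fun u _ => ?_) fun _ _ => rfl
    rw [leftDeriv_neg]
    ring

theorem IsFBM.frictionlessValue_eq [IsProbabilityMeasure P] (hB : IsFBM P H T B)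
    (hH : 1 / 2 < H) (hH' : H < 1) (hT : 0 < T) {S₀ : ℝ} (hS₀ : 0 < S₀) (μ σ : ℝ) {f : ℝ → ℝ}
    (hf : ConvexOn ℝ (Ioi 0) f ∨ ConcaveOn ℝ (Ioi 0) f) {s : ℝ} (hs : s ∈ Icc 0 T) :
    frictionlessValue f (assetPrice S₀ μ σ B) s =ᵐ[P] fun ω => f (assetPrice S₀ μ σ B s ω) := by
  filter_upwards [hB.hasForwardIntegral_leftDeriv_assetPrice hH hH' hT hS₀ μ σ hf] with ω hω
  unfold frictionlessValue
  rw [(hω s hs).eq hs.1]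
  ring

end Oscillation

/-! ### Conditional gains of discrete strategies -/

section Gains

/-- Pull-out property of the conditional expectation for an integrable sum `A + π X` whose
summands need not be integrable. -/
theorem condExp_add_mul {Ω : Type*} {m : MeasurableSpace Ω} [mΩ : MeasurableSpace Ω]
    {P : Measure Ω} [IsProbabilityMeasure P] (hm : m ≤ mΩ) {A π X W : Ω → ℝ} (hA : Measurable[m] A)
    (hπ : Measurable[m] π) (hX : Integrable X P) (hW : Integrable W P)
    (h : W =ᵐ[P] fun ω => A ω + π ω * X ω) :
    P[W | m] =ᵐ[P] fun ω => A ω + π ω * (P[X | m]) ω := by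
  -- On `D n` both coefficients are bounded and the usual pull-out property applies. These sets
  -- belong to `m`, so the conditional expectation localizes to them, and they exhaust `Ω`.
  set D : ℕ → Set Ω := fun n => {ω | |A ω| ≤ n} ∩ {ω | |π ω| ≤ n} with hD
  have hAabs : Measurable[m] fun ω => |A ω| := (measurable_norm (α := ℝ)).comp hA
  have hπabs : Measurable[m] fun ω => |π ω| := (measurable_norm (α := ℝ)).comp hπ
  have Dm : ∀ n, MeasurableSet[m] (D n) := fun n =>
    MeasurableSet.inter (hAabs measurableSet_Iic) (hπabs measurableSet_Iic)
  have key : ∀ n, ∀ᵐ ω ∂P, ω ∈ D n → (P[W | m]) ω = A ω + π ω * (P[X | m]) ω := by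
    intro n
    have sA : StronglyMeasurable[m] ((D n).indicator A) :=
      (Measurable.indicator hA (Dm n)).stronglyMeasurable
    have sπ : StronglyMeasurable[m] ((D n).indicator π) :=
      (Measurable.indicator hπ (Dm n)).stronglyMeasurable
    have bA : ∀ ω, ‖(D n).indicator A ω‖ ≤ n := fun ω => by
      by_cases hω : ω ∈ D n
      · rw [indicator_of_mem hω]
        exact hω.1
      · rw [indicator_of_notMem hω, norm_zero]
        exact Nat.cast_nonneg n
    have bπ : ∀ ω, ‖(D n).indicator π ω‖ ≤ n := fun ω => by
      by_cases hω : ω ∈ D n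
      · rw [indicator_of_mem hω]
        exact hω.2
      · rw [indicator_of_notMem hω, norm_zero]
        exact Nat.cast_nonneg n
    have iA : Integrable ((D n).indicator A) P :=
      Integrable.of_bound (sA.mono hm).aestronglyMeasurable n (ae_of_all _ bA)
    have iπ : Integrable ((D n).indicator π * X) P :=
      hX.bdd_mul (sπ.mono hm).aestronglyMeasurable (ae_of_all _ bπ)
    have e : (D n).indicator W =ᵐ[P] (D n).indicator A + (D n).indicator π * X := by
      filter_upwards [h] with ω hω
      by_cases hωD : ω ∈ D n
      · simp [indicator_of_mem hωD, hω]
      · simp [indicator_of_notMem hωD]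
    have c1 := condExp_indicator (m := m) hW (Dm n)
    have c2 := condExp_congr_ae (m := m) e
    have c3 := condExp_add iA iπ m
    have c4 := condExp_mul_of_stronglyMeasurable_left sπ iπ hX
    rw [condExp_of_stronglyMeasurable hm sA iA] at c3
    filter_upwards [c1, c2, c3, c4] with ω h1 h2 h3 h4 hωD
    rw [h1, h3] at h2
    simp only [Pi.add_apply, Pi.mul_apply, indicator_of_mem hωD] at h2 h4
    rw [h2, h4]
  filter_upwards [ae_all_iff.2 key] with ω hω
  obtain ⟨n, hn⟩ := exists_nat_ge (max |A ω| |π ω|)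
  exact hω n ⟨(le_max_left _ _).trans hn, (le_max_right _ _).trans hn⟩

variable {Ω : Type*} {S : ℝ → Ω → ℝ} {N : ℕ} {t : Fin (N + 1) → ℝ} {pre : Ω → ℝ} {pos : Fin N → Ω → ℝ}

theorem past_mono (S : ℝ → Ω → ℝ) {s u : ℝ} (hsu : s ≤ u) : past S s ≤ past S u :=
  iSup₂_le fun _ hv => (measurable_past (S := S) ⟨hv.1, hv.2.trans hsu⟩).comap_le

theorem measurable_trade (ht : StrictMono t) (ht0 : t 0 = 0) (hpre : Measurable[past S 0] pre)
    (hpos : ∀ j, Measurable[past S (t j.castSucc)] (pos j)) (i : Fin N) :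
    Measurable[past S (t i.castSucc)] (trade pre pos i) := by
  unfold trade
  refine Measurable.sub (hpos i) ?_
  obtain ⟨n, hn⟩ := i
  cases n with
  | zero =>
    refine hpre.mono (past_mono S ?_) le_rfl
    exact (ht0.symm.trans rfl).le
  | succ n =>
    have h := hpos ⟨n, Nat.lt_of_succ_lt hn⟩
    exact h.mono (past_mono S (ht.monotone (by simp [Fin.le_def]))) le_rfl

/-- The closed formula is measurable for every `ω`, while the wealth itself is known to equal it
only on continuous paths. Trades at or after `t i` contribute nothing. -/
theorem measurable_wealth (ht : StrictMono t) (ht0 : t 0 = 0) {v₀ : Ω → ℝ} (k : ℝ)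
    (hv₀ : Measurable[past S 0] v₀) (hpre : Measurable[past S 0] pre)
    (hpos : ∀ j, Measurable[past S (t j.castSucc)] (pos j)) (i : Fin (N + 1)) :
    Measurable[past S (t i)] fun ω =>
      v₀ ω + (∑ j : Fin N, pos j ω * (S (min (t j.succ) (t i)) ω - S (min (t j.castSucc) (t i)) ω)) -
      ∑ j : Fin N, |trade pre pos j ω| *
        (unitJump (t j.castSucc) (t i) * (k * S (t j.castSucc) ω)) := by
  have hnn : ∀ j, 0 ≤ t j := fun j => ht0 ▸ ht.monotone (Fin.zero_le j)
  refine Measurable.sub (Measurable.add (hv₀.mono (past_mono S (hnn i)) le_rfl)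
    (Finset.measurable_fun_sum _ fun j _ => ?_)) (Finset.measurable_fun_sum _ fun j _ => ?_)
  · rcases le_or_gt (t j.castSucc) (t i) with h | h
    · refine Measurable.mul ((hpos j).mono (past_mono S h) le_rfl) (Measurable.sub ?_ ?_) <;>
      exact measurable_past ⟨le_min (hnn _) (hnn _), min_le_right _ _⟩
    · have h' : t i ≤ t j.succ := h.le.trans (ht.monotone j.castSucc_le_succ)
      simp only [min_eq_right h.le, min_eq_right h', sub_self, mul_zero]
      exact measurable_const
  · rcases lt_or_ge (t j.castSucc) (t i) with h | h
    · have m1 := (measurable_trade ht ht0 hpre hpos j).mono (past_mono S h.le) le_rfl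
      refine Measurable.mul ((measurable_norm (α := ℝ)).comp m1) ?_
      exact ((measurable_past ⟨hnn _, h.le⟩).const_mul k).const_mul _
    · simp only [unitJump_of_le h, zero_mul, mul_zero]
      exact measurable_const

/-- The wealth at the end of the period is `A + π S_{t_{i+1}}` with `A` and `π` known at its start,
so only the price is affected by conditioning. Integrability is assumed for the sum alone, which is
why the truncated pull-out is needed. -/
theorem condGain_valueWithCosts [MeasurableSpace Ω] {P : Measure Ω} [IsProbabilityMeasure P]
    (ht : StrictMono t) (ht0 : t 0 = 0) {v₀ : Ω → ℝ} (k : ℝ)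
    (hv₀ : Measurable[past S 0] v₀) (hpre : Measurable[past S 0] pre)
    (hpos : ∀ j, Measurable[past S (t j.castSucc)] (pos j)) (i : Fin N)
    (hle : past S (t i.castSucc) ≤ ‹MeasurableSpace Ω›)
    (hS : ∀ᵐ ω ∂P, ContinuousOn (fun u => S u ω) (Icc 0 (t (Fin.last N))))
    (hSi : Integrable (S (t i.succ)) P)
    (hV : Integrable (valueWithCosts k S v₀ (strategyPath t pre pos) (t i.succ)) P) :
    ∀ᵐ ω ∂P, condGain P S (valueWithCosts k S v₀ (strategyPath t pre pos)) (t i.succ)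
        (t i.castSucc) ω =
      pos i ω * condGain P S S (t i.succ) (t i.castSucc) ω -
        k * S (t i.castSucc) ω * |trade pre pos i ω| := by
  have hmem : ∀ j, t j ∈ Icc 0 (t (Fin.last N)) := fun j =>
    ⟨ht0 ▸ ht.monotone (Fin.zero_le j), ht.monotone (Fin.le_last j)⟩
  set U : Ω → ℝ := fun ω => v₀ ω + (∑ j : Fin N, pos j ω *
    (S (min (t j.succ) (t i.castSucc)) ω - S (min (t j.castSucc) (t i.castSucc)) ω)) -
      ∑ j : Fin N, |trade pre pos j ω| *
        (unitJump (t j.castSucc) (t i.castSucc) * (k * S (t j.castSucc) ω)) with hU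
  have hUm : Measurable[past S (t i.castSucc)] U :=
    measurable_wealth ht ht0 k hv₀ hpre hpos i.castSucc
  have hSm : Measurable[past S (t i.castSucc)] (S (t i.castSucc)) :=
    measurable_past ⟨(hmem _).1, le_rfl⟩
  have hAm : Measurable[past S (t i.castSucc)] fun ω => U ω - pos i ω * S (t i.castSucc) ω -
      k * S (t i.castSucc) ω * |trade pre pos i ω| :=
    (hUm.sub ((hpos i).mul hSm)).sub ((hSm.const_mul k).mul
      ((measurable_norm (α := ℝ)).comp (measurable_trade ht ht0 hpre hpos i)))
  have hVU : ∀ᵐ ω ∂P, valueWithCosts k S v₀ (strategyPath t pre pos) (t i.castSucc) ω = U ω := by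
    filter_upwards [hS] with ω hω
    exact valueWithCosts_strategyPath ht ht0 (hmem _)
      (hω.mono (Icc_subset_Icc_right (hmem _).2))
  have hrep : valueWithCosts k S v₀ (strategyPath t pre pos) (t i.succ) =ᵐ[P] fun ω =>
      (U ω - pos i ω * S (t i.castSucc) ω - k * S (t i.castSucc) ω * |trade pre pos i ω|) +
        pos i ω * S (t i.succ) ω := by
    filter_upwards [hS, hVU] with ω hω hVω
    rw [valueWithCosts_succ ht ht0 i hω, hVω]
    ring
  have key := condExp_add_mul hle hAm (hpos i) hSi hV hrep
  filter_upwards [key, hVU] with ω hω hVω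
  unfold condGain
  rw [hω, hVω]
  ring

/-- Outside `(0,∞)` the function `f` is arbitrary and possibly not measurable; only its composition
with positive prices is used. -/
theorem measurable_comp_exp {f : ℝ → ℝ} (hf : ConvexOn ℝ (Ioi 0) f ∨ ConcaveOn ℝ (Ioi 0) f)
    {S₀ : ℝ} (hS₀ : 0 < S₀) : Measurable fun x => f (S₀ * Real.exp x) := by
  have hc : ContinuousOn f (Ioi 0) := by
    rcases hf with hf | hf
    · exact hf.continuousOn isOpen_Ioi
    · exact hf.continuousOn isOpen_Ioi
  exact (hc.comp_continuous (f := fun x => S₀ * Real.exp x) (by fun_prop)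
    fun x => mul_pos hS₀ (Real.exp_pos x)).measurable

end Gains

end FracBS

end

/-! ### The conditional gains -/

theorem lemma3p1 {Ω : Type*} [MeasurableSpace Ω] (P : Measure Ω) [IsProbabilityMeasure P]
    (H T : ℝ) (hH : 1 / 2 < H) (hH' : H < 1) (hT : 0 < T)
    (B : ℝ → Ω → ℝ) (hB : FracBS.IsFBM P H T B)
    (S₀ μ σ k : ℝ) (hS₀ : 0 < S₀) (hk : 0 ≤ k) (hk' : k < 1)
    (S : ℝ → Ω → ℝ) (hS : S = FracBS.assetPrice S₀ μ σ B)
    (f : ℝ → ℝ) (hf : ConvexOn ℝ (Ioi 0) f ∨ ConcaveOn ℝ (Ioi 0) f)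
    -- trading times
    (N : ℕ) (t : Fin (N + 1) → ℝ) (ht : StrictMono t) (ht0 : t 0 = 0) (htN : t (Fin.last N) = T)
    -- initial wealth and discrete trading strategy
    (v₀ : Ω → ℝ) (hv₀ : Measurable[FracBS.past S 0] v₀)
    (pre : Ω → ℝ) (hpre : Measurable[FracBS.past S 0] pre)
    (pos : Fin N → Ω → ℝ) (hpos : ∀ j, Measurable[FracBS.past S (t j.castSucc)] (pos j))
    (y : ℝ → Ω → ℝ) (hy : y = FracBS.strategyPath t pre pos)
    -- the value processes without and with transaction costs
    (V Vk : ℝ → Ω → ℝ) (hV : V = FracBS.frictionlessValue f S)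
    (hVk : Vk = FracBS.valueWithCosts k S v₀ y)
    -- the trading period `[a, b] = [t_i, t_{i+1}]`
    (i : Fin N) (a b : ℝ) (ha : a = t i.castSucc) (hb : b = t i.succ)
    -- the factor `exp(μ Δt + σ ΔB̂ + σ √r̂ z)`
    (G : Ω → ℝ → ℝ)
    (hG : G = fun ω z => Real.exp (μ * (b - a) + σ * (FracBS.condMean P B H b a ω - B a ω) +
      σ * Real.sqrt (FracBS.condVar H b a) * z)) :
    -- all the integrals involved exist
    (∃ I, FracBS.IsWienerIntegral P B H a (fun s => FracBS.predKernel H b a s) I) ∧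
    (∀ s ∈ Icc (0 : ℝ) T, ∀ᵐ ω ∂P,
      (∃ I, FracBS.HasForwardIntegral (fun u => FracBS.leftDeriv f (S u ω)) (fun u => S u ω)
        0 s I) ∧
      (∃ I, FracBS.HasForwardIntegral (fun u => y u ω) (fun u => S u ω) 0 s I) ∧
      (∃ I, FracBS.HasForwardIntegral (fun u => k * S u ω)
        (FracBS.totalVariation fun u => y u ω) 0 s I)) ∧
    -- the conditional gain of the asset
    (Integrable (S b) P ∧ ∀ᵐ ω ∂P,
      Integrable (fun z => G ω z * FracBS.stdNormalPDF z) ∧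
      FracBS.condGain P S S b a ω = S a ω * ((∫ z, G ω z * FracBS.stdNormalPDF z) - 1)) ∧
    -- the conditional gain of the frictionless value
    (Integrable (fun ω => f (S b ω)) P → Integrable (V b) P ∧ ∀ᵐ ω ∂P,
      Integrable (fun z => f (S a ω * G ω z) * FracBS.stdNormalPDF z) ∧
      FracBS.condGain P S V b a ω =
        (∫ z, f (S a ω * G ω z) * FracBS.stdNormalPDF z) - f (S a ω)) ∧
    -- the conditional gain of the discrete strategy under transaction costs
    (Integrable (Vk b) P → ∀ᵐ ω ∂P,
      FracBS.condGain P S Vk b a ω =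
        pos i ω * FracBS.condGain P S S b a ω - k * S a ω * |FracBS.trade pre pos i ω|) := by
  subst hS hy hV hVk hG ha hb
  have hmem : ∀ j, t j ∈ Icc 0 T := fun j =>
    ⟨ht0 ▸ ht.monotone (Fin.zero_le j), htN ▸ ht.monotone (Fin.le_last j)⟩
  have hA := hmem i.castSucc
  have hB' := hmem i.succ
  have hab : t i.castSucc ≤ t i.succ := ht.monotone i.castSucc_le_succ
  have hSb := hB.integrable_assetPrice hB' S₀ μ σ
  have hSc : ∀ᵐ ω ∂P, ContinuousOn (fun u => FracBS.assetPrice S₀ μ σ B u ω)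
      (Icc 0 (t (Fin.last N))) := by
    rw [htN]
    exact hB.continuous_paths.mono fun ω hω => FracBS.continuousOn_assetPrice hω
  refine ⟨hB.exists_isWienerIntegral hH hH' hA hB' hab, fun s hs => ?_, ⟨hSb, ?_⟩, fun hfi => ?_,
    fun hVi => ?_⟩
  · filter_upwards [hB.hasForwardIntegral_leftDeriv_assetPrice hH hH' hT hS₀ μ σ hf, hSc] with
      ω h1 h2
    rw [htN] at h2
    have h3 := h2.mono (Icc_subset_Icc_right hs.2)
    exact ⟨⟨_, h1 s hs⟩, ⟨_, FracBS.hasForwardIntegral_strategyPath ht ht0 ω hs.1 h3⟩,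
      ⟨_, FracBS.hasForwardIntegral_totalVariation ht ht0 ω (htN ▸ hs.2)
        (continuousOn_const.mul h3)⟩⟩
  · filter_upwards [hB.condExp_assetPrice hH hH' hA hB' hab hS₀ μ σ (h := fun x => x)
      (by fun_prop) hSb] with ω hω
    have hpos : 0 < FracBS.assetPrice S₀ μ σ B (t i.castSucc) ω := mul_pos hS₀ (Real.exp_pos _)
    simp only [mul_assoc (FracBS.assetPrice S₀ μ σ B (t i.castSucc) ω)] at hω
    -- The general formula treats the product of `S_{t_i}` and the exponential factor; since
    -- `S_{t_i} > 0` it can be divided out.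
    refine ⟨(integrable_const_mul_iff (isUnit_iff_ne_zero.2 hpos.ne') _).1 hω.1, ?_⟩
    unfold FracBS.condGain
    rw [hω.2, integral_const_mul]
    ring
  · have hV := fun {s : ℝ} (hs : s ∈ Icc 0 T) =>
      hB.frictionlessValue_eq hH hH' hT hS₀ μ σ hf hs
    refine ⟨hfi.congr (hV hB').symm, ?_⟩
    filter_upwards [hB.condExp_assetPrice hH hH' hA hB' hab hS₀ μ σ
      (FracBS.measurable_comp_exp hf hS₀) hfi, hV hA,
      condExp_congr_ae (m := FracBS.past (FracBS.assetPrice S₀ μ σ B) (t i.castSucc)) (hV hB')]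
      with ω h1 h2 h3
    refine ⟨h1.1, ?_⟩
    unfold FracBS.condGain
    rw [h3, h1.2, h2]
  · exact FracBS.condGain_valueWithCosts ht ht0 k hv₀ hpre hpos i
      (hB.past_assetPrice_le S₀ μ σ hA.2) hSc hSb hVi
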